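/- **Setting.** Let $n\ge 0$, let $s_i=(i,i+1)$ ($1\le i\le n$) be the simple transpositions of $\mathfrak S_{n+1}$ (products are composed from right to left), and let $c$ be a standard Coxeter element, i.e. a product of $s_1,\dots,s_n$ in some order. Write $c=(i_1,\dots,i_{n+1})$ with $i_1=1$, $i_k=n+1$, place the labels $i_1,\dots,i_{n+1}$ clockwise on a circle, and put $R_c=\{i_1,\dots,i_k\}$, $L_c=\{i_k,\dots,i_{n+1},i_1\}$. Let $\mathsf{NC}(\mathfrak S_{n+1},c)$ be the set of $x$ with $\ell_T(x)+\ell_T(x^{-1}c)=\ell_T(c)$, where $\ell_T(p)$ is the least number of transpositions with product $p$. The polygons of $x$ are the supports of its nontrivial cycles. The minimum (maximum) of a polygon is called an initial (terminal) index of $x$. An index $k$ is nested in a polygon $P$ if $k\notin P$ and $\min P<k<\max P$. Let $D_x$ (resp. $U_x$) be the set of non-fixed points of $x$ that are not terminal (resp. not initial). **The map $\varphi$.** Let $M_x=D_x\cap U_x\cap L_c$ and let $N_x$ be the set of $k\in L_c$ that are fixed by $x$ and nested in some polygon of $x$. Each $k\in N_x$ is nested in exactly one polygon $P$ of $x$ such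 that $P\cup\{k\}$ crosses no other polygon of $x$. Add every $k\in N_x$ as a vertex to that polygon and then remove all vertices in $M_x$; $\mathsf{inv}_c(x)$ is the product of the disjoint cycles obtained by reading each resulting polygon clockwise. Writing $D_{\mathsf{inv}_c(x)}=\{d_1<\dots<d_m\}$ and $U_{\mathsf{inv}_c(x)}=\{u_1<\dots<u_m\}$, put $$\varphi(x)=(s_{u_1-1}s_{u_1-2}\cdots s_{d_1})\cdots(s_{u_m-1}s_{u_m-2}\cdots s_{d_m}).$$ **Standard forms.** Order the polygons of $x$ by the order in which their initial indices are met going counterclockwise around the circle from $n+1$. For each polygon $\{e_1<\dots<e_r\}$ in this order, write the corresponding cycle of $x$ as the product of the transpositions $(e_1,e_2),\dots,(e_{r-1},e_r)$, each used once, in a suitable order (possibly not unique). Concatenate these expressions and replace each transposition $(i,j)$, $i<j$, by the syllable $s_{j-1}\cdots s_{i+1}\,s_i\,s_{i+1}\cdots s_{j-1}$, whose center is $s_i$ and whose left and right parts are the words before and after the center. Any word $m_x^c$ so obtained is a standard form of $x$. The word $w_x^c$ is the subword of $m_x^c$ to which every syllable contributes each of its letters exactly once: its center, and every other letter $s_i$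 in it from - its left part if $s_i$ is the center of some syllable of $m_x^c$ and $i\in L_c$, or if $s_i$ is not the center of any syllable and $i\in R_c$; - its right part if $s_i$ is the center of some syllable of $m_x^c$ and $i\in R_c$, or if $s_i$ is not the center of any syllable and $i\in L_c$. **Theorem.** Let $x\in\mathsf{NC}(\mathfrak S_{n+1},c)$. Then $x$ has a standard form, and for every standard form $m_x^c$ of $x$ the extracted word $w_x^c$ is a reduced word in $s_1,\dots,s_n$ (no shorter word represents the same permutation), the permutation it represents is fully commutative (any two of its reduced words are related by a sequence of commutations of adjacent letters), and this permutation equals $\varphi(x)$. -/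

import Mathlib

namespace NCFC

open Equiv

/-! The points `1, …, n + 1` are the elements `0, …, n` of `Fin (n + 1)`, in the same order, and the
simple transpositions `s_1, …, s_n` are indexed by `Fin n`: the letter `k` stands for the transposition
of the points `k.castSucc` and `k.succ`, so `s_i` is the letter whose point `castSucc` is the `i`-th
point. Permutations are composed from right to left. -/

/-! ### Words, reduced words, fully commutative elements -/

/-- The simple transposition exchanging the points `k` and `k + 1`. -/
def s {n : ℕ} (k : Fin n) : Perm (Fin (n + 1)) := swap k.castSucc k.succ

/-- The permutation represented by a word in the simple transpositions. -/
def wordProd {n : ℕ} (w : List (Fin n)) : Perm (Fin (n + 1)) := (w.map s).prod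

/-- `w` is a reduced word: no word representing the same permutation is shorter. -/
def IsReduced {n : ℕ} (w : List (Fin n)) : Prop :=
  ∀ v : List (Fin n), wordProd v = wordProd w → w.length ≤ v.length

/-- `v` is obtained from `u` by exchanging two adjacent commuting letters. -/
def CommStep {n : ℕ} (u v : List (Fin n)) : Prop :=
  ∃ (a b : List (Fin n)) (i j : Fin n),
    Commute (s i) (s j) ∧ u = a ++ i :: j :: b ∧ v = a ++ j :: i :: b

/-- Any two reduced words of `p` are related by a sequence of commutations of adjacent letters. -/
def IsFullyCommutative {n : ℕ} (p : Perm (Fin (n + 1))) : Prop :=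
  ∀ u v : List (Fin n), IsReduced u → IsReduced v → wordProd u = p → wordProd v = p →
    Relation.ReflTransGen CommStep u v

/-! ### Standard Coxeter elements and noncrossing partitions -/

/-- A standard Coxeter element: the product of all simple transpositions in some order. -/
def IsStdCoxeter {n : ℕ} (c : Perm (Fin (n + 1))) : Prop :=
  ∃ l : List (Fin n), l.Perm (List.finRange n) ∧ wordProd l = c

/-- The reflection length: the least number of transpositions with product `p`. -/
noncomputable def reflLength {n : ℕ} (p : Perm (Fin (n + 1))) : ℕ :=
  sInf {k | ∃ l : List (Perm (Fin (n + 1))), (∀ t ∈ l, t.IsSwap) ∧ l.prod = p ∧ l.length = k}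

/-- The absolute order. -/
def AbsLE {n : ℕ} (u v : Perm (Fin (n + 1))) : Prop :=
  reflLength u + reflLength (u⁻¹ * v) = reflLength v

/-- The noncrossing partitions for `c`: the order ideal of `c` in the absolute order. -/
def NC {n : ℕ} (c : Perm (Fin (n + 1))) : Set (Perm (Fin (n + 1))) := {x | AbsLE x c}

/-! ### The circle -/

/-- The labels in clockwise order on the circle, `[i_1, …, i_{n+1}]`, where `c = (i_1, …, i_{n+1})`
and `i_1` is the smallest point. -/
def circle {n : ℕ} (c : Perm (Fin (n + 1))) : List (Fin (n + 1)) :=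
  (List.range (n + 1)).map fun j => (c ^ j) 0

/-- The labels in counterclockwise order, starting from the largest point. -/
def ccwCircle {n : ℕ} (c : Perm (Fin (n + 1))) : List (Fin (n + 1)) :=
  (List.range (n + 1)).map fun j => ((c⁻¹) ^ j) (Fin.last n)

/-- The clockwise position of a point, starting from the smallest point, which has position `0`. -/
def pos {n : ℕ} (c : Perm (Fin (n + 1))) (v : Fin (n + 1)) : ℕ := (circle c).idxOf v

/-- The right part of the circle: the points met clockwise from the smallest to the largest point. -/
def R {n : ℕ} (c : Perm (Fin (n + 1))) : Finset (Fin (n + 1)) :=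
  Finset.univ.filter fun v => pos c v ≤ pos c (Fin.last n)

/-- The left part of the circle: the points met clockwise from the largest to the smallest point. -/
def L {n : ℕ} (c : Perm (Fin (n + 1))) : Finset (Fin (n + 1)) :=
  Finset.univ.filter fun v => v = 0 ∨ pos c (Fin.last n) ≤ pos c v

/-- The polygons `P` and `Q` cross: there are vertices `a, b` of `P` and `u, v` of `Q` met in the order
`a, u, b, v` or `u, a, v, b` along the circle. -/
def Cross {n : ℕ} (c : Perm (Fin (n + 1))) (P Q : Finset (Fin (n + 1))) : Prop :=
  ∃ a ∈ P, ∃ b ∈ P, ∃ u ∈ Q, ∃ v ∈ Q,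
    (pos c a < pos c u ∧ pos c u < pos c b ∧ pos c b < pos c v) ∨
    (pos c u < pos c a ∧ pos c a < pos c v ∧ pos c v < pos c b)

/-! ### Polygons -/

/-- The polygons of `x`, as vertex sets: the supports of the nontrivial cycles of `x`. -/
def Pol {n : ℕ} (x : Perm (Fin (n + 1))) : Finset (Finset (Fin (n + 1))) :=
  x.cycleFactorsFinset.image Perm.support

/-- `v` is the smallest vertex of a polygon of `x`. -/
def IsInitial {n : ℕ} (x : Perm (Fin (n + 1))) (v : Fin (n + 1)) : Prop :=
  ∃ P ∈ Pol x, v ∈ P ∧ ∀ u ∈ P, v ≤ u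

/-- `v` is the largest vertex of a polygon of `x`. -/
def IsTerminal {n : ℕ} (x : Perm (Fin (n + 1))) (v : Fin (n + 1)) : Prop :=
  ∃ P ∈ Pol x, v ∈ P ∧ ∀ u ∈ P, u ≤ v

/-- `k` is nested in `P`: it is not a vertex of `P` and `min P < k < max P`. -/
def Nested {n : ℕ} (k : Fin (n + 1)) (P : Finset (Fin (n + 1))) : Prop :=
  k ∉ P ∧ (∃ a ∈ P, a < k) ∧ (∃ b ∈ P, k < b)

open scoped Classical in
/-- The vertices of polygons of `x` that are not terminal. -/
noncomputable def D {n : ℕ} (x : Perm (Fin (n + 1))) : Finset (Fin (n + 1)) :=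
  x.support.filter fun v => ¬ IsTerminal x v

open scoped Classical in
/-- The vertices of polygons of `x` that are not initial. -/
noncomputable def U {n : ℕ} (x : Perm (Fin (n + 1))) : Finset (Fin (n + 1)) :=
  x.support.filter fun v => ¬ IsInitial x v

/-! ### The involution -/

/-- The vertices on the left part that are neither initial nor terminal. -/
noncomputable def M {n : ℕ} (c x : Perm (Fin (n + 1))) : Finset (Fin (n + 1)) := D x ∩ U x ∩ L c

open scoped Classical in
/-- The points of the left part that are not vertices but are nested in some polygon. -/
noncomputable def N {n : ℕ} (c x : Perm (Fin (n + 1))) : Finset (Fin (n + 1)) :=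
  (L c).filter fun k => k ∉ x.support ∧ ∃ P ∈ Pol x, Nested k P

open scoped Classical in
/-- The polygon `P` of `x` enlarged by all `k ∈ N c x` that are nested in `P` and for which adding the
vertex `k` to `P` keeps the diagram noncrossing. -/
noncomputable def enlarge {n : ℕ} (c x : Perm (Fin (n + 1))) (P : Finset (Fin (n + 1))) :
    Finset (Fin (n + 1)) :=
  P ∪ (N c x).filter fun k => Nested k P ∧ ∀ Q ∈ Pol x, Q ≠ P → ¬ Cross c (insert k P) Q

/-- The cycle through the vertices of `B` in clockwise order. -/
def blockCycle {n : ℕ} (c : Perm (Fin (n + 1))) (B : Finset (Fin (n + 1))) : Perm (Fin (n + 1)) :=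
  ((circle c).filter fun v => v ∈ B).formPerm

open scoped Classical in
/-- The cycles of `x` in the order of its polygons: `P` comes before `Q` if, going counterclockwise from
the largest point, the initial vertex of `P` is met before that of `Q`. -/
noncomputable def cycleList {n : ℕ} (c x : Perm (Fin (n + 1))) : List (Perm (Fin (n + 1))) :=
  ((ccwCircle c).filter fun v => decide (IsInitial x v)).map x.cycleOf

/-- The involution: enlarge every polygon by the points of `N c x`, remove the vertices in `M c x`, and
take the (disjoint) product of the clockwise cycles of the resulting polygons. -/
noncomputable def inv {n : ℕ} (c x : Perm (Fin (n + 1))) : Perm (Fin (n + 1)) :=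
  ((cycleList c x).map fun σ => blockCycle c (enlarge c x σ.support \ M c x)).prod

/-! ### The map to permutations -/

/-- The word `s_{u-1} s_{u-2} ⋯ s_d` for the points `d < u`. -/
def desc {n : ℕ} (d u : Fin (n + 1)) : List (Fin n) :=
  ((List.finRange n).filter fun k => d ≤ k.castSucc ∧ k.castSucc < u).reverse

/-- For `A = {d_1 < ⋯ < d_k}` and `B = {u_1 < ⋯ < u_k}`, the permutation with normal form
`(s_{u_1 - 1} ⋯ s_{d_1}) ⋯ (s_{u_k - 1} ⋯ s_{d_k})`. -/
def g {n : ℕ} (A B : Finset (Fin (n + 1))) : Perm (Fin (n + 1)) :=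
  wordProd ((List.zipWith desc (A.sort (· ≤ ·)) (B.sort (· ≤ ·))).flatten)

/-- The map from noncrossing partitions to fully commutative permutations built from `inv`. -/
noncomputable def phi {n : ℕ} (c x : Perm (Fin (n + 1))) : Perm (Fin (n + 1)) :=
  g (D (inv c x)) (U (inv c x))

/-! ### Standard forms and extraction of the subword -/

/-- A distinguished expression of a cycle `σ` with support `{d_1 < ⋯ < d_k}`: the transpositions
`(d_i, d_{i+1})`, each used once, in an order such that their product is `σ`. -/
def IsDistinguished {n : ℕ} (σ : Perm (Fin (n + 1))) (t : List (Fin (n + 1) × Fin (n + 1))) : Prop :=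
  t.Perm ((σ.support.sort (· ≤ ·)).zip (σ.support.sort (· ≤ ·)).tail) ∧
    (t.map fun p => swap p.1 p.2).prod = σ

/-- `t` lists the transpositions `(i, j)`, `i < j`, of the successive syllables of a standard form of
`x`: it is the concatenation of distinguished expressions of the cycles of `x`, in their order. -/
def IsStandardForm {n : ℕ} (c x : Perm (Fin (n + 1))) (t : List (Fin (n + 1) × Fin (n + 1))) : Prop :=
  ∃ ts : List (List (Fin (n + 1) × Fin (n + 1))),
    List.Forall₂ IsDistinguished (cycleList c x) ts ∧ t = ts.flatten

/-- The center `s_i` of the syllable of `(i, j)`. -/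
def centerPart {n : ℕ} (p : Fin (n + 1) × Fin (n + 1)) : List (Fin n) :=
  (List.finRange n).filter fun k => k.castSucc = p.1

/-- The right part `s_{i+1} ⋯ s_{j-1}` of the syllable of `(i, j)`. -/
def rightPart {n : ℕ} (p : Fin (n + 1) × Fin (n + 1)) : List (Fin n) :=
  (List.finRange n).filter fun k => p.1 < k.castSucc ∧ k.castSucc < p.2

/-- The left part `s_{j-1} ⋯ s_{i+1}` of the syllable of `(i, j)`. -/
def leftPart {n : ℕ} (p : Fin (n + 1) × Fin (n + 1)) : List (Fin n) := (rightPart p).reverse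

/-- The syllable `s_{j-1} ⋯ s_{i+1} s_i s_{i+1} ⋯ s_{j-1}` of `(i, j)`. -/
def syllable {n : ℕ} (p : Fin (n + 1) × Fin (n + 1)) : List (Fin n) :=
  leftPart p ++ centerPart p ++ rightPart p

/-- The standard form as a word in the simple transpositions. -/
def standardWord {n : ℕ} (t : List (Fin (n + 1) × Fin (n + 1))) : List (Fin n) := t.flatMap syllable

/-- The letter `k` is the center of a syllable. -/
def IsCenter {n : ℕ} (t : List (Fin (n + 1) × Fin (n + 1))) (k : Fin n) : Prop :=
  ∃ p ∈ t, k ∈ centerPart p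

/-- Letters which the syllables contribute from their left part. -/
def FromLeft {n : ℕ} (c : Perm (Fin (n + 1))) (t : List (Fin (n + 1) × Fin (n + 1))) (k : Fin n) :
    Prop :=
  (IsCenter t k ∧ k.castSucc ∈ L c) ∨ (¬ IsCenter t k ∧ k.castSucc ∈ R c)

/-- Letters which the syllables contribute from their right part. -/
def FromRight {n : ℕ} (c : Perm (Fin (n + 1))) (t : List (Fin (n + 1) × Fin (n + 1))) (k : Fin n) :
    Prop :=
  (IsCenter t k ∧ k.castSucc ∈ R c) ∨ (¬ IsCenter t k ∧ k.castSucc ∈ L c)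

open scoped Classical in
/-- The subword contributed by the syllable of `p`: its center, and every other letter of the syllable
either from the left part or from the right part. -/
noncomputable def contribution {n : ℕ} (c : Perm (Fin (n + 1)))
    (t : List (Fin (n + 1) × Fin (n + 1))) (p : Fin (n + 1) × Fin (n + 1)) : List (Fin n) :=
  (leftPart p).filter (fun k => decide (FromLeft c t k)) ++ centerPart p ++
    (rightPart p).filter (fun k => decide (FromRight c t k))

/-- The subword extracted from the standard form. -/
noncomputable def extractedWord {n : ℕ} (c : Perm (Fin (n + 1)))
    (t : List (Fin (n + 1) × Fin (n + 1))) : List (Fin n) :=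
  t.flatMap (contribution c t)

/-- The extracted word is a subword of the standard form. -/
theorem extractedWord_sublist {n : ℕ} (c : Perm (Fin (n + 1)))
    (t : List (Fin (n + 1) × Fin (n + 1))) : (extractedWord c t).Sublist (standardWord t) := by
  have h : ∀ u : List (Fin (n + 1) × Fin (n + 1)),
      (u.flatMap (contribution c t)).Sublist (u.flatMap syllable) := by
    intro u
    induction u with
    | nil => simp
    | cons p u ih =>
      simp only [List.flatMap_cons]
      refine List.Sublist.append ?_ ih
      exact ((List.filter_sublist).append (List.Sublist.refl _)).append List.filter_sublist
  exact h t

end NCFC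

/-! The extracted word and the normal form behind `phi` are compared through their projections. By
`prod_map_eq_of_projections`, two words have the same product if they contain each letter equally
often and have the same restriction to each pair of noncommuting letters, here two consecutive
letters `a`, `b` with common point `k`.

Counts: join consecutive vertices of every polygon by edges. A letter occurs once for each edge
passing over it, so its count is a difference of numbers of elements of `D x` and `U x` below a
bound. The involution removes `M c x` and adds `N c x` in both `D` and `U` (`mem_D_inv`,
`mem_U_inv`), so the difference is unchanged and is also the count in the normal form
(`IsEdgeList.count_eq`).

Restrictions: in the normal form the letters `a`, `b` alternate as `(ba)^m`, preceded by `a` if `k ∈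
U (inv c x)` and followed by `b` if `k ∈ D (inv c x)`. In the extracted word every polygon nesting
`k` contributes the same block `ab` or `ba`, and the polygon through `k` contributes `a`, `b`, `ab`
or `ba`. The left/right rule and the order of the polygons make the result alternate too. On the
left side, `(ab)^(m+1) = a(ba)^m b` at a nested fixed point accounts for `N`, and `(ba)^m` at an
intermediate vertex accounts for `M` (`flatMap_polygonWord`). Equal counts then give equal
exponents.

Reducedness and full commutativity come from the total displacement, which grows by at most 2 per
letter. Words attaining the bound (`Tight`) are reduced, and the possible first letters of tight
words of one permutation are pairwise nonadjacent, so such words differ by commutations. The normal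
form is tight because it carries each `d_i` to `u_i`; the extracted word has the same product and
length.

The geometry rests on two facts: the cycle of `c` climbs the right side and descends the left side
(`wordProd_apply_lt_of_le`), and elements of `NC c` have clockwise noncrossing cycles
(`ArcInvariant`), since they arise from `c` by successively splitting cycles. -/

namespace NCFC

open Equiv

/-! ### Words with the same projections -/

/-- Two words with the same letters, whose projections to every pair of noncommuting letters agree,
have the same product. -/
theorem prod_map_eq_of_projections {α G : Type*} [DecidableEq α] [Monoid G] (f : α → G) :
    ∀ u v : List α, (∀ i, u.count i = v.count i) →
      (∀ i j, i ≠ j → ¬ Commute (f i) (f j) →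
        u.filter (fun x => decide (x = i ∨ x = j)) = v.filter (fun x => decide (x = i ∨ x = j))) →
      (u.map f).prod = (v.map f).prod := by
  intro u
  induction u with
  | nil =>
    intro v hc _
    have : v = [] := by
      rw [List.eq_nil_iff_forall_not_mem]
      intro a ha
      have := hc a
      have h2 := List.count_pos_iff.2 ha
      simp at this
      omega
    simp [this]
  | cons a u ih =>
    intro v hc hp
    have ha : a ∈ v := by
      rw [← List.count_pos_iff, ← hc a]
      simp
    obtain ⟨v1, v2, rfl, hav⟩ : ∃ v1 v2, v = v1 ++ a :: v2 ∧ a ∉ v1 := by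
      obtain ⟨v1, v2, h1, h2⟩ := List.eq_append_cons_of_mem ha
      exact ⟨v1, v2, h1, h2⟩
    -- `v1` precedes the first `a` in `v`. A letter of `v1` not commuting with `a` would make the
    -- projection of `v` to that pair start with a letter other than `a`, while that of `a :: u`
    -- starts with `a`. So `a` can be moved to the front of `v` and cancelled.
    have hcomm : ∀ b ∈ v1, Commute (f a) (f b) := by
      intro b hb
      by_contra hab
      have hne : a ≠ b := by rintro rfl; exact hav hb
      have h := hp a b hne hab
      rw [List.filter_cons_of_pos (by simp), List.filter_append] at h
      have hb' : b ∈ v1.filter (fun x => decide (x = a ∨ x = b)) := by simp [hb]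
      rcases hv : v1.filter (fun x => decide (x = a ∨ x = b)) with _ | ⟨y, ys⟩
      · rw [hv] at hb'; simp at hb'
      · rw [hv] at h
        have hy : y = a := by simp at h; exact h.1.symm
        have : y ∈ v1.filter (fun x => decide (x = a ∨ x = b)) := by rw [hv]; simp
        rw [hy] at this
        exact hav (List.mem_of_mem_filter this)
    have hprod : Commute (f a) (v1.map f).prod := by
      apply Commute.list_prod_right
      intro y hy
      obtain ⟨b, hb, rfl⟩ := List.mem_map.1 hy
      exact hcomm b hb
    have key : (u.map f).prod = ((v1 ++ v2).map f).prod := by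
      apply ih
      · intro i
        have := hc i
        simp only [List.count_cons, List.count_append] at this ⊢
        omega
      · intro i j hij hn
        have h := hp i j hij hn
        by_cases hai : a = i ∨ a = j
        · rw [List.filter_cons_of_pos (by simpa using hai), List.filter_append,
            List.filter_cons_of_pos (by simpa using hai)] at h
          have h0 : v1.filter (fun x => decide (x = i ∨ x = j)) = [] := by
            rw [List.filter_eq_nil_iff]
            intro b hb hbij
            simp only [decide_eq_true_eq] at hbij
            have hba : b ≠ a := by rintro rfl; exact hav hb
            have hcab := hcomm b hb
            rcases hai with rfl | rfl <;> rcases hbij with rfl | rfl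
            · exact hba rfl
            · exact hn hcab
            · exact hn hcab.symm
            · exact hba rfl
          rw [List.filter_append, h0]
          rw [h0] at h
          simpa using h
        · rw [List.filter_cons_of_neg (by simpa using hai), List.filter_append,
            List.filter_cons_of_neg (by simpa using hai)] at h
          rw [List.filter_append, h]
    rw [List.map_cons, List.prod_cons, key, List.map_append, List.prod_append, List.map_append,
      List.prod_append, List.map_cons, List.prod_cons, ← mul_assoc, ← mul_assoc, hprod.eq]

/-! ### Total displacement and fully commutative words -/

variable {n : ℕ}

@[simp] theorem wordProd_nil : wordProd ([] : List (Fin n)) = 1 := rfl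

@[simp] theorem wordProd_cons (k : Fin n) (w : List (Fin n)) :
    wordProd (k :: w) = s k * wordProd w := by
  simp [wordProd]

theorem wordProd_append (u v : List (Fin n)) : wordProd (u ++ v) = wordProd u * wordProd v := by
  simp [wordProd]

@[simp] theorem s_mul_s (k : Fin n) : s k * s k = 1 := swap_mul_self _ _

theorem s_castSucc (k : Fin n) : s k k.castSucc = k.succ := swap_apply_left _ _

theorem s_succ (k : Fin n) : s k k.succ = k.castSucc := swap_apply_right _ _

theorem s_of_ne {k : Fin n} {v : Fin (n + 1)} (h1 : (v : ℕ) ≠ k) (h2 : (v : ℕ) ≠ k + 1) :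
    s k v = v := by
  apply swap_apply_of_ne_of_ne
  · intro h; apply h1; simp [h]
  · intro h; apply h2; simp [h]

theorem commute_s {i j : Fin n} (h : (i : ℕ) + 1 < j ∨ (j : ℕ) + 1 < i) : Commute (s i) (s j) := by
  apply Perm.Disjoint.commute
  intro v
  by_cases hv : (v : ℕ) = i ∨ (v : ℕ) = i + 1
  · right; exact s_of_ne (by omega) (by omega)
  · left; exact s_of_ne (by omega) (by omega)

/-- The total displacement of a permutation. -/
def disp (p : Perm (Fin (n + 1))) : ℤ := ∑ v, |((p v : ℕ) : ℤ) - (v : ℕ)|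

theorem disp_one : disp (1 : Perm (Fin (n + 1))) = 0 := by simp [disp]

theorem disp_eq_inv (p : Perm (Fin (n + 1))) :
    disp p = ∑ y : Fin (n + 1), |((y : ℕ) : ℤ) - (p⁻¹ y : ℕ)| := by
  rw [disp, ← Equiv.sum_comp p (fun y : Fin (n + 1) => |((y : ℕ) : ℤ) - (p⁻¹ y : ℕ)|)]
  simp

/-- Left multiplication exchanges two values, so in the sum indexed by values only two terms change,
each by at most 1. -/
theorem disp_s_mul (k : Fin n) (p : Perm (Fin (n + 1))) :
    disp (s k * p) = disp p +
      ((|(k : ℤ) + 1 - (p⁻¹ k.castSucc : ℕ)| - |(k : ℤ) - (p⁻¹ k.castSucc : ℕ)|) +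
        (|(k : ℤ) - (p⁻¹ k.succ : ℕ)| - |(k : ℤ) + 1 - (p⁻¹ k.succ : ℕ)|)) := by
  have h1 : disp (s k * p) = ∑ y : Fin (n + 1), |((s k y : ℕ) : ℤ) - (p⁻¹ y : ℕ)| := by
    rw [disp, ← Equiv.sum_comp p (fun y : Fin (n + 1) => |((s k y : ℕ) : ℤ) - (p⁻¹ y : ℕ)|)]
    simp
  rw [h1, disp_eq_inv p, ← sub_eq_iff_eq_add', ← Finset.sum_sub_distrib,
    Fintype.sum_eq_add k.castSucc k.succ (by simp [Fin.ext_iff])]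
  · rw [s_castSucc, s_succ]; simp
  · rintro v ⟨hv1, hv2⟩
    rw [s_of_ne]
    · simp
    · intro h; exact hv1 (Fin.ext h)
    · intro h; exact hv2 (Fin.ext h)

theorem disp_s_mul_le (k : Fin n) (p : Perm (Fin (n + 1))) : disp (s k * p) ≤ disp p + 2 := by
  rw [disp_s_mul]
  have h1 := abs_add_le ((k : ℤ) - (p⁻¹ k.castSucc : ℕ)) 1
  have h2 := abs_sub_abs_le_abs_sub ((k : ℤ) - (p⁻¹ k.succ : ℕ)) ((k : ℤ) + 1 - (p⁻¹ k.succ : ℕ))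
  have e1 : (k : ℤ) - (p⁻¹ k.castSucc : ℕ) + 1 = (k : ℤ) + 1 - (p⁻¹ k.castSucc : ℕ) := by ring
  have e2 : (k : ℤ) - (p⁻¹ k.succ : ℕ) - ((k : ℤ) + 1 - (p⁻¹ k.succ : ℕ)) = -1 := by ring
  rw [e1] at h1
  rw [e2] at h2
  rw [abs_one] at h1
  rw [abs_neg, abs_one] at h2
  linarith

theorem disp_wordProd_le (w : List (Fin n)) : disp (wordProd w) ≤ 2 * w.length := by
  induction w with
  | nil => simp [disp_one]
  | cons k w ih =>
    have := disp_s_mul_le k (wordProd w)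
    simp only [wordProd_cons, List.length_cons]
    push_cast
    linarith

/-- The displacement of the permutation represented by `w` is as large as possible. -/
def Tight (w : List (Fin n)) : Prop := disp (wordProd w) = 2 * w.length

/-- The displacement depends on the permutation only and bounds the length of each of its words from
below. -/
theorem Tight.isReduced {w : List (Fin n)} (h : Tight w) : IsReduced w := by
  intro v hv
  have := disp_wordProd_le v
  rw [hv, h] at this
  omega

theorem Tight.of_cons {k : Fin n} {w : List (Fin n)} (h : Tight (k :: w)) : Tight w := by
  have h1 := disp_s_mul_le k (wordProd w)
  have h2 := disp_wordProd_le w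
  unfold Tight at h ⊢
  simp only [wordProd_cons, List.length_cons] at h
  push_cast at h
  linarith

/-- Multiplication by `s k` on the left lowers the displacement of `p`. -/
def Drops (k : Fin n) (p : Perm (Fin (n + 1))) : Prop :=
  (k : ℕ) < (p⁻¹ k.castSucc : ℕ) ∧ (p⁻¹ k.succ : ℕ) ≤ k

/-- Removing the first letter must lose exactly 2, which forces each of the two changing terms to
drop by 1. -/
theorem Tight.drops {k : Fin n} {w : List (Fin n)} (h : Tight (k :: w)) :
    Drops k (wordProd (k :: w)) := by
  have h1 := h.of_cons
  have h2 := disp_s_mul k (wordProd (k :: w))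
  unfold Tight at h h1
  have h3 : s k * wordProd (k :: w) = wordProd w := by
    rw [wordProd_cons, ← mul_assoc, s_mul_s, one_mul]
  rw [h3, h, h1, List.length_cons] at h2
  push_cast at h2
  unfold Drops
  generalize ((wordProd (k :: w))⁻¹ k.castSucc : ℕ) = a at *
  generalize ((wordProd (k :: w))⁻¹ k.succ : ℕ) = b at *
  rcases abs_cases ((k : ℤ) + 1 - a) with h4 | h4 <;> rcases abs_cases ((k : ℤ) - a) with h5 | h5 <;>
  rcases abs_cases ((k : ℤ) + 1 - b) with h6 | h6 <;> rcases abs_cases ((k : ℤ) - b) with h7 | h7 <;>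
  omega

/-- The value shared by two adjacent letters would have to sit both at or before `i` and after `j`.
This excludes braid relations. -/
theorem Drops.not_adjacent {i j : Fin n} {p : Perm (Fin (n + 1))} (hi : Drops i p)
    (hj : Drops j p) : (i : ℕ) + 1 ≠ j := by
  intro h
  have h1 := hi.2
  have h2 := hj.1
  have : j.castSucc = i.succ := Fin.ext (by simp [← h])
  rw [this] at h2
  omega

theorem CommStep.cons {u v : List (Fin n)} (k : Fin n) (h : CommStep u v) :
    CommStep (k :: u) (k :: v) := by
  obtain ⟨a, b, i, j, hij, rfl, rfl⟩ := h
  exact ⟨k :: a, b, i, j, hij, rfl, rfl⟩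

theorem CommStep.wordProd_eq {u v : List (Fin n)} (h : CommStep u v) : wordProd u = wordProd v := by
  obtain ⟨a, b, i, j, hij, rfl, rfl⟩ := h
  simp only [wordProd_append, wordProd_cons]
  rw [← mul_assoc (s i), hij.eq, mul_assoc]

theorem CommStep.length_eq {u v : List (Fin n)} (h : CommStep u v) : u.length = v.length := by
  obtain ⟨a, b, i, j, hij, rfl, rfl⟩ := h
  simp

theorem commSteps_cons {u v : List (Fin n)} (k : Fin n) (h : Relation.ReflTransGen CommStep u v) :
    Relation.ReflTransGen CommStep (k :: u) (k :: v) := by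
  induction h with
  | refl => exact Relation.ReflTransGen.refl
  | tail _ h ih => exact ih.tail (h.cons k)

theorem commSteps_inv {u v : List (Fin n)} (h : Relation.ReflTransGen CommStep u v) :
    wordProd u = wordProd v ∧ u.length = v.length := by
  induction h with
  | refl => exact ⟨rfl, rfl⟩
  | tail _ h ih => exact ⟨ih.1.trans h.wordProd_eq, ih.2.trans h.length_eq⟩

theorem Tight.of_commSteps {u v : List (Fin n)} (hu : Tight u)
    (h : Relation.ReflTransGen CommStep u v) : Tight v := by
  obtain ⟨h1, h2⟩ := commSteps_inv h
  unfold Tight at *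
  rw [← h1, ← h2, hu]

theorem Drops.s_mul {i j : Fin n} {p : Perm (Fin (n + 1))} (hi : Drops i p)
    (h : (i : ℕ) + 1 < j ∨ (j : ℕ) + 1 < i) : Drops i (s j * p) := by
  unfold Drops at *
  have e : (s j)⁻¹ = s j := swap_inv _ _
  rw [mul_inv_rev, e, Perm.mul_apply, Perm.mul_apply, s_of_ne, s_of_ne]
  · exact hi
  all_goals simp; omega

/-- A letter that lowers the displacement can be moved to the front. -/
theorem Tight.exists_cons {k : Fin n} {w : List (Fin n)} (h : Tight w)
    (hk : Drops k (wordProd w)) : ∃ w', Relation.ReflTransGen CommStep w (k :: w') := by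
  induction w with
  | nil =>
    have := hk.1
    simp at this
  | cons b w ih =>
    by_cases hkb : k = b
    · subst hkb; exact ⟨w, Relation.ReflTransGen.refl⟩
    -- Both `k` and the first letter `b` lower the displacement, so they are not adjacent and
    -- commute; `k` still lowers it after `b` is removed.
    have hb := h.drops
    have h1 := hk.not_adjacent hb
    have h2 := hb.not_adjacent hk
    have hne : (k : ℕ) ≠ b := fun h => hkb (Fin.ext h)
    have hfar : (k : ℕ) + 1 < b ∨ (b : ℕ) + 1 < k := by omega
    have h3 := hk.s_mul hfar
    rw [wordProd_cons, ← mul_assoc, s_mul_s, one_mul] at h3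
    obtain ⟨w', hw'⟩ := ih h.of_cons h3
    exact ⟨b :: w', (commSteps_cons b hw').tail ⟨[], w', b, k, commute_s hfar.symm, rfl, rfl⟩⟩

/-- The first letter of `u` lowers the displacement of the common product, so it can be commuted to
the front of `v` and cancelled. -/
theorem Tight.commSteps {u v : List (Fin n)} (hu : Tight u) (hv : Tight v)
    (h : wordProd u = wordProd v) : Relation.ReflTransGen CommStep v u := by
  induction u generalizing v with
  | nil =>
    have h1 : disp (wordProd v) = 2 * v.length := hv
    rw [← h, wordProd_nil, disp_one] at h1
    have : v = [] := List.length_eq_zero_iff.1 (by omega)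
    rw [this]
  | cons a u ih =>
    have h1 := hu.drops
    rw [h] at h1
    obtain ⟨v', hv'⟩ := hv.exists_cons h1
    have h2 := (commSteps_inv hv').1
    have h3 : wordProd u = wordProd v' := by
      rw [← h, wordProd_cons, wordProd_cons] at h2
      exact mul_left_cancel h2
    exact hv'.trans (commSteps_cons a (ih hu.of_cons (hv.of_commSteps hv').of_cons h3))

theorem IsReduced.tight {u w : List (Fin n)} (hu : IsReduced u) (hw : Tight w)
    (h : wordProd u = wordProd w) : Tight u := by
  have h1 := hu w h.symm
  have h2 := hw.isReduced u h
  unfold Tight at *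
  rw [h, hw, le_antisymm h1 h2]

theorem Tight.isFullyCommutative {w : List (Fin n)} (h : Tight w) :
    IsFullyCommutative (wordProd w) := by
  intro u v hu hv hup hvp
  exact (hv.tight h hvp).commSteps (hu.tight h hup) (hvp.trans hup.symm)

end NCFC

namespace NCFC

open Equiv

variable {n : ℕ}

/-! ### The cycle of a standard Coxeter element -/

/-- Only the letter `k` carries points across the gap between `k` and `k + 1`. -/
theorem wordProd_apply_le_iff {k : Fin n} {l : List (Fin n)} (hk : k ∉ l) (v : Fin (n + 1)) :
    (wordProd l v : ℕ) ≤ k ↔ (v : ℕ) ≤ k := by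
  induction l with
  | nil => simp
  | cons a l ih =>
    simp only [List.mem_cons, not_or] at hk
    rw [wordProd_cons, Perm.mul_apply, ← ih hk.2]
    have hne : (k : ℕ) ≠ a := fun h => hk.1 (Fin.ext h)
    generalize wordProd l v = y
    by_cases h1 : (y : ℕ) = a
    · have : y = a.castSucc := Fin.ext h1
      rw [this, s_castSucc]
      simp; omega
    · by_cases h2 : (y : ℕ) = a + 1
      · have : y = a.succ := Fin.ext h2
        rw [this, s_succ]
        simp; omega
      · rw [s_of_ne h1 h2]

/-- A cycle that has started to descend keeps descending. Write `l = A ++ j :: B`. The image of `v`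
never crosses below the gap of `j`, so it lies above `j + 1` after `B`, and `A` must contain the
letter `j + 1` to bring it down. Then `B` contains neither `j` nor `j + 1` and fixes the point `j +
1`, which `j` moves down and `A` cannot lift back. -/
theorem wordProd_apply_lt_of_le {l : List (Fin n)} (hl : l.Nodup) {v : Fin (n + 1)} {j : Fin n}
    (hj : j ∈ l) (hw : wordProd l v = j.succ) (hv : j.succ ≤ v) :
    wordProd l j.succ < j.succ := by
  obtain ⟨A, B, rfl⟩ := List.append_of_mem hj
  rw [List.nodup_append] at hl
  obtain ⟨_, hB, hAB⟩ := hl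
  have hjB : j ∉ B := (List.nodup_cons.1 hB).1
  have hjA : j ∉ A := fun h => hAB j h j (by simp) rfl
  rw [wordProd_append, wordProd_cons, Perm.mul_apply, Perm.mul_apply] at hw ⊢
  have hv' : (j : ℕ) + 1 ≤ v := by simpa using (Fin.le_def.1 hv)
  have h1 : (j : ℕ) < wordProd B v := by
    have := wordProd_apply_le_iff hjB v
    omega
  have h2 : (j : ℕ) < s j (wordProd B v) := by
    have := wordProd_apply_le_iff hjA (s j (wordProd B v))
    rw [hw] at this
    simp at this
    omega
  have h3 : (wordProd B v : ℕ) ≠ j + 1 := by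
    intro h
    have : wordProd B v = j.succ := Fin.ext h
    rw [this, s_succ] at h2
    simp at h2
  rw [s_of_ne (by omega) h3] at hw
  have hlt : (j : ℕ) + 1 < n := by have := (wordProd B v).2; omega
  have h4 : (⟨j + 1, hlt⟩ : Fin n) ∈ A := by
    by_contra h
    have := wordProd_apply_le_iff h (wordProd B v)
    rw [hw] at this
    simp at this
    omega
  have h5 : (⟨j + 1, hlt⟩ : Fin n) ∉ B := fun h => hAB _ h4 _ (by simp [h]) rfl
  have h6 : wordProd B j.succ = j.succ := by
    have e1 := wordProd_apply_le_iff h5 j.succ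
    have e2 := wordProd_apply_le_iff hjB j.succ
    apply Fin.ext
    simp at e1 e2 ⊢
    omega
  rw [h6, s_succ, Fin.lt_def]
  have := wordProd_apply_le_iff hjA j.castSucc
  simp at this ⊢
  omega

theorem IsStdCoxeter.apply_le {c : Perm (Fin (n + 1))} (hc : IsStdCoxeter c) (v : Fin (n + 1))
    (hv : c v ≤ v) : c v = 0 ∨ c (c v) < c v := by
  obtain ⟨l, hl, rfl⟩ := hc
  by_cases h0 : wordProd l v = 0
  · exact Or.inl h0
  right
  obtain ⟨j, hj⟩ := Fin.exists_succ_eq.2 h0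
  rw [← hj] at hv ⊢
  exact wordProd_apply_lt_of_le (hl.nodup_iff.2 (List.nodup_finRange n))
    (hl.mem_iff.2 (List.mem_finRange j)) hj.symm hv

/-! ### Permutations whose iterates climb a height function until they return to a base point. -/

section chain

variable {c : Perm (Fin (n + 1))} {a : Fin (n + 1)} {K : Fin (n + 1) → ℕ}

/-- The height is bounded, so every orbit eventually hits `a`. -/
theorem isCycleOn_of_chain (h : ∀ v, c v = a ∨ K v < K (c v)) :
    c.IsCycleOn ((Finset.univ : Finset (Fin (n + 1))) : Set (Fin (n + 1))) := by
  have reach : ∀ v, c.SameCycle v a := by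
    obtain ⟨b, hb⟩ : ∃ b, ∀ v, K v ≤ b :=
      ⟨Finset.univ.sup K, fun v => Finset.le_sup (Finset.mem_univ v)⟩
    intro v
    induction hd : b - K v using Nat.strong_induction_on generalizing v with
    | _ d ih =>
      rcases h v with h1 | h1
      · exact ⟨1, by simpa using h1⟩
      · have h2 := ih (b - K (c v)) (by have := hb (c v); omega) (c v) rfl
        exact (Perm.sameCycle_apply_left).1 h2
  refine ⟨by simp, ?_⟩
  intro x _ y _
  exact (reach x).trans (reach y).symm

theorem chain_lt (h : ∀ v, c v = a ∨ K v < K (c v)) {i j : ℕ} (hij : i < j) (hj : j < n + 1) :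
    K ((c ^ i) a) < K ((c ^ j) a) := by
  have step : ∀ i, i + 1 < n + 1 → K ((c ^ i) a) < K ((c ^ (i + 1)) a) := by
    intro i hi
    rw [pow_succ', Perm.mul_apply]
    refine (h _).resolve_left fun h1 => ?_
    rw [← Perm.mul_apply, ← pow_succ',
      (isCycleOn_of_chain h).pow_apply_eq (Finset.mem_univ a)] at h1
    have := Nat.le_of_dvd (Nat.succ_pos i) h1
    simp at this
    omega
  induction j with
  | zero => omega
  | succ j ih =>
    rcases Nat.lt_succ_iff_lt_or_eq.1 hij with h1 | rfl
    · exact (ih h1 (by omega)).trans (step j hj)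
    · exact step i hj

theorem chain_exists (h : ∀ v, c v = a ∨ K v < K (c v)) (v : Fin (n + 1)) :
    ∃ i < n + 1, (c ^ i) a = v := by
  have := (isCycleOn_of_chain h).exists_pow_eq (Finset.mem_univ a) (Finset.mem_univ v)
  simpa using this

/-- No height lies strictly between those of a point and its image, and none above that of the
preimage of `a`. -/
theorem chain_consecutive (h : ∀ v, c v = a ∨ K v < K (c v)) (w u : Fin (n + 1)) :
    K u ≤ K w ∨ (c w ≠ a ∧ K (c w) ≤ K u) := by
  obtain ⟨i, hi, rfl⟩ := chain_exists h w
  obtain ⟨m, hm, rfl⟩ := chain_exists h u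
  rcases lt_trichotomy m i with hmi | rfl | hmi
  · exact Or.inl (chain_lt h hmi hi).le
  · exact Or.inl le_rfl
  · right
    rw [← Perm.mul_apply, ← pow_succ']
    constructor
    · intro h1
      rw [(isCycleOn_of_chain h).pow_apply_eq (Finset.mem_univ a)] at h1
      have := Nat.le_of_dvd (Nat.succ_pos i) h1
      simp at this
      omega
    · rcases Nat.lt_or_eq_of_le (Nat.succ_le_of_lt hmi) with h2 | h2
      · exact (chain_lt h h2 hm).le
      · rw [← h2]

theorem chain_pairwise (h : ∀ v, c v = a ∨ K v < K (c v)) :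
    ((List.range (n + 1)).map fun j => (c ^ j) a).Pairwise fun u v => K u < K v := by
  rw [List.pairwise_map]
  refine List.pairwise_lt_range.imp_of_mem ?_
  intro i j _ hj hij
  exact chain_lt h hij (List.mem_range.1 hj)

theorem chain_mem (h : ∀ v, c v = a ∨ K v < K (c v)) (v : Fin (n + 1)) :
    v ∈ (List.range (n + 1)).map fun j => (c ^ j) a := by
  obtain ⟨i, hi, rfl⟩ := chain_exists h v
  exact List.mem_map.2 ⟨i, List.mem_range.2 hi, rfl⟩

end chain

theorem idxOf_lt_idxOf_iff {α : Type*} [DecidableEq α] {l : List α} {K : α → ℕ}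
    (hl : l.Pairwise fun u v => K u < K v) {u v : α} (hu : u ∈ l) (hv : v ∈ l) :
    l.idxOf u < l.idxOf v ↔ K u < K v := by
  have key : ∀ u ∈ l, ∀ v ∈ l, l.idxOf u < l.idxOf v → K u < K v := by
    intro u hu v hv h
    have := List.pairwise_iff_getElem.1 hl _ _ (List.idxOf_lt_length_iff.2 hu)
      (List.idxOf_lt_length_iff.2 hv) h
    simpa using this
  refine ⟨key u hu v hv, fun h => ?_⟩
  rcases lt_trichotomy (l.idxOf u) (l.idxOf v) with h1 | h1 | h1
  · exact h1
  · rw [List.idxOf_inj hu] at h1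
    subst h1
    omega
  · have := key v hv u hu h1
    omega

/-- A height function on the circle: it increases along the clockwise order from the smallest point. -/
def ht (c : Perm (Fin (n + 1))) (v : Fin (n + 1)) : ℕ := if v ∈ R c then (v : ℕ) else 2 * n - v

/-- The counterclockwise analogue of `ht`, starting from the largest point. -/
def ccwHt (c : Perm (Fin (n + 1))) (v : Fin (n + 1)) : ℕ := if v ∈ R c then n - v else n + v

theorem ht_injective (c : Perm (Fin (n + 1))) (h : Fin.last n ∈ R c) : Function.Injective (ht c) := by
  intro u v huv
  unfold ht at huv
  have hl : ∀ w : Fin (n + 1), w ∉ R c → (w : ℕ) < n := by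
    intro w hw
    rcases Nat.lt_or_eq_of_le (Nat.lt_succ_iff.1 w.2) with h1 | h1
    · exact h1
    · exact absurd (by rwa [show w = Fin.last n from Fin.ext h1]) hw
  apply Fin.ext
  split_ifs at huv with h1 h2 h2
  · exact huv
  · have := hl v h2; omega
  · have := hl u h1; omega
  · have := hl u h1; have := hl v h2; omega

namespace IsStdCoxeter

variable {c : Perm (Fin (n + 1))}

/-- The height is first built from the descents of `c`, which by `apply_le` persist until 0 is
reached; comparing it with `n` then recovers the side of a point. -/
theorem exists_chain (hc : IsStdCoxeter c) : ∃ K : Fin (n + 1) → ℕ, (∀ v, c v = 0 ∨ K v < K (c v)) ∧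
    K (Fin.last n) = n ∧ ∀ v, K v = if K v ≤ n then (v : ℕ) else 2 * n - v := by
  refine ⟨fun v => if c v < v ∧ v ≠ Fin.last n then 2 * n - v else v, ?_, by simp, ?_⟩
  · intro v
    dsimp only
    by_cases h0 : c v = 0
    · exact Or.inl h0
    right
    by_cases h1 : c v ≤ v
    · have h2 := (hc.apply_le v h1).resolve_left h0
      have h3 : c v ≠ v := by
        intro h
        rw [h, h] at h2
        exact lt_irrefl _ h2
      have h4 : c v < v := lt_of_le_of_ne h1 h3
      have h5 : c v ≠ Fin.last n := (lt_of_lt_of_le h4 (Fin.le_last v)).ne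
      rw [if_pos (show c (c v) < c v ∧ c v ≠ Fin.last n from ⟨h2, h5⟩)]
      have := v.2
      rw [Fin.lt_def] at h4
      split_ifs <;> omega
    · rw [not_le, Fin.lt_def] at h1
      rw [if_neg (by rw [Fin.lt_def]; omega)]
      have := (c v).2
      split_ifs <;> omega
  · intro v
    have := v.2
    by_cases h : c v < v ∧ v ≠ Fin.last n
    · simp only [if_pos h]
      have : (v : ℕ) ≠ n := fun h' => h.2 (Fin.ext h')
      rw [if_neg (by omega)]
    · simp only [if_neg h]
      rw [if_pos (by omega)]

theorem structure_aux (hc : IsStdCoxeter c) : (∀ v, c v = 0 ∨ ht c v < ht c (c v)) ∧ Fin.last n ∈ R c ∧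
    (0 : Fin (n + 1)) ∈ R c ∧ ∀ u v, pos c u < pos c v ↔ ht c u < ht c v := by
  obtain ⟨K, h1, h2, h3⟩ := hc.exists_chain
  have hpos : ∀ u v, pos c u < pos c v ↔ K u < K v := fun u v =>
    idxOf_lt_idxOf_iff (chain_pairwise h1) (chain_mem h1 u) (chain_mem h1 v)
  have hR : ∀ v, v ∈ R c ↔ K v ≤ n := by
    intro v
    rw [R, Finset.mem_filter, ← not_lt, hpos, h2, not_lt]
    simp
  -- The right side consists of the points of height at most `n`, the height of the last point, so
  -- the auxiliary height is `ht c`.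
  have hK : K = ht c := by
    funext v
    rw [h3 v, ht]
    simp only [hR]
  subst hK
  refine ⟨h1, by simp [hR, h2], ?_, hpos⟩
  rw [hR]
  by_contra h0
  obtain ⟨i, _, hi⟩ := chain_exists h1 (Fin.last n)
  have h4 : ht c 0 ≤ ht c (Fin.last n) := by
    rcases Nat.eq_zero_or_pos i with rfl | hi0
    · rw [pow_zero, Perm.one_apply] at hi
      exact (congrArg (ht c) hi).le
    · rw [← hi]
      exact (chain_lt h1 hi0 (by assumption)).le
  omega

theorem last_mem_R (hc : IsStdCoxeter c) : Fin.last n ∈ R c := hc.structure_aux.2.1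

theorem zero_mem_R (hc : IsStdCoxeter c) : (0 : Fin (n + 1)) ∈ R c := hc.structure_aux.2.2.1

theorem pos_lt_iff (hc : IsStdCoxeter c) (u v : Fin (n + 1)) : pos c u < pos c v ↔ ht c u < ht c v :=
  hc.structure_aux.2.2.2 u v

theorem ht_chain (hc : IsStdCoxeter c) (v : Fin (n + 1)) : c v = 0 ∨ ht c v < ht c (c v) := hc.structure_aux.1 v

theorem mem_L (hc : IsStdCoxeter c) {v : Fin (n + 1)} : v ∈ L c ↔ v = 0 ∨ v = Fin.last n ∨ v ∉ R c := by
  rw [L, Finset.mem_filter, ← not_lt, hc.pos_lt_iff, not_lt]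
  simp only [Finset.mem_univ, true_and]
  have hl : ht c (Fin.last n) = n := by simp [ht, hc.last_mem_R]
  rw [hl]
  have := v.2
  by_cases h : v ∈ R c
  · rw [ht, if_pos h]
    simp only [h, not_true_eq_false, or_false]
    constructor
    · rintro (h1 | h1)
      · exact Or.inl h1
      · exact Or.inr (Fin.ext (by simp; omega))
    · rintro (h1 | h1)
      · exact Or.inl h1
      · right; rw [h1]; simp
  · rw [ht, if_neg h]
    simp only [h, not_false_eq_true, or_true, iff_true]
    right; omega

theorem pos_of_mem_R (hc : IsStdCoxeter c) {v : Fin (n + 1)} (hv : v ∉ R c) : 0 < (v : ℕ) ∧ (v : ℕ) < n := by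
  constructor
  · rcases Nat.eq_zero_or_pos (v : ℕ) with h | h
    · exact absurd (by rw [show v = 0 from Fin.ext h]; exact hc.zero_mem_R) hv
    · exact h
  · rcases Nat.lt_or_eq_of_le (Nat.lt_succ_iff.1 v.2) with h | h
    · exact h
    · exact absurd (by rw [show v = Fin.last n from Fin.ext h]; exact hc.last_mem_R) hv

/-- `ccwHt` is `n - ht` modulo `2n`, so it climbs along `c⁻¹` from the last point, where it
vanishes. -/
theorem ccw_chain (hc : IsStdCoxeter c) (v : Fin (n + 1)) :
    c⁻¹ v = Fin.last n ∨ ccwHt c v < ccwHt c (c⁻¹ v) := by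
  obtain ⟨w, rfl⟩ := c.surjective v
  rw [show c⁻¹ (c w) = w by simp]
  by_cases hw : w = Fin.last n
  · exact Or.inl hw
  right
  have h1 := chain_consecutive hc.ht_chain w (Fin.last n)
  have h2 := hc.ht_chain w
  have hl : ht c (Fin.last n) = n := by simp [ht, hc.last_mem_R]
  have hw' : (w : ℕ) ≠ n := fun h => hw (Fin.ext h)
  have e0 := hc.zero_mem_R
  have b1 := w.2
  have b2 := (c w).2
  rw [hl] at h1
  by_cases h0 : c w = 0
  · rw [h0] at h1 ⊢
    simp only [ne_eq, not_true_eq_false, false_and, or_false] at h1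
    unfold ht at h1
    unfold ccwHt
    rw [if_pos e0]
    by_cases hwR : w ∈ R c
    · simp only [hwR, if_true] at h1; exfalso; omega
    · have := hc.pos_of_mem_R hwR
      rw [if_neg hwR]; rw [Fin.val_zero]; omega
  · have h3 := h2.resolve_left h0
    replace h1 : n ≤ ht c w ∨ ht c (c w) ≤ n := h1.imp id And.right
    unfold ht at h1 h3
    unfold ccwHt
    by_cases h4 : w ∈ R c <;> by_cases h5 : c w ∈ R c <;> simp only [h4, h5, if_true, if_false] at h1 h3 ⊢
    · omega
    · have := hc.pos_of_mem_R h5; omega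
    · have := hc.pos_of_mem_R h4; omega
    · omega

theorem ccwCircle_pairwise (hc : IsStdCoxeter c) : (ccwCircle c).Pairwise fun u v => ccwHt c u < ccwHt c v :=
  chain_pairwise hc.ccw_chain

theorem mem_ccwCircle (hc : IsStdCoxeter c) (v : Fin (n + 1)) : v ∈ ccwCircle c := chain_mem hc.ccw_chain v

theorem mem_circle (hc : IsStdCoxeter c) (v : Fin (n + 1)) : v ∈ circle c := chain_mem hc.ht_chain v

theorem circle_nodup (hc : IsStdCoxeter c) : (circle c).Nodup :=
  (chain_pairwise hc.ht_chain).imp fun h => by rintro rfl; exact lt_irrefl _ h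

theorem ccwCircle_nodup (hc : IsStdCoxeter c) : (ccwCircle c).Nodup :=
  hc.ccwCircle_pairwise.imp fun h => by rintro rfl; exact lt_irrefl _ h

end IsStdCoxeter

/-! ### Cycles of permutations multiplied by transpositions -/

section cyclic

variable {α : Type*} [Finite α]

theorem sameCycle_induction {p : Perm α} {S : α → Prop} (hS : ∀ v, S v → S (p v)) {u v : α}
    (h : p.SameCycle u v) (hu : S u) : S v := by
  obtain ⟨i, rfl⟩ := h.exists_nat_pow_eq
  clear h
  induction i with
  | zero => simpa using hu
  | succ i ih => rw [pow_succ', Perm.mul_apply]; exact hS _ ih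

theorem sameCycle_mul_swap [DecidableEq α] {p : Perm α} {a b : α} (h : ¬ p.SameCycle a b) :
    (p * swap a b).SameCycle a b := by
  by_contra hab
  have h1 : p.SameCycle (p b) b := Perm.sameCycle_apply_left.2 (Perm.SameCycle.refl _ _)
  -- Walk along the `p`-cycle of `b` from `p b`, which is the image of `a` under the new
  -- permutation. Until the walk meets `b` the two permutations agree, so it stays in the new cycle
  -- of `a` and must end at `b`.
  have key := sameCycle_induction (p := p)
    (S := fun v => (p * swap a b).SameCycle a v ∧ p.SameCycle b v) ?_ h1 ?_
  · exact hab key.1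
  · rintro v ⟨hv1, hv2⟩
    refine ⟨?_, Perm.sameCycle_apply_right.2 hv2⟩
    have h2 : v ≠ a := by rintro rfl; exact h hv2.symm
    have h3 : v ≠ b := by rintro rfl; exact hab hv1
    have h4 : p v = (p * swap a b) v := by rw [Perm.mul_apply, swap_apply_of_ne_of_ne h2 h3]
    rw [h4]
    exact Perm.sameCycle_apply_right.2 hv1
  · refine ⟨?_, h1.symm⟩
    have h4 : p b = (p * swap a b) a := by rw [Perm.mul_apply, swap_apply_left]
    rw [h4]
    exact Perm.sameCycle_apply_right.2 (Perm.SameCycle.refl _ _)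

/-- `v` lies strictly between `i` and `j`, going clockwise (along increasing `f`) from `i` to `j`. -/
def Arc (f : α → ℕ) (i j v : α) : Prop :=
  (f i < f v ∧ f v < f j) ∨ (f v < f j ∧ f j ≤ f i) ∨ (f j ≤ f i ∧ f i < f v)

/-- Every arc from a point to its image is invariant: the cycles are clockwise and noncrossing. -/
def ArcInvariant (f : α → ℕ) (x : Perm α) : Prop :=
  ∀ i v, Arc f i (x i) v → Arc f i (x i) (x v)

namespace ArcInvariant

variable {f : α → ℕ} {x : Perm α} (hx : ArcInvariant f x)

theorem of_sameCycle (hx : ArcInvariant f x) {i u v : α} (h : x.SameCycle u v)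
    (hu : Arc f i (x i) u) : Arc f i (x i) v :=
  sameCycle_induction (hx i) h hu

/-- Otherwise the whole cycle, including `i` itself, would lie inside the arc leaving `i`. -/
theorem not_arc (hx : ArcInvariant f x) {i v : α} (h : x.SameCycle i v) : ¬ Arc f i (x i) v := by
  intro hv
  have := hx.of_sameCycle h.symm hv
  unfold Arc at this
  omega

/-- The new arc of `a` ends at `x b`. If some `x v` left it, the old arc from `v` to `x v` would
contain `x b`, hence `a`, which lies in the same cycle; clockwise from `v`, however, `x v` comes no
later than `a`. -/
theorem mul_swap_aux [DecidableEq α] (hf : Function.Injective f) (hx : ArcInvariant f x) {a b : α}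
    (hab : a ≠ b) (h : x.SameCycle a b) (v : α) (hv : Arc f a (x b) v) :
    Arc f a (x b) ((x * swap a b) v) := by
  have hxb : x.SameCycle a (x b) := Perm.sameCycle_apply_right.2 h
  have hva : v ≠ a := by rintro rfl; unfold Arc at hv; omega
  have hne : f (x a) ≠ f (x b) := fun h => hab (x.injective (hf h))
  rw [Perm.mul_apply]
  by_cases hvb : v = b
  · subst hvb
    rw [swap_apply_right]
    have h1 := hx.not_arc hxb
    have h2 : f (x a) ≠ f a := by
      intro h2
      have h3 := h.eq_of_left (hf h2)
      exact hab h3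
    unfold Arc at *
    omega
  · rw [swap_apply_of_ne_of_ne hva hvb]
    by_contra hxv
    have hvb' : f (x v) ≠ f (x b) := fun h => hvb (x.injective (hf h))
    have h1 : Arc f v (x v) (x b) := by
      unfold Arc at *
      omega
    have h2 := hx.of_sameCycle hxb.symm h1
    unfold Arc at *
    omega

/-- Splitting a cycle by a transposition of two of its points creates no crossing. -/
theorem mul_swap [DecidableEq α] (hf : Function.Injective f) (hx : ArcInvariant f x) {a b : α}
    (h : x.SameCycle a b) : ArcInvariant f (x * swap a b) := by
  by_cases hab : a = b
  · subst hab
    rwa [swap_self, ← Perm.one_def, mul_one]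
  intro i v hv
  by_cases hia : i = a
  · subst hia
    have e : (x * swap i b) i = x b := by rw [Perm.mul_apply, swap_apply_left]
    rw [e] at hv ⊢
    exact mul_swap_aux hf hx hab h v hv
  by_cases hib : i = b
  · subst hib
    have e : (x * swap a i) i = x a := by rw [Perm.mul_apply, swap_apply_right]
    rw [e] at hv ⊢
    rw [swap_comm]
    exact mul_swap_aux hf hx (Ne.symm hab) h.symm v hv
  have e : (x * swap a b) i = x i := by rw [Perm.mul_apply, swap_apply_of_ne_of_ne hia hib]
  rw [e] at hv ⊢
  rw [Perm.mul_apply]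
  apply hx
  by_cases hva : v = a
  · subst hva
    rw [swap_apply_left]
    exact hx.of_sameCycle h hv
  by_cases hvb : v = b
  · subst hvb
    rw [swap_apply_right]
    exact hx.of_sameCycle h.symm hv
  rw [swap_apply_of_ne_of_ne hva hvb]
  exact hv

/-- Distinct cycles do not cross. -/
theorem noncrossing (hf : Function.Injective f) (hx : ArcInvariant f x) {a b u v : α}
    (hab : x.SameCycle a b) (huv : x.SameCycle u v) (hau : ¬ x.SameCycle a u) :
    ¬ (f a < f u ∧ f u < f b ∧ f b < f v) ∧ ¬ (f u < f a ∧ f a < f v ∧ f v < f b) := by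
  have key : ∀ {a b : α}, x.SameCycle a b → ¬ x.SameCycle a u →
      ¬ (f u < f a ∧ f a < f v) → (f u < f b ∧ f b < f v) → False := by
    intro a b hab hau h1 h2
    have hne : ∀ p, x.SameCycle a p → f p ≠ f u ∧ f p ≠ f v := by
      intro p hp
      constructor
      · intro h; exact hau (hf h ▸ hp)
      · intro h; exact hau ((hf h ▸ hp).trans huv.symm)
    -- Follow the cycle of `a` from outside the interval between `u` and `v`. A step into it is an
    -- arc containing `u` but not `v`, which is impossible since `u` and `v` share a cycle.
    refine (sameCycle_induction (p := x)
      (S := fun p => x.SameCycle a p ∧ ¬ (f u < f p ∧ f p < f v)) ?_ hab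
      ⟨Perm.SameCycle.refl _ _, h1⟩).2 h2
    rintro p ⟨hp1, hp2⟩
    have hp3 := Perm.sameCycle_apply_right.2 hp1
    refine ⟨hp3, fun hp4 => ?_⟩
    have h5 := hne p hp1
    have h6 : Arc f p (x p) u := by unfold Arc; omega
    have h7 := hx.of_sameCycle huv h6
    unfold Arc at h7
    omega
  constructor
  · rintro ⟨h1, h2, h3⟩
    exact key hab hau (by omega) ⟨h2, h3⟩
  · rintro ⟨h1, h2, h3⟩
    exact key hab.symm (fun h => hau (hab.trans h)) (by omega) ⟨h1, h2⟩

end ArcInvariant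

end cyclic

/-! ### Minimal factorizations of a long cycle -/

section factorization

variable {α : Type*} [DecidableEq α]

theorem reachable_of_swaps {G : SimpleGraph α} {m : List (α × α)}
    (h : ∀ p ∈ m, G.Reachable p.1 p.2) (v : α) :
    G.Reachable v ((m.map fun p => swap p.1 p.2).prod v) := by
  induction m with
  | nil => simp
  | cons p m ih =>
    rw [List.map_cons, List.prod_cons, Perm.mul_apply]
    refine (ih fun q hq => h q (List.mem_cons_of_mem _ hq)).trans ?_
    generalize (m.map fun p => swap p.1 p.2).prod v = y
    have hp := h p List.mem_cons_self
    rw [swap_apply_def]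
    split_ifs with h1 h2
    · rw [h1]; exact hp
    · rw [h2]; exact hp.symm
    · exact SimpleGraph.Reachable.refl _

/-- In a factorization of a long cycle into as few transpositions as possible, no transposition joins
two points already in a common cycle. -/
theorem not_sameCycle_of_factorization [Fintype α] {c : Perm α} (hc : ∀ u v, c.SameCycle u v)
    {A B : List (α × α)} {q : α × α}
    (hprod : ((A ++ q :: B).map fun p => swap p.1 p.2).prod = c)
    (hlen : (A ++ q :: B).length < Fintype.card α) :
    ¬ (A.map fun p => swap p.1 p.2).prod.SameCycle q.1 q.2 := by
  intro hq
  -- The graph omits the edge `q`. If the factors in `A` already join its ends, the remaining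
  -- transpositions still connect everything, with too few edges for a connected graph.
  set E : Finset (Sym2 α) := ((A ++ B).map fun p => s(p.1, p.2)).toFinset with hE
  set G := SimpleGraph.fromEdgeSet (E : Set (Sym2 α)) with hG
  have hr : ∀ p ∈ A ++ B, G.Reachable p.1 p.2 := by
    intro p hp
    by_cases hpe : p.1 = p.2
    · rw [hpe]
    · apply SimpleGraph.Adj.reachable
      rw [hG, SimpleGraph.fromEdgeSet_adj]
      refine ⟨?_, hpe⟩
      rw [hE, Finset.mem_coe, List.mem_toFinset]
      exact List.mem_map.2 ⟨p, hp, rfl⟩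
  have hqr : G.Reachable q.1 q.2 :=
    sameCycle_induction (S := fun v => G.Reachable q.1 v)
      (fun v hv => hv.trans (reachable_of_swaps
        (fun p hp => hr p (List.mem_append_left _ hp)) v)) hq (SimpleGraph.Reachable.refl _)
  have hstep : ∀ v, G.Reachable v (c v) := by
    intro v
    rw [← hprod]
    apply reachable_of_swaps
    intro p hp
    rw [List.mem_append, List.mem_cons] at hp
    rcases hp with hp | rfl | hp
    · exact hr p (List.mem_append_left _ hp)
    · exact hqr
    · exact hr p (List.mem_append_right _ hp)
  have hpre : G.Preconnected := fun u v =>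
    sameCycle_induction (S := fun w => G.Reachable u w) (fun w hw => hw.trans (hstep w)) (hc u v)
      (SimpleGraph.Reachable.refl _)
  have : Nonempty α := ⟨q.1⟩
  have hcon : G.Connected := ⟨hpre⟩
  have h1 := hcon.card_vert_le_card_edgeSet_add_one
  have h2 : Nat.card G.edgeSet ≤ E.card := by
    rw [hG, SimpleGraph.edgeSet_fromEdgeSet, Nat.card_coe_set_eq, ← Set.ncard_coe_finset]
    exact Set.ncard_le_ncard Set.sdiff_subset (Finset.finite_toSet _)
  have h3 : E.card ≤ (A ++ B).length := by
    rw [hE]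
    exact (List.toFinset_card_le _).trans (by simp)
  rw [Nat.card_eq_fintype_card] at h1
  simp only [List.length_append, List.length_cons] at hlen h3
  omega

/-- Descend from `c` by deleting factors on the right. By minimality each deleted factor had merged
two cycles, so deleting it splits a cycle and `mul_swap` applies. -/
theorem arcInvariant_of_factorization [Fintype α] {f : α → ℕ} (hf : Function.Injective f) {c : Perm α}
    (hc : ∀ u v, c.SameCycle u v) (hcf : ArcInvariant f c) (B A : List (α × α))
    (hprod : ((A ++ B).map fun p => swap p.1 p.2).prod = c)
    (hlen : (A ++ B).length < Fintype.card α) :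
    ArcInvariant f (A.map fun p => swap p.1 p.2).prod := by
  induction B generalizing A with
  | nil => rw [List.append_nil] at hprod; rwa [hprod]
  | cons q B ih =>
    have h1 := not_sameCycle_of_factorization hc hprod hlen
    have e : A ++ q :: B = (A ++ [q]) ++ B := by simp
    rw [e] at hprod hlen
    have h2 := ih (A ++ [q]) hprod hlen
    rw [List.map_append, List.prod_append, List.map_singleton, List.prod_singleton] at h2
    have h3 := h2.mul_swap hf (sameCycle_mul_swap h1)
    rwa [mul_assoc, swap_mul_self, mul_one] at h3

theorem exists_pairs_of_isSwap (l : List (Perm α)) (hl : ∀ t ∈ l, t.IsSwap) :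
    ∃ m : List (α × α), m.map (fun p => swap p.1 p.2) = l := by
  induction l with
  | nil => exact ⟨[], rfl⟩
  | cons t l ih =>
    obtain ⟨m, hm⟩ := ih fun t ht => hl t (List.mem_cons_of_mem _ ht)
    obtain ⟨a, b, -, hab⟩ := hl t List.mem_cons_self
    exact ⟨(a, b) :: m, by simp [hm, hab]⟩

end factorization

theorem exists_reflLength (p : Perm (Fin (n + 1))) :
    ∃ m : List (Fin (n + 1) × Fin (n + 1)), (m.map fun q => swap q.1 q.2).prod = p ∧
      m.length = reflLength p := by
  have hne : {k | ∃ l : List (Perm (Fin (n + 1))), (∀ t ∈ l, t.IsSwap) ∧ l.prod = p ∧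
      l.length = k}.Nonempty := by
    obtain ⟨l, h1, h2⟩ := (Perm.truncSwapFactors p).out
    exact ⟨l.length, l, h2, h1, rfl⟩
  obtain ⟨l, h1, h2, h3⟩ := Nat.sInf_mem hne
  obtain ⟨m, rfl⟩ := exists_pairs_of_isSwap l h1
  exact ⟨m, h2, by rw [reflLength, ← h3, List.length_map]⟩

/-! ### Noncrossing partitions as clockwise noncrossing permutations -/

namespace IsStdCoxeter

variable {c x : Perm (Fin (n + 1))}

theorem reflLength_le (hc : IsStdCoxeter c) : reflLength c ≤ n := by
  obtain ⟨l, hl, rfl⟩ := hc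
  apply Nat.sInf_le
  refine ⟨l.map s, ?_, rfl, by simp [hl.length_eq]⟩
  intro t ht
  obtain ⟨k, -, rfl⟩ := List.mem_map.1 ht
  exact ⟨k.castSucc, k.succ, by simp [Fin.ext_iff], rfl⟩

/-- The arc from a point to its image under `c` is empty. -/
theorem arcInvariant (hc : IsStdCoxeter c) : ArcInvariant (ht c) c := by
  intro i v hv
  exfalso
  have h1 := chain_consecutive hc.ht_chain i v
  have h0 : ht c 0 = 0 := by simp [ht, hc.zero_mem_R]
  rcases hc.ht_chain i with h2 | h2
  · rw [h2] at h1 hv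
    unfold Arc at hv
    simp only [ne_eq, not_true_eq_false, false_and, or_false] at h1
    omega
  · unfold Arc at hv
    omega

theorem ht_inj (hc : IsStdCoxeter c) : Function.Injective (ht c) :=
  ht_injective c hc.last_mem_R

/-- Minimal factorizations of `x` and `x⁻¹ * c` concatenate to one of `c` with at most `n` factors.
-/
theorem arcInvariant_of_mem_NC (hc : IsStdCoxeter c) (hx : x ∈ NC c) : ArcInvariant (ht c) x := by
  obtain ⟨A, hA, hAl⟩ := exists_reflLength x
  obtain ⟨B, hB, hBl⟩ := exists_reflLength (x⁻¹ * c)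
  have h1 : reflLength x + reflLength (x⁻¹ * c) = reflLength c := hx
  have h2 := hc.reflLength_le
  have h3 := isCycleOn_of_chain hc.ht_chain
  rw [← hA]
  refine arcInvariant_of_factorization hc.ht_inj (c := c) ?_ hc.arcInvariant B A ?_ ?_
  · intro u v
    exact h3.2 (by simp) (by simp)
  · rw [List.map_append, List.prod_append, hA, hB, mul_inv_cancel_left]
  · rw [List.length_append, Fintype.card_fin]
    omega

/-- Clockwise motion goes up on the right: if `x k` were smaller, the arc from `k` to it would sweep
over `m`. The next two lemmas are the analogues for the predecessor on the right and the successor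
on the left; they give every noninitial vertex a smaller neighbour in its cycle. -/
theorem lt_apply_of_mem_R (hc : IsStdCoxeter c) (hx : x ∈ NC c) {k m : Fin (n + 1)} (hk : k ∈ R c)
    (h : x.SameCycle k m) (hkm : k < m) : k < x k := by
  have h1 := (hc.arcInvariant_of_mem_NC hx).not_arc h
  by_contra hlt
  have hne : x k ≠ k := fun h2 => hkm.ne (h.eq_of_left h2)
  have hne' : (x k : ℕ) ≠ k := fun h => hne (Fin.ext h)
  rw [Fin.lt_def] at hlt hkm
  have b1 := (x k).2
  have b2 := m.2
  have b3 := hc.pos_of_mem_R (v := m)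
  have b4 := hc.pos_of_mem_R (v := x k)
  unfold Arc ht at h1
  by_cases h2 : x k ∈ R c <;> by_cases h3 : m ∈ R c <;> 
    simp only [hk, h2, h3, if_true, if_false, not_true_eq_false, not_false_eq_true, forall_const]
      at h1 b3 b4 <;> omega

theorem inv_apply_lt_of_mem_R (hc : IsStdCoxeter c) (hx : x ∈ NC c) {k m : Fin (n + 1)}
    (hk : k ∈ R c) (h : x.SameCycle k m) (hkm : m < k) : x⁻¹ k < k := by
  obtain ⟨i, rfl⟩ := x.surjective k
  rw [show x⁻¹ (x i) = i by simp]
  have h1 := (hc.arcInvariant_of_mem_NC hx).not_arc (Perm.sameCycle_apply_left.1 h)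
  by_contra hlt
  have hne : x i ≠ i := by
    intro h2
    rw [h2] at h hkm
    exact hkm.ne' (h.eq_of_left h2)
  have hne' : (x i : ℕ) ≠ i := fun h => hne (Fin.ext h)
  rw [Fin.lt_def] at hlt hkm
  have b1 := i.2
  have b2 := m.2
  have b0 := (x i).2
  have b3 := hc.pos_of_mem_R (v := m)
  have b4 := hc.pos_of_mem_R (v := i)
  unfold Arc ht at h1
  by_cases h2 : i ∈ R c <;> by_cases h3 : m ∈ R c <;> 
    simp only [hk, h2, h3, if_true, if_false, not_true_eq_false, not_false_eq_true, forall_const]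
      at h1 b3 b4 <;> omega

theorem apply_lt_of_notMem_R (hc : IsStdCoxeter c) (hx : x ∈ NC c) {k m : Fin (n + 1)}
    (hk : k ∉ R c) (h : x.SameCycle k m) (hkm : m < k) : x k < k := by
  have h1 := (hc.arcInvariant_of_mem_NC hx).not_arc h
  by_contra hlt
  have hne : x k ≠ k := fun h2 => hkm.ne' (h.eq_of_left h2)
  have hne' : (x k : ℕ) ≠ k := fun h => hne (Fin.ext h)
  rw [Fin.lt_def] at hlt hkm
  have b1 := (x k).2
  have b2 := m.2
  have b0 := hc.pos_of_mem_R hk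
  have b3 := hc.pos_of_mem_R (v := m)
  have b4 := hc.pos_of_mem_R (v := x k)
  unfold Arc ht at h1
  by_cases h2 : x k ∈ R c <;> by_cases h3 : m ∈ R c <;> 
    simp only [hk, h2, h3, if_true, if_false, not_true_eq_false, not_false_eq_true, forall_const]
      at h1 b3 b4 <;> omega

end IsStdCoxeter

/-! ### Distinguished expressions of a cycle -/

theorem IsDistinguished.inv {σ : Perm (Fin (n + 1))} {t : List (Fin (n + 1) × Fin (n + 1))}
    (h : IsDistinguished σ t) : IsDistinguished σ⁻¹ t.reverse := by
  obtain ⟨h1, h2⟩ := h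
  refine ⟨by rw [Perm.support_inv]; exact t.reverse_perm.trans h1, ?_⟩
  rw [← h2, List.prod_inv_reverse, List.map_reverse, List.map_map]
  congr 2

/-- When the two smallest vertices satisfy `σ a = b`, the factor `(a, b)` can be split off on the
left, leaving a cycle on the remaining vertices. -/
theorem exists_isDistinguished_step {σ : Perm (Fin (n + 1))} (hσ : σ.IsCycle)
    (hQ : ∀ k ∈ σ.support, ∀ m ∈ σ.support, m < k → σ k < k ∨ σ⁻¹ k < k)
    (ih : ∀ τ : Perm (Fin (n + 1)), τ.IsCycle → τ.support.card < σ.support.card →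
      (∀ k ∈ τ.support, ∀ m ∈ τ.support, m < k → τ k < k ∨ τ⁻¹ k < k) →
      ∃ t, IsDistinguished τ t)
    {a b : Fin (n + 1)} {l : List (Fin (n + 1))} (hl : σ.support.sort (· ≤ ·) = a :: b :: l)
    (hab : σ a = b) : ∃ t, IsDistinguished σ t := by
  have hsl := σ.support.pairwise_sort (· ≤ ·)
  have hnd := σ.support.sort_nodup (· ≤ ·)
  have hmem : ∀ v, v ∈ σ.support ↔ v ∈ a :: b :: l := by
    intro v; rw [← hl, Finset.mem_sort]
  rw [hl] at hsl hnd
  have ha : σ a ≠ a := by rw [← Perm.mem_support, hmem]; simp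
  by_cases h2 : σ (σ a) = a
  · have e := hσ.eq_swap_of_apply_apply_eq_self ha h2
    rw [hab] at e
    refine ⟨[(a, b)], ?_, by simp [e]⟩
    have : l = [] := by
      rw [List.eq_nil_iff_forall_not_mem]
      intro v hv
      have h3 : v ∈ σ.support := by rw [hmem]; simp [hv]
      rw [e, Perm.mem_support] at h3
      apply h3
      apply swap_apply_of_ne_of_ne
      · rintro rfl; simp [hv] at hnd
      · rintro rfl; simp [hv] at hnd
    rw [hl, this]
    simp
  · have hcyc := hσ.swap_mul ha h2
    have hsupp := Perm.support_swap_mul_eq σ a h2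
    rw [hab] at hcyc hsupp
    set τ := swap a b * σ with hτ
    have hsort : τ.support.sort (· ≤ ·) = b :: l := by
      have e : τ.support = (b :: l).toFinset := by
        ext v
        rw [hsupp, Finset.mem_sdiff, hmem, List.mem_toFinset, Finset.mem_singleton,
          List.mem_cons (a := v) (b := a)]
        constructor
        · rintro ⟨h3 | h3, h4⟩
          · exact absurd h3 h4
          · exact h3
        · intro h3
          refine ⟨Or.inr h3, ?_⟩
          rintro rfl
          exact (List.nodup_cons.1 hnd).1 h3
      rw [e, List.toFinset_sort _ (List.nodup_cons.1 hnd).2]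
      exact (List.pairwise_cons.1 hsl).2
    have hmem' : ∀ v, v ∈ τ.support ↔ v ∈ b :: l := by
      intro v; rw [← hsort, Finset.mem_sort]
    obtain ⟨t, ht1, ht2⟩ := ih τ hcyc (by
        rw [← Finset.length_sort (· ≤ ·) (s := τ.support),
          ← Finset.length_sort (· ≤ ·) (s := σ.support), hsort, hl]; simp) (by
      intro k hk m hm hmk
      rw [hmem'] at hk hm
      have hbk : b < k := by
        rcases List.mem_cons.1 hm with rfl | hm
        · exact hmk
        · exact ((List.pairwise_cons.1 (List.pairwise_cons.1 hsl).2).1 m hm).trans_lt hmk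
      have hab' : a < b := lt_of_le_of_ne ((List.pairwise_cons.1 hsl).1 b (by simp))
        (by rintro rfl; simp at hnd)
      -- The smaller neighbour of `k` survives, except that a successor `a` is replaced by `b`,
      -- which is still below `k`.
      rcases hQ k ((hmem k).2 (List.mem_cons_of_mem _ hk)) a ((hmem a).2 (by simp))
        (hab'.trans hbk) with h3 | h3
      · left
        rw [hτ, Perm.mul_apply]
        by_cases h4 : σ k = a
        · rw [h4, swap_apply_left]; exact hbk
        · rw [swap_apply_of_ne_of_ne h4]
          · exact h3
          · rw [← hab]
            intro h5
            exact (hab'.trans hbk).ne' (σ.injective h5)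
      · right
        rw [hτ, mul_inv_rev, swap_inv, Perm.mul_apply,
          swap_apply_of_ne_of_ne (hab'.trans hbk).ne' hbk.ne']
        exact h3)
    refine ⟨(a, b) :: t, ?_, ?_⟩
    · rw [hl]
      rw [hsort] at ht1
      simpa using ht1
    · rw [List.map_cons, List.prod_cons, ht2, hτ, ← mul_assoc, swap_mul_self, one_mul]

/-- A cycle in which every vertex except the smallest one has a smaller neighbour has a distinguished
expression. -/
theorem exists_isDistinguished {σ : Perm (Fin (n + 1))} (hσ : σ.IsCycle)
    (hQ : ∀ k ∈ σ.support, ∀ m ∈ σ.support, m < k → σ k < k ∨ σ⁻¹ k < k) :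
    ∃ t, IsDistinguished σ t := by
  induction hN : σ.support.card using Nat.strong_induction_on generalizing σ with
  | _ N ih =>
    have hlen := hσ.two_le_card_support
    rw [← Finset.length_sort (· ≤ ·)] at hlen
    have hnd := σ.support.sort_nodup (· ≤ ·)
    have hsl := σ.support.pairwise_sort (· ≤ ·)
    rcases hl : σ.support.sort (· ≤ ·) with _ | ⟨a, _ | ⟨b, l⟩⟩
    · simp [hl] at hlen
    · simp [hl] at hlen
    have hmem : ∀ v, v ∈ σ.support ↔ v ∈ a :: b :: l := by
      intro v; rw [← hl, Finset.mem_sort]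
    rw [hl] at hnd hsl
    have hab : a < b := lt_of_le_of_ne ((List.pairwise_cons.1 hsl).1 b (by simp))
        (by rintro rfl; simp at hnd)
    have hlt : ∀ v ∈ σ.support, v < b → v = a := by
      intro v hv hvb
      rw [hmem, List.mem_cons, List.mem_cons] at hv
      rcases hv with rfl | rfl | hv
      · rfl
      · exact absurd hvb (lt_irrefl _)
      · exact absurd hvb (not_lt.2 ((List.pairwise_cons.1 (List.pairwise_cons.1 hsl).2).1 v hv))
    have hb : b ∈ σ.support := (hmem b).2 (by simp)
    -- The only vertex below `b` is `a`, so `a` is a neighbour of `b`. If it comes after `b`, pass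
    -- to `σ⁻¹` and reverse the expression.
    rcases hQ b hb a ((hmem a).2 (by simp)) hab with h1 | h1
    · have h2 := hlt _ (Perm.apply_mem_support.2 hb) h1
      obtain ⟨t, ht⟩ := exists_isDistinguished_step hσ.inv
        (by
          intro k hk m hm hmk
          rw [Perm.support_inv] at hk hm
          rw [inv_inv]
          exact (hQ k hk m hm hmk).symm)
        (fun τ hτ hlt' hτQ => ih τ.support.card (by rwa [Perm.support_inv, hN] at hlt') hτ hτQ rfl)
        (by rw [Perm.support_inv]; exact hl) (by rw [← h2]; simp)
      exact ⟨t.reverse, by simpa using ht.inv⟩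
    · have h2 := hlt _ (by
        rw [← Perm.support_inv] at hb ⊢
        exact Perm.apply_mem_support.2 hb) h1
      exact exists_isDistinguished_step hσ hQ
        (fun τ hτ hlt' hτQ => ih τ.support.card (by rwa [hN] at hlt') hτ hτQ rfl) hl
        (by rw [← h2]; simp)

/-! ### The edges of a polygon at a point -/

/-- The edges joining consecutive elements of a list whose closed interval contains `k`. -/
def edgesAt (k : Fin (n + 1)) (l : List (Fin (n + 1) × Fin (n + 1))) :
    List (Fin (n + 1) × Fin (n + 1)) :=
  l.filter fun p => p.1 ≤ k ∧ k ≤ p.2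

theorem edgesAt_of_lt {k : Fin (n + 1)} {l : List (Fin (n + 1))} (h : ∀ v ∈ l, k < v) :
    edgesAt k (l.zip l.tail) = [] := by
  rw [edgesAt, List.filter_eq_nil_iff]
  rintro ⟨a, b⟩ hp
  have := h a (List.of_mem_zip hp).1
  simp [this]

theorem edgesAt_cons_self {k : Fin (n + 1)} {l : List (Fin (n + 1))} (h : ∀ v ∈ l, k < v) :
    edgesAt k ((k :: l).zip l) = (l.head?.map fun j => (k, j)).toList := by
  rcases l with _ | ⟨j, l⟩
  · simp [edgesAt]
  · have h1 := edgesAt_of_lt h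
    simp only [List.tail_cons] at h1
    have h2 := h j (by simp)
    rw [edgesAt] at h1
    rw [List.zip_cons_cons, edgesAt, List.filter_cons_of_pos (by simp [h2.le]), h1]
    simp

/-- The cases are: `k` outside the path or its only vertex, under one edge, its first vertex, its
last vertex, or an intermediate vertex where exactly two edges meet. -/
theorem edgesAt_cases (k : Fin (n + 1)) {l : List (Fin (n + 1))} (hl : l.Pairwise (· < ·)) :
    (((∀ v ∈ l, k < v) ∨ (∀ v ∈ l, v < k) ∨ l = [k]) ∧ edgesAt k (l.zip l.tail) = []) ∨
    (k ∉ l ∧ ∃ i ∈ l, ∃ j ∈ l, i < k ∧ k < j ∧ edgesAt k (l.zip l.tail) = [(i, j)]) ∨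
    (k ∈ l ∧ (∀ v ∈ l, k ≤ v) ∧ ∃ j ∈ l, k < j ∧ edgesAt k (l.zip l.tail) = [(k, j)]) ∨
    (k ∈ l ∧ (∀ v ∈ l, v ≤ k) ∧ ∃ i ∈ l, i < k ∧ edgesAt k (l.zip l.tail) = [(i, k)]) ∨
    (k ∈ l ∧ ∃ i ∈ l, ∃ j ∈ l, i < k ∧ k < j ∧ edgesAt k (l.zip l.tail) = [(i, k), (k, j)]) := by
  induction l with
  | nil => left; simp [edgesAt]
  | cons d l ih =>
    obtain ⟨h1, h2⟩ := List.pairwise_cons.1 hl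
    rcases lt_trichotomy d k with hd | rfl | hd
    · rcases l with _ | ⟨e, l⟩
      · left; simp [edgesAt, hd]
      have hde := h1 e (by simp)
      have h3 := (List.pairwise_cons.1 h2).1
      rcases lt_trichotomy e k with he | rfl | he
      · have e1 : edgesAt k ((d :: e :: l).zip (d :: e :: l).tail) =
            edgesAt k ((e :: l).zip (e :: l).tail) := by
          simp only [List.tail_cons, List.zip_cons_cons, edgesAt]
          rw [List.filter_cons_of_neg (by simp [he])]
        rw [e1]
        rcases ih h2 with ⟨h | h | h, h4⟩ | ⟨h, i, hi, j, hj, h4⟩ | ⟨h, h', j, hj, h4⟩ |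
          ⟨h, h', i, hi, h4⟩ | ⟨h, i, hi, j, hj, h4⟩
        · exact absurd (h e (by simp)) (not_lt.2 he.le)
        · left
          refine ⟨Or.inr (Or.inl ?_), h4⟩
          intro v hv
          rcases List.mem_cons.1 hv with rfl | hv
          · exact hd
          · exact h v hv
        · simp only [List.cons.injEq] at h
          exact absurd h.1 he.ne
        · right; left
          refine ⟨?_, i, List.mem_cons_of_mem _ hi, j, List.mem_cons_of_mem _ hj, h4⟩
          rw [List.mem_cons, not_or]
          exact ⟨hd.ne', h⟩
        · exact absurd (h' e (by simp)) (not_le.2 he)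
        · right; right; right; left
          refine ⟨List.mem_cons_of_mem _ h, ?_, i, List.mem_cons_of_mem _ hi, h4⟩
          intro v hv
          rcases List.mem_cons.1 hv with rfl | hv
          · exact hd.le
          · exact h' v hv
        · right; right; right; right
          exact ⟨List.mem_cons_of_mem _ h, i, List.mem_cons_of_mem _ hi, j,
            List.mem_cons_of_mem _ hj, h4⟩
      · have h4 := edgesAt_cons_self h3
        have e1 : edgesAt e ((d :: e :: l).zip (d :: e :: l).tail) =
            (d, e) :: edgesAt e ((e :: l).zip l) := by
          simp only [List.tail_cons, List.zip_cons_cons, edgesAt]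
          rw [List.filter_cons_of_pos (by simp [hd.le])]
        rw [e1, h4]
        rcases l with _ | ⟨j, l⟩
        · right; right; right; left
          refine ⟨by simp, by simp [hd.le], d, by simp, hd, by simp⟩
        · right; right; right; right
          exact ⟨by simp, d, by simp, j, by simp, hd, h3 j (by simp), by simp⟩
      · right; left
        refine ⟨?_, d, by simp, e, by simp, hd, he, ?_⟩
        · simp only [List.mem_cons, not_or]
          refine ⟨hd.ne', he.ne, fun hk => ?_⟩
          exact absurd (h3 k hk) (not_lt.2 he.le)
        · have h4 : ∀ v ∈ e :: l, k < v := by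
            intro v hv
            rcases List.mem_cons.1 hv with rfl | hv
            · exact he
            · exact he.trans (h3 v hv)
          have h5 := edgesAt_of_lt h4
          simp only [List.tail_cons, List.zip_cons_cons, edgesAt] at h5 ⊢
          rw [List.filter_cons_of_pos (by simp [hd.le, he.le]), h5]
    · have h3 := edgesAt_cons_self h1
      rw [List.tail_cons, h3]
      rcases l with _ | ⟨j, l⟩
      · left; simp
      · right; right; left
        refine ⟨by simp, ?_, j, by simp, h1 j (by simp), by simp⟩
        intro v hv
        rcases List.mem_cons.1 hv with rfl | hv
        · exact le_rfl
        · exact (h1 v hv).le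
    · left
      have h3 : ∀ v ∈ d :: l, k < v := by
        intro v hv
        rcases List.mem_cons.1 hv with rfl | hv
        · exact hd
        · exact hd.trans (h1 v hv)
      exact ⟨Or.inl h3, edgesAt_of_lt h3⟩

theorem swaps_prod_fixed {k : Fin (n + 1)} {t : List (Fin (n + 1) × Fin (n + 1))}
    (h : ∀ p ∈ t, p.1 ≠ k ∧ p.2 ≠ k) : (t.map fun p => swap p.1 p.2).prod k = k := by
  induction t with
  | nil => simp
  | cons p t ih =>
    rw [List.map_cons, List.prod_cons, Perm.mul_apply, ih fun q hq => h q (List.mem_cons_of_mem _ hq)]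
    exact swap_apply_of_ne_of_ne (h p (by simp)).1.symm (h p (by simp)).2.symm

theorem swaps_prod_mem {S : Set (Fin (n + 1))} {t : List (Fin (n + 1) × Fin (n + 1))}
    (h : ∀ p ∈ t, p.1 ∈ S ↔ p.2 ∈ S) {v : Fin (n + 1)} (hv : v ∈ S) :
    (t.map fun p => swap p.1 p.2).prod v ∈ S := by
  induction t with
  | nil => simpa
  | cons p t ih =>
    rw [List.map_cons, List.prod_cons, Perm.mul_apply]
    have h1 := ih fun q hq => h q (List.mem_cons_of_mem _ hq)
    generalize (t.map fun p => swap p.1 p.2).prod v = y at h1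
    have h2 := h p (by simp)
    rw [swap_apply_def]
    split_ifs with h3 h4
    · rw [← h2, ← h3]; exact h1
    · rw [h2, ← h4]; exact h1
    · exact h1

theorem rel_of_mem_zip_tail {α : Type*} {r : α → α → Prop} {l : List α} (hl : l.Pairwise r)
    {p : α × α} (hp : p ∈ l.zip l.tail) : r p.1 p.2 := by
  induction l with
  | nil => simp at hp
  | cons a l ih =>
    obtain ⟨h1, h2⟩ := List.pairwise_cons.1 hl
    rcases l with _ | ⟨b, l⟩
    · simp at hp
    · rw [List.tail_cons, List.zip_cons_cons, List.mem_cons] at hp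
      rcases hp with rfl | hp
      · exact h1 b (by simp)
      · exact ih h2 hp

/-- The letters contributed at the point `k` by an edge: `w` if `k` lies strictly below the edge, and
the letter after (before) `k` if the edge starts (ends) at `k`. -/
def edgeWord {β : Type*} (w : List β) (a b : β) (k : Fin (n + 1)) (p : Fin (n + 1) × Fin (n + 1)) :
    List β :=
  if p.1 < k ∧ k < p.2 then w else if p.1 = k then [b] else if p.2 = k then [a] else []

theorem flatMap_edgeWord {β : Type*} (w : List β) (a b : β) (k : Fin (n + 1))
    {t : List (Fin (n + 1) × Fin (n + 1))} (ht : ∀ p ∈ t, p.1 < p.2) :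
    t.flatMap (edgeWord w a b k) = (edgesAt k t).flatMap (edgeWord w a b k) := by
  induction t with
  | nil => rfl
  | cons p t ih =>
    have h1 := ih fun q hq => ht q (List.mem_cons_of_mem _ hq)
    have h2 := ht p (by simp)
    unfold edgesAt at h1 ⊢
    by_cases hp : p.1 ≤ k ∧ k ≤ p.2
    · rw [List.filter_cons_of_pos (by simpa using hp), List.flatMap_cons, List.flatMap_cons, h1]
    · rw [List.filter_cons_of_neg (by simpa using hp), List.flatMap_cons, h1]
      have : edgeWord w a b k p = [] := by
        unfold edgeWord
        rw [if_neg (fun h => hp ⟨h.1.le, h.2.le⟩), if_neg, if_neg]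
        · intro h; exact hp ⟨h ▸ h2.le, h.ge⟩
        · intro h; exact hp ⟨h.le, h ▸ h2.le⟩
      rw [this, List.nil_append]

namespace IsDistinguished

variable {σ : Perm (Fin (n + 1))} {t : List (Fin (n + 1) × Fin (n + 1))}

theorem fst_lt_snd (h : IsDistinguished σ t) {p : Fin (n + 1) × Fin (n + 1)} (hp : p ∈ t) :
    p.1 < p.2 :=
  rel_of_mem_zip_tail σ.support.sortedLT_sort.pairwise ((h.1.mem_iff).1 hp)

theorem edgesAt_cases (h : IsDistinguished σ t) (k : Fin (n + 1)) :
    (((∀ v ∈ σ.support, k < v) ∨ (∀ v ∈ σ.support, v < k) ∨ ∀ v ∈ σ.support, v = k) ∧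
      edgesAt k t = []) ∨
    (k ∉ σ.support ∧ ∃ i ∈ σ.support, ∃ j ∈ σ.support, i < k ∧ k < j ∧ edgesAt k t = [(i, j)]) ∨
    (k ∈ σ.support ∧ (∀ v ∈ σ.support, k ≤ v) ∧
      ∃ j ∈ σ.support, k < j ∧ edgesAt k t = [(k, j)]) ∨
    (k ∈ σ.support ∧ (∀ v ∈ σ.support, v ≤ k) ∧
      ∃ i ∈ σ.support, i < k ∧ edgesAt k t = [(i, k)]) ∨
    (k ∈ σ.support ∧ ∃ i ∈ σ.support, ∃ j ∈ σ.support, i < k ∧ k < j ∧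
      (edgesAt k t).Perm [(i, k), (k, j)]) := by
  have h1 : (edgesAt k t).Perm _ := h.1.filter _
  have h2 := NCFC.edgesAt_cases k σ.support.sortedLT_sort.pairwise
  have h3 := σ.support.sort_nodup (· ≤ ·)
  simp only [Finset.mem_sort] at h2
  change (edgesAt k t).Perm (edgesAt k _) at h1
  rcases h2 with ⟨h4, h5⟩ | ⟨h4, i, hi, j, hj, h6, h7, h5⟩ | ⟨h4, h6, j, hj, h7, h5⟩ |
    ⟨h4, h6, i, hi, h7, h5⟩ | ⟨h4, i, hi, j, hj, h6, h7, h5⟩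
  · left
    rw [h5, List.perm_nil] at h1
    refine ⟨h4.imp id (Or.imp id fun h => ?_), h1⟩
    intro v hv
    rw [← Finset.mem_sort (· ≤ ·), h] at hv
    simpa using hv
  · right; left
    rw [h5, List.perm_singleton] at h1
    exact ⟨h4, i, hi, j, hj, h6, h7, h1⟩
  · right; right; left
    rw [h5, List.perm_singleton] at h1
    exact ⟨h4, h6, j, hj, h7, h1⟩
  · right; right; right; left
    rw [h5, List.perm_singleton] at h1
    exact ⟨h4, h6, i, hi, h7, h1⟩
  · right; right; right; right
    rw [h5] at h1
    exact ⟨h4, i, hi, j, hj, h6, h7, h1⟩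

/-- Products act from right to left: the factors after `(k, j)` fix `k`, then `k` goes to `j`, and
no remaining factor crosses `k`, as `(i, k)` lies weakly below it. With `apply_lt`, the direction of
`σ` at `k` determines the order of the two edges in every distinguished expression. -/
theorem lt_apply (h : IsDistinguished σ t) {i j k : Fin (n + 1)} (hik : i < k) (hkj : k < j)
    (he : edgesAt k t = [(i, k), (k, j)]) : k < σ k := by
  rw [edgesAt, List.filter_eq_cons_iff] at he
  obtain ⟨A, C, rfl, hA, -, he⟩ := he
  rw [List.filter_eq_cons_iff] at he
  obtain ⟨B, C, rfl, hB, -, he⟩ := he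
  rw [List.filter_eq_nil_iff] at he
  have hlt : ∀ p ∈ A ++ (i, k) :: (B ++ (k, j) :: C), p.1 < p.2 := fun p hp => h.fst_lt_snd hp
  have h2 := h.2
  rw [show A ++ (i, k) :: (B ++ (k, j) :: C) = (A ++ (i, k) :: B) ++ ((k, j) :: C) by simp,
    List.map_append, List.prod_append, List.map_cons, List.prod_cons] at h2
  rw [← h2, Perm.mul_apply, Perm.mul_apply, swaps_prod_fixed (t := C), swap_apply_left]
  · refine swaps_prod_mem (S := Set.Ioi k) ?_ hkj
    intro p hp
    have h4 := hlt p (by simp only [List.mem_append, List.mem_cons] at hp ⊢; tauto)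
    have h3 : (¬ (p.1 ≤ k ∧ k ≤ p.2)) ∨ p = (i, k) := by
      rw [List.mem_append, List.mem_cons] at hp
      rcases hp with hp | hp | hp
      · left; simpa using hA p hp
      · right; exact hp
      · left; simpa using hB p hp
    simp only [Set.mem_Ioi]
    rcases h3 with h3 | rfl
    · rw [not_and, not_le] at h3
      constructor
      · intro h5; exact h5.trans h4
      · intro h5
        by_contra h6
        exact absurd (h3 (not_lt.1 h6)) (not_lt.2 h5.le)
    · simp [hik.le]
  · intro p hp
    have h4 := hlt p (by simp [hp])
    have h3 := he p hp
    simp only [decide_eq_true_eq] at h3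
    constructor
    · rintro rfl; exact h3 ⟨le_rfl, h4.le⟩
    · rintro rfl; exact h3 ⟨h4.le, le_rfl⟩

theorem apply_lt (h : IsDistinguished σ t) {i j k : Fin (n + 1)} (hik : i < k) (hkj : k < j)
    (he : edgesAt k t = [(k, j), (i, k)]) : σ k < k := by
  rw [edgesAt, List.filter_eq_cons_iff] at he
  obtain ⟨A, C, rfl, hA, -, he⟩ := he
  rw [List.filter_eq_cons_iff] at he
  obtain ⟨B, C, rfl, hB, -, he⟩ := he
  rw [List.filter_eq_nil_iff] at he
  have hlt : ∀ p ∈ A ++ (k, j) :: (B ++ (i, k) :: C), p.1 < p.2 := fun p hp => h.fst_lt_snd hp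
  have h2 := h.2
  rw [show A ++ (k, j) :: (B ++ (i, k) :: C) = (A ++ (k, j) :: B) ++ ((i, k) :: C) by simp,
    List.map_append, List.prod_append, List.map_cons, List.prod_cons] at h2
  rw [← h2, Perm.mul_apply, Perm.mul_apply, swaps_prod_fixed (t := C), swap_apply_right]
  · refine swaps_prod_mem (S := Set.Iio k) ?_ hik
    intro p hp
    have h4 := hlt p (by simp only [List.mem_append, List.mem_cons] at hp ⊢; tauto)
    have h3 : (¬ (p.1 ≤ k ∧ k ≤ p.2)) ∨ p = (k, j) := by
      rw [List.mem_append, List.mem_cons] at hp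
      rcases hp with hp | hp | hp
      · left; simpa using hA p hp
      · right; exact hp
      · left; simpa using hB p hp
    simp only [Set.mem_Iio]
    rcases h3 with h3 | rfl
    · rw [not_and, not_le] at h3
      constructor
      · intro h5; exact h3 h5.le
      · intro h5; exact h4.trans h5
    · simp [hkj.le]
  · intro p hp
    have h4 := hlt p (by simp [hp])
    have h3 := he p hp
    simp only [decide_eq_true_eq] at h3
    constructor
    · rintro rfl; exact h3 ⟨le_rfl, h4.le⟩
    · rintro rfl; exact h3 ⟨h4.le, le_rfl⟩

variable {β : Type*} (w : List β) (a b : β) (k : Fin (n + 1))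

theorem flatMap_of_nested (h : IsDistinguished σ t) (hk : Nested k σ.support) :
    t.flatMap (edgeWord w a b k) = w := by
  obtain ⟨h1, ⟨i', hi', hik'⟩, j', hj', hkj'⟩ := hk
  rw [flatMap_edgeWord w a b k fun p hp => h.fst_lt_snd hp]
  rcases h.edgesAt_cases k with ⟨h2 | h2 | h2, -⟩ | ⟨h4, i, hi, j, hj, h6, h7, h5⟩ | ⟨h4, -⟩ |
    ⟨h4, -⟩ | ⟨h4, -⟩
  · exact absurd (h2 i' hi') (not_lt.2 hik'.le)
  · exact absurd (h2 j' hj') (not_lt.2 hkj'.le)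
  · exact absurd (h2 i' hi') hik'.ne
  · rw [h5]; simp [edgeWord, h6, h7]
  all_goals exact absurd h4 h1

theorem flatMap_of_not_nested (h : IsDistinguished σ t) (hk : k ∉ σ.support)
    (hk' : ¬ Nested k σ.support) : t.flatMap (edgeWord w a b k) = [] := by
  rw [flatMap_edgeWord w a b k fun p hp => h.fst_lt_snd hp]
  rcases h.edgesAt_cases k with ⟨-, h2⟩ | ⟨h4, i, hi, j, hj, h6, h7, h5⟩ | ⟨h4, -⟩ |
    ⟨h4, -⟩ | ⟨h4, -⟩
  · rw [h2]; rfl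
  · exact absurd ⟨h4, ⟨i, hi, h6⟩, j, hj, h7⟩ hk'
  all_goals exact absurd h4 hk

theorem flatMap_of_min (h : IsDistinguished σ t) (hk : ∀ v ∈ σ.support, k ≤ v)
    (hkm : k ∈ σ.support) {m : Fin (n + 1)} (hm : m ∈ σ.support) (hne : k < m) :
    t.flatMap (edgeWord w a b k) = [b] := by
  rw [flatMap_edgeWord w a b k fun p hp => h.fst_lt_snd hp]
  rcases h.edgesAt_cases k with ⟨h2 | h2 | h2, -⟩ | ⟨h4, -⟩ | ⟨-, -, j, hj, h6, h5⟩ |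
    ⟨-, h2, -⟩ | ⟨-, i, hi, -, -, h6, -⟩
  · exact absurd (h2 k hkm) (lt_irrefl _)
  · exact absurd (h2 k hkm) (lt_irrefl _)
  · exact absurd (h2 m hm) hne.ne'
  · exact absurd hkm h4
  · rw [h5]; simp [edgeWord]
  · exact absurd (h2 m hm) (not_le.2 hne)
  · exact absurd (hk i hi) (not_le.2 h6)

theorem flatMap_of_max (h : IsDistinguished σ t) (hk : ∀ v ∈ σ.support, v ≤ k)
    (hkm : k ∈ σ.support) {m : Fin (n + 1)} (hm : m ∈ σ.support) (hne : m < k) :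
    t.flatMap (edgeWord w a b k) = [a] := by
  rw [flatMap_edgeWord w a b k fun p hp => h.fst_lt_snd hp]
  rcases h.edgesAt_cases k with ⟨h2 | h2 | h2, -⟩ | ⟨h4, -⟩ | ⟨-, h2, -⟩ |
    ⟨-, -, j, hj, h6, h5⟩ | ⟨-, -, -, i, hi, -, h6, -⟩
  · exact absurd (h2 k hkm) (lt_irrefl _)
  · exact absurd (h2 k hkm) (lt_irrefl _)
  · exact absurd (h2 m hm) hne.ne
  · exact absurd hkm h4
  · exact absurd (h2 m hm) (not_le.2 hne)
  · rw [h5]; simp [edgeWord, h6.ne]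
  · exact absurd (hk i hi) (not_le.2 h6)

theorem flatMap_of_mid (h : IsDistinguished σ t) (hkm : k ∈ σ.support) {i' j' : Fin (n + 1)}
    (hi' : i' ∈ σ.support) (hj' : j' ∈ σ.support) (hik : i' < k) (hkj : k < j') :
    (k < σ k → t.flatMap (edgeWord w a b k) = [a, b]) ∧
      (σ k < k → t.flatMap (edgeWord w a b k) = [b, a]) := by
  rw [flatMap_edgeWord w a b k fun p hp => h.fst_lt_snd hp]
  rcases h.edgesAt_cases k with ⟨h2 | h2 | h2, -⟩ | ⟨h4, -⟩ | ⟨-, h2, -⟩ |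
    ⟨-, h2, -⟩ | ⟨-, i, hi, j, hj, h6, h7, h8⟩
  · exact absurd (h2 k hkm) (lt_irrefl _)
  · exact absurd (h2 k hkm) (lt_irrefl _)
  · exact absurd (h2 j' hj') hkj.ne'
  · exact absurd hkm h4
  · exact absurd (h2 i' hi') (not_le.2 hik)
  · exact absurd (h2 j' hj') (not_le.2 hkj)
  · have h9 := List.perm_pair.1 h8
    rcases h9 with h9 | h9
    · have := h.lt_apply h6 h7 h9
      refine ⟨fun _ => ?_, fun h' => absurd h' (not_lt.2 this.le)⟩
      rw [h9]; simp [edgeWord, h6.ne]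
    · have := h.apply_lt h6 h7 h9
      refine ⟨fun h' => absurd h' (not_lt.2 this.le), fun _ => ?_⟩
      rw [h9]; simp [edgeWord, h6.ne]

end IsDistinguished

/-! ### The normal form of a fully commutative permutation -/

theorem mem_desc {d u : Fin (n + 1)} {k : Fin n} :
    k ∈ desc d u ↔ d ≤ k.castSucc ∧ k.castSucc < u := by
  simp [desc]

theorem desc_self (d : Fin (n + 1)) : desc d d = [] := by
  rw [List.eq_nil_iff_forall_not_mem]
  intro k hk
  rw [mem_desc] at hk
  exact absurd hk.2 (not_lt.2 hk.1)

theorem desc_pairwise (d u : Fin (n + 1)) : (desc d u).Pairwise (· > ·) := by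
  rw [desc, List.pairwise_reverse]
  exact (List.pairwise_lt_finRange n).filter _

theorem desc_succ {d : Fin (n + 1)} {k : Fin n} (h : d ≤ k.castSucc) :
    desc d k.succ = k :: desc d k.castSucc := by
  refine List.Pairwise.eq_of_mem_iff (r := (· > ·)) (desc_pairwise _ _) ?_ ?_
  · rw [List.pairwise_cons]
    refine ⟨?_, desc_pairwise _ _⟩
    intro j hj
    have := (mem_desc.1 hj).2
    simpa using this
  · intro j
    rw [mem_desc, List.mem_cons, mem_desc]
    simp only [Fin.le_def, Fin.lt_def, Fin.ext_iff, Fin.val_castSucc, Fin.val_succ] at h ⊢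
    omega

theorem wordProd_desc_apply {d : Fin (n + 1)} (u : Fin (n + 1)) (h : d ≤ u) :
    wordProd (desc d u) d = u ∧ (desc d u).length + d = u := by
  induction u using Fin.induction with
  | zero =>
    have : d = 0 := Fin.le_zero_iff.1 h
    subst this
    simp [desc_self]
  | succ k ih =>
    by_cases hd : d = k.succ
    · subst hd
      simp [desc_self]
    · have h1 : d ≤ k.castSucc := by
        simp only [Fin.le_def, Fin.ext_iff, Fin.val_castSucc, Fin.val_succ] at h hd ⊢
        omega
      obtain ⟨h2, h3⟩ := ih h1
      rw [desc_succ h1, wordProd_cons, Perm.mul_apply, h2, s_castSucc]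
      simp only [List.length_cons, Fin.val_castSucc, Fin.val_succ] at h3 ⊢
      exact ⟨trivial, by omega⟩

theorem wordProd_apply_of_fixed {w : List (Fin n)} {v : Fin (n + 1)}
    (h : ∀ k ∈ w, (v : ℕ) ≠ k ∧ (v : ℕ) ≠ k + 1) : wordProd w v = v := by
  induction w with
  | nil => simp
  | cons k w ih =>
    rw [wordProd_cons, Perm.mul_apply, ih fun j hj => h j (List.mem_cons_of_mem _ hj)]
    exact s_of_ne (h k (by simp)).1 (h k (by simp)).2

/-- The word of the normal form attached to a list of pairs. -/
def normalWord (Z : List (Fin (n + 1) × Fin (n + 1))) : List (Fin n) :=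
  Z.flatMap fun p => desc p.1 p.2

/-- The pairs increase in both components. -/
def Increasing (Z : List (Fin (n + 1) × Fin (n + 1))) : Prop :=
  Z.Pairwise (fun p q => p.1 < q.1 ∧ p.2 < q.2) ∧ ∀ p ∈ Z, p.1 < p.2

/-- Later factors act first and use only letters beyond `p.1`; earlier factors act last and use only
letters ending before `p.2`. Neither moves the point on its way. -/
theorem Increasing.wordProd_apply {Z : List (Fin (n + 1) × Fin (n + 1))} (hZ : Increasing Z)
    {p : Fin (n + 1) × Fin (n + 1)} (hp : p ∈ Z) : wordProd (normalWord Z) p.1 = p.2 := by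
  obtain ⟨h1, h2⟩ := hZ
  induction Z with
  | nil => simp at hp
  | cons q Z ih =>
    obtain ⟨h3, h4⟩ := List.pairwise_cons.1 h1
    have h5 : normalWord (q :: Z) = desc q.1 q.2 ++ normalWord Z := rfl
    rw [h5, wordProd_append, Perm.mul_apply]
    rcases List.mem_cons.1 hp with rfl | hp
    · rw [wordProd_apply_of_fixed (w := normalWord Z), (wordProd_desc_apply _ (h2 p (by simp)).le).1]
      intro k hk
      obtain ⟨q, hq, hk⟩ := List.mem_flatMap.1 hk
      have h6 := (h3 q hq).1
      have h7 := (mem_desc.1 hk).1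
      simp only [Fin.le_def, Fin.lt_def, Fin.val_castSucc] at h6 h7
      omega
    · rw [ih hp h4 fun q hq => h2 q (List.mem_cons_of_mem _ hq)]
      apply wordProd_apply_of_fixed
      intro k hk
      have h6 := (h3 p hp).2
      have h7 := (mem_desc.1 hk).2
      simp only [Fin.lt_def, Fin.val_castSucc] at h6 h7
      omega

/-- Signed displacements sum to zero, so the total displacement is twice the sum of their positive
parts, and the pairs of `Z` account for some of these. -/
theorem two_mul_sum_le_disp {g : Perm (Fin (n + 1))} {Z : List (Fin (n + 1) × Fin (n + 1))}
    (hnd : (Z.map Prod.fst).Nodup) (h : ∀ p ∈ Z, g p.1 = p.2) :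
    2 * (Z.map fun p => ((p.2 : ℕ) : ℤ) - (p.1 : ℕ)).sum ≤ disp g := by
  set F : Fin (n + 1) → ℤ := fun v => |((g v : ℕ) : ℤ) - (v : ℕ)| + (((g v : ℕ) : ℤ) - (v : ℕ))
    with hF
  have h0 : ∑ v : Fin (n + 1), (((g v : ℕ) : ℤ) - (v : ℕ)) = 0 := by
    rw [Finset.sum_sub_distrib, Equiv.sum_comp g (fun v : Fin (n + 1) => ((v : ℕ) : ℤ)), sub_self]
  have h1 : disp g = ∑ v, F v := by
    rw [hF, Finset.sum_add_distrib, h0, add_zero]; rfl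
  rw [h1]
  calc 2 * (Z.map fun p => ((p.2 : ℕ) : ℤ) - (p.1 : ℕ)).sum
      ≤ (Z.map fun p => F p.1).sum := by
        rw [← List.sum_map_mul_left]
        apply List.sum_le_sum
        intro p hp
        rw [hF]
        dsimp only
        rw [h p hp]
        have := le_abs_self (((p.2 : ℕ) : ℤ) - (p.1 : ℕ))
        linarith
    _ = ∑ v ∈ (Z.map Prod.fst).toFinset, F v := by
        rw [List.sum_toFinset _ hnd, List.map_map]; rfl
    _ ≤ ∑ v, F v := by
        apply Finset.sum_le_sum_of_subset_of_nonneg (Finset.subset_univ _)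
        intro v _ _
        rw [hF]
        dsimp only
        have := neg_abs_le (((g v : ℕ) : ℤ) - (v : ℕ))
        linarith

theorem Increasing.tight {Z : List (Fin (n + 1) × Fin (n + 1))} (hZ : Increasing Z) :
    Tight (normalWord Z) := by
  apply le_antisymm (disp_wordProd_le _)
  have h1 : ((normalWord Z).length : ℤ) = (Z.map fun p => ((p.2 : ℕ) : ℤ) - (p.1 : ℕ)).sum := by
    have h2 := hZ.2
    clear hZ
    induction Z with
    | nil => simp [normalWord]
    | cons q Z ih =>
      have h3 := ih fun p hp => h2 p (List.mem_cons_of_mem _ hp)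
      have h4 := (wordProd_desc_apply _ (h2 q (by simp)).le).2
      have h5 : normalWord (q :: Z) = desc q.1 q.2 ++ normalWord Z := rfl
      rw [h5, List.length_append, List.map_cons, List.sum_cons, ← h3]
      push_cast
      omega
  rw [h1]
  apply two_mul_sum_le_disp
  · rw [List.Nodup, List.pairwise_map]
    exact hZ.1.imp fun h => h.1.ne
  · exact fun p hp => hZ.wordProd_apply hp

/-! ### Projections and letter counts -/

theorem filter_finRange_pair {a b : Fin n} (h : a < b) :
    (List.finRange n).filter (fun x => decide (x = a ∨ x = b)) = [a, b] := by
  refine List.Pairwise.eq_of_mem_iff (r := (· < ·)) ((List.pairwise_lt_finRange n).filter _)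
    (by simp [h]) ?_
  intro j
  simp

theorem filter_filter_finRange_pair {a b : Fin n} (h : a < b) (q : Fin n → Bool) :
    ((List.finRange n).filter q).filter (fun x => decide (x = a ∨ x = b)) = [a, b].filter q := by
  rw [← filter_finRange_pair h, List.filter_filter, List.filter_filter]
  congr 1
  funext x
  rw [Bool.and_comm]

theorem filter_filter_filter_finRange_pair {a b : Fin n} (h : a < b) (q r : Fin n → Bool) :
    (((List.finRange n).filter q).filter r).filter (fun x => decide (x = a ∨ x = b)) =
      [a, b].filter fun x => r x && q x := by
  rw [List.filter_filter (l := List.finRange n), filter_filter_finRange_pair h]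

/-- The point `b.castSucc` is shared by the two letters: the segment contains both when it passes
over this point, only `b` when it starts there, only `a` when it ends there. -/
theorem filter_desc {a b : Fin n} (hab : (a : ℕ) + 1 = b) {p : Fin (n + 1) × Fin (n + 1)}
    (hp : p.1 < p.2) :
    (desc p.1 p.2).filter (fun x => decide (x = a ∨ x = b)) =
      edgeWord [b, a] a b b.castSucc p := by
  rw [desc, List.filter_reverse, filter_filter_finRange_pair (Fin.lt_def.2 (by omega))]
  have e1 : (p.1 ≤ a.castSucc) ↔ p.1 < b.castSucc := by
    simp only [Fin.le_def, Fin.lt_def, Fin.val_castSucc]; omega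
  have e2 : (a.castSucc < p.2) ↔ b.castSucc ≤ p.2 := by
    simp only [Fin.le_def, Fin.lt_def, Fin.val_castSucc]; omega
  simp only [List.filter_cons, List.filter_nil, e1, e2, edgeWord]
  generalize b.castSucc = k
  grind

/-- Letters other than the first one come from exactly one of the two parts of a syllable. -/
theorem fromRight_iff {c : Perm (Fin (n + 1))} (hc : IsStdCoxeter c)
    (t : List (Fin (n + 1) × Fin (n + 1))) {k : Fin n} (hk : 0 < (k : ℕ)) :
    FromRight c t k ↔ ¬ FromLeft c t k := by
  have h1 := hc.mem_L (v := k.castSucc)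
  have h2 : k.castSucc ≠ 0 := by intro h; simp [Fin.ext_iff] at h; omega
  have h3 : k.castSucc ≠ Fin.last n := (Fin.castSucc_lt_last k).ne
  unfold FromRight FromLeft
  tauto

-- The side of `b` alone decides the order. Left parts decrease, right parts increase and the center
-- lies between them, so `b` precedes `a` exactly when it is taken from the left, wherever `a` is
-- taken from.
open scoped Classical in
theorem filter_contribution {c : Perm (Fin (n + 1))} (hc : IsStdCoxeter c)
    (t : List (Fin (n + 1) × Fin (n + 1))) {a b : Fin n} (hab : (a : ℕ) + 1 = b)
    {p : Fin (n + 1) × Fin (n + 1)} (hp : p.1 < p.2) :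
    (contribution c t p).filter (fun x => decide (x = a ∨ x = b)) =
      edgeWord (if FromLeft c t b then [b, a] else [a, b]) a b b.castSucc p := by
  have hb := fromRight_iff hc t (k := b) (by omega)
  -- The point 0 lies in both `L c` and `R c`, but its letter can only be a center, so the ambiguity
  -- does no harm.
  have ha : p.1 < a.castSucc → (FromRight c t a ↔ ¬ FromLeft c t a) := by
    intro h
    apply fromRight_iff hc
    simp only [Fin.lt_def, Fin.val_castSucc] at h
    omega
  rw [contribution, leftPart, rightPart, centerPart, List.filter_append, List.filter_append,
    List.filter_reverse, List.filter_reverse,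
    filter_filter_filter_finRange_pair (Fin.lt_def.2 (by omega)),
    filter_filter_filter_finRange_pair (Fin.lt_def.2 (by omega)),
    filter_filter_finRange_pair (Fin.lt_def.2 (by omega))]
  have e2 : (a.castSucc < p.2) ↔ b.castSucc ≤ p.2 := by
    simp only [Fin.le_def, Fin.lt_def, Fin.val_castSucc]; omega
  have e3 : a.castSucc < b.castSucc := by
    simp only [Fin.lt_def, Fin.val_castSucc]; omega
  have e4 : a.castSucc < p.1 → b.castSucc ≤ p.1 := by
    simp only [Fin.le_def, Fin.lt_def, Fin.val_castSucc]; omega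
  simp only [List.filter_cons, List.filter_nil, e2, edgeWord]
  generalize b.castSucc = k at *
  generalize a.castSucc = k' at *
  generalize FromLeft c t b = Lb at *
  generalize FromLeft c t a = La at *
  generalize FromRight c t b = Rb at *
  generalize FromRight c t a = Ra at *
  rcases lt_trichotomy p.1 k' with h1 | h1 | h1
  · have h2 := ha h1
    have h3 := h1.trans e3
    clear ha
    grind
  · clear ha
    grind
  · have h2 := e4 h1
    have h3 := h2.trans_lt hp
    have h4 := h1.not_gt
    clear ha
    grind

theorem count_filter_finRange (q : Fin n → Bool) (k : Fin n) :
    ((List.finRange n).filter q).count k = if q k then 1 else 0 := by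
  split_ifs with h
  · rw [List.count_filter h]
    exact List.count_eq_one_of_mem (List.nodup_finRange n) (List.mem_finRange k)
  · rw [List.count_eq_zero]
    intro hk
    exact h (List.mem_filter.1 hk).2

theorem count_desc (p : Fin (n + 1) × Fin (n + 1)) (k : Fin n) :
    (desc p.1 p.2).count k = if p.1 ≤ k.castSucc ∧ k.castSucc < p.2 then 1 else 0 := by
  rw [desc, List.count_reverse, count_filter_finRange]
  simp

open scoped Classical in
theorem count_contribution {c : Perm (Fin (n + 1))} (hc : IsStdCoxeter c)
    (t : List (Fin (n + 1) × Fin (n + 1))) {p : Fin (n + 1) × Fin (n + 1)} (hp : p.1 < p.2)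
    (k : Fin n) : (contribution c t p).count k =
      if p.1 ≤ k.castSucc ∧ k.castSucc < p.2 then 1 else 0 := by
  have ha : p.1 < k.castSucc → (FromRight c t k ↔ ¬ FromLeft c t k) := by
    intro h
    apply fromRight_iff hc
    simp only [Fin.lt_def, Fin.val_castSucc] at h
    omega
  rw [contribution, leftPart, rightPart, centerPart, List.count_append, List.count_append,
    List.filter_reverse, List.count_reverse, List.filter_filter, List.filter_filter,
    count_filter_finRange, count_filter_finRange, count_filter_finRange]
  generalize k.castSucc = k' at *
  generalize FromLeft c t k = Lb at *
  generalize FromRight c t k = Rb at *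
  grind

theorem count_flatMap_eq_countP {F : Fin (n + 1) × Fin (n + 1) → List (Fin n)}
    {t : List (Fin (n + 1) × Fin (n + 1))} {k : Fin n}
    (h : ∀ p ∈ t, (F p).count k = if p.1 ≤ k.castSucc ∧ k.castSucc < p.2 then 1 else 0) :
    (t.flatMap F).count k = t.countP fun p => p.1 ≤ k.castSucc ∧ k.castSucc < p.2 := by
  induction t with
  | nil => simp
  | cons p t ih =>
    rw [List.flatMap_cons, List.count_append, ih fun q hq => h q (List.mem_cons_of_mem _ hq),
      h p (by simp), List.countP_cons, add_comm]
    simp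

/-- Edges that pass beyond `k` are those that have started minus those that have ended, so their
number depends only on the endpoints and not on how these are paired. -/
theorem countP_add_countP {t : List (Fin (n + 1) × Fin (n + 1))} (ht : ∀ p ∈ t, p.1 < p.2)
    (k : Fin (n + 1)) : (t.countP fun p => p.1 ≤ k ∧ k < p.2) +
      (t.map Prod.snd).countP (fun v => v ≤ k) = (t.map Prod.fst).countP (fun v => v ≤ k) := by
  induction t with
  | nil => simp
  | cons p t ih =>
    have h1 := ih fun q hq => ht q (List.mem_cons_of_mem _ hq)
    have h2 := ht p (by simp)
    simp only [List.countP_cons, List.map_cons]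
    grind

/-- A ballot condition: each end is preceded by enough starts, so matching in increasing order gives
genuine segments. -/
theorem zip_lt_of_countP {A B : List (Fin (n + 1))} (hA : A.Pairwise (· < ·))
    (hB : B.Pairwise (· < ·))
    (h : ∀ k, B.countP (fun v => v ≤ k) ≤ A.countP (fun v => v < k)) :
    ∀ p ∈ A.zip B, p.1 < p.2 := by
  induction A generalizing B with
  | nil => simp
  | cons d A ih =>
    rcases B with _ | ⟨u, B⟩
    · simp
    obtain ⟨hA1, hA2⟩ := List.pairwise_cons.1 hA
    obtain ⟨hB1, hB2⟩ := List.pairwise_cons.1 hB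
    have hdu : d < u := by
      have h1 := h u
      rw [List.countP_cons_of_pos (by simp)] at h1
      obtain ⟨v, hv, hvu⟩ := List.countP_pos_iff.1 (lt_of_lt_of_le (Nat.succ_pos _) h1)
      simp only [decide_eq_true_eq] at hvu
      rcases List.mem_cons.1 hv with rfl | hv
      · exact hvu
      · exact (hA1 v hv).trans hvu
    intro p hp
    rw [List.zip_cons_cons, List.mem_cons] at hp
    rcases hp with rfl | hp
    · exact hdu
    · refine ih hA2 hB2 ?_ p hp
      intro k
      by_cases hk : u ≤ k
      · have h1 := h k
        rw [List.countP_cons_of_pos (by simpa using hk),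
          List.countP_cons_of_pos (by simpa using hdu.trans_le hk)] at h1
        omega
      · have : B.countP (fun v => v ≤ k) = 0 := by
          rw [List.countP_eq_zero]
          intro v hv
          simp only [decide_eq_true_eq, not_le]
          exact (not_le.1 hk).trans (hB1 v hv)
        rw [this]
        exact Nat.zero_le _

theorem zip_pairwise {α : Type*} {r : α → α → Prop} {A B : List α} (hA : A.Pairwise r)
    (hB : B.Pairwise r) : (A.zip B).Pairwise fun p q => r p.1 q.1 ∧ r p.2 q.2 := by
  induction A generalizing B with
  | nil => simp
  | cons d A ih =>
    rcases B with _ | ⟨u, B⟩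
    · simp
    obtain ⟨hA1, hA2⟩ := List.pairwise_cons.1 hA
    obtain ⟨hB1, hB2⟩ := List.pairwise_cons.1 hB
    rw [List.zip_cons_cons, List.pairwise_cons]
    refine ⟨?_, ih hA2 hB2⟩
    intro p hp
    exact ⟨hA1 _ (List.of_mem_zip hp).1, hB1 _ (List.of_mem_zip hp).2⟩

/-- Both components increase, so the pair ending at `k` precedes those passing over `k`, which
precede the pair starting at `k`. -/
theorem Increasing.flatMap_edgeWord {β : Type*} {Z : List (Fin (n + 1) × Fin (n + 1))}
    (hZ : Increasing Z) (a b : β) (k : Fin (n + 1)) :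
    ∃ m, Z.flatMap (edgeWord [b, a] a b k) =
      (if k ∈ Z.map Prod.snd then [a] else []) ++ (List.replicate m [b, a]).flatten ++
        (if k ∈ Z.map Prod.fst then [b] else []) := by
  obtain ⟨h1, h2⟩ := hZ
  induction Z with
  | nil => exact ⟨0, by simp⟩
  | cons q Z ih =>
    obtain ⟨h3, h4⟩ := List.pairwise_cons.1 h1
    obtain ⟨m, hm⟩ := ih h4 fun p hp => h2 p (List.mem_cons_of_mem _ hp)
    have hq := h2 q (by simp)
    have hsnd : k ≤ q.2 → k ∉ Z.map Prod.snd := by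
      intro hk hk'
      obtain ⟨p, hp, rfl⟩ := List.mem_map.1 hk'
      exact absurd (h3 p hp).2 (not_lt.2 hk)
    have hfst : k ≤ q.1 → k ∉ Z.map Prod.fst := by
      intro hk hk'
      obtain ⟨p, hp, rfl⟩ := List.mem_map.1 hk'
      exact absurd (h3 p hp).1 (not_lt.2 hk)
    rw [List.flatMap_cons]
    by_cases h5 : k ≤ q.1
    · have h6 : Z.flatMap (edgeWord [b, a] a b k) = [] := by
        rw [List.flatMap_eq_nil_iff]
        intro p hp
        have := h3 p hp
        have h7 : k < p.1 := h5.trans_lt this.1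
        have h8 : k < p.2 := (h5.trans hq.le).trans_lt this.2
        simp [edgeWord, h7.not_gt, h7.ne', h8.ne']
      refine ⟨0, ?_⟩
      rw [h6]
      have h7 := hsnd (h5.trans hq.le)
      have h8 := hfst h5
      have h9 : k < q.2 := h5.trans_lt hq
      simp only [List.map_cons, List.mem_cons, h7, h8, or_false, h9.ne, if_false, edgeWord,
        h5.not_gt, false_and, h9.ne', eq_comm (a := k) (b := q.1)]
      simp
    · rw [not_le] at h5
      rcases lt_trichotomy q.2 k with h6 | h6 | h6
      · refine ⟨m, ?_⟩
        rw [hm]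
        simp [edgeWord, h6.not_gt, h5.ne, h5.ne', h6.ne, h6.ne']
      · refine ⟨m, ?_⟩
        rw [hm]
        simp [edgeWord, h5.ne, h5.ne', h6, hsnd h6.ge]
      · refine ⟨m + 1, ?_⟩
        rw [hm]
        simp [edgeWord, h5, h5.ne', h6, h6.ne, hsnd h6.le, List.replicate_succ]

/-! ### Polygons -/

theorem mem_Pol {x : Perm (Fin (n + 1))} {P : Finset (Fin (n + 1))} :
    P ∈ Pol x ↔ ∃ v ∈ x.support, P = (x.cycleOf v).support := by
  rw [Pol, Finset.mem_image]
  constructor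
  · rintro ⟨σ, hσ, rfl⟩
    obtain ⟨v, hv⟩ := (Perm.mem_cycleFactorsFinset_iff.1 hσ).1.nonempty_support
    refine ⟨v, Perm.mem_cycleFactorsFinset_support_le hσ hv, ?_⟩
    rw [← Perm.cycle_is_cycleOf hv hσ]
  · rintro ⟨v, hv, rfl⟩
    exact ⟨x.cycleOf v, Perm.cycleOf_mem_cycleFactorsFinset_iff.2 hv, rfl⟩

theorem mem_cycle {x : Perm (Fin (n + 1))} {v u : Fin (n + 1)} (hv : v ∈ x.support) :
    u ∈ (x.cycleOf v).support ↔ x.SameCycle v u := by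
  rw [Perm.mem_support_cycleOf_iff]
  exact and_iff_left hv

theorem isInitial_iff {x : Perm (Fin (n + 1))} {v : Fin (n + 1)} :
    IsInitial x v ↔ v ∈ x.support ∧ ∀ u, x.SameCycle v u → v ≤ u := by
  constructor
  · rintro ⟨P, hP, hv, h⟩
    obtain ⟨w, hw, rfl⟩ := mem_Pol.1 hP
    have h1 := (mem_cycle hw).1 hv
    refine ⟨Perm.support_cycleOf_le x w hv, fun u hu => h u ((mem_cycle hw).2 (h1.trans hu))⟩
  · rintro ⟨hv, h⟩
    exact ⟨_, mem_Pol.2 ⟨v, hv, rfl⟩, (mem_cycle hv).2 (Perm.SameCycle.refl _ _),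
      fun u hu => h u ((mem_cycle hv).1 hu)⟩

theorem isTerminal_iff {x : Perm (Fin (n + 1))} {v : Fin (n + 1)} :
    IsTerminal x v ↔ v ∈ x.support ∧ ∀ u, x.SameCycle v u → u ≤ v := by
  constructor
  · rintro ⟨P, hP, hv, h⟩
    obtain ⟨w, hw, rfl⟩ := mem_Pol.1 hP
    have h1 := (mem_cycle hw).1 hv
    refine ⟨Perm.support_cycleOf_le x w hv, fun u hu => h u ((mem_cycle hw).2 (h1.trans hu))⟩
  · rintro ⟨hv, h⟩
    exact ⟨_, mem_Pol.2 ⟨v, hv, rfl⟩, (mem_cycle hv).2 (Perm.SameCycle.refl _ _),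
      fun u hu => h u ((mem_cycle hv).1 hu)⟩

theorem sameCycle_mem_support {x : Perm (Fin (n + 1))} {v u : Fin (n + 1)} (h : x.SameCycle v u)
    (hv : v ∈ x.support) : u ∈ x.support := by
  rw [Perm.mem_support] at hv ⊢
  intro hu
  exact hv (h.symm.apply_eq_self_iff.1 hu)

theorem mem_D {x : Perm (Fin (n + 1))} {k : Fin (n + 1)} :
    k ∈ D x ↔ ∃ j, x.SameCycle k j ∧ k < j := by
  classical
  rw [D, Finset.mem_filter, isTerminal_iff, not_and]
  constructor
  · rintro ⟨h1, h2⟩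
    simpa using h2 h1
  · rintro ⟨j, hj, hkj⟩
    refine ⟨?_, fun _ h => absurd (h j hj) (not_le.2 hkj)⟩
    rw [Perm.mem_support]
    intro hk
    exact hkj.ne (hj.eq_of_left hk)

theorem mem_U {x : Perm (Fin (n + 1))} {k : Fin (n + 1)} :
    k ∈ U x ↔ ∃ j, x.SameCycle k j ∧ j < k := by
  classical
  rw [U, Finset.mem_filter, isInitial_iff, not_and]
  constructor
  · rintro ⟨h1, h2⟩
    simpa using h2 h1
  · rintro ⟨j, hj, hkj⟩
    refine ⟨?_, fun _ h => absurd (h j hj) (not_le.2 hkj)⟩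
    rw [Perm.mem_support]
    intro hk
    exact hkj.ne' (hj.eq_of_left hk)

theorem exists_isInitial {x : Perm (Fin (n + 1))} {k : Fin (n + 1)} (hk : k ∈ x.support) :
    ∃ v, IsInitial x v ∧ x.SameCycle v k := by
  have h0 : (x.cycleOf k).support.Nonempty := ⟨k, (mem_cycle hk).2 (Perm.SameCycle.refl _ _)⟩
  have h1 := (mem_cycle hk).1 (Finset.min'_mem _ h0)
  refine ⟨_, isInitial_iff.2 ⟨sameCycle_mem_support h1 hk, ?_⟩, h1.symm⟩
  intro u hu
  exact Finset.min'_le _ _ ((mem_cycle hk).2 (h1.trans hu))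

theorem exists_isTerminal {x : Perm (Fin (n + 1))} {k : Fin (n + 1)} (hk : k ∈ x.support) :
    ∃ v, IsTerminal x v ∧ x.SameCycle v k := by
  have h0 : (x.cycleOf k).support.Nonempty := ⟨k, (mem_cycle hk).2 (Perm.SameCycle.refl _ _)⟩
  have h1 := (mem_cycle hk).1 (Finset.max'_mem _ h0)
  refine ⟨_, isTerminal_iff.2 ⟨sameCycle_mem_support h1 hk, ?_⟩, h1.symm⟩
  intro u hu
  exact Finset.le_max' _ _ ((mem_cycle hk).2 (h1.trans hu))

theorem IsInitial.eq_of_sameCycle {x : Perm (Fin (n + 1))} {u v : Fin (n + 1)}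
    (hu : IsInitial x u) (hv : IsInitial x v) (h : x.SameCycle u v) : u = v :=
  le_antisymm ((isInitial_iff.1 hu).2 v h) ((isInitial_iff.1 hv).2 u h.symm)

theorem nested_cycle_iff {x : Perm (Fin (n + 1))} {k v : Fin (n + 1)} (hv : v ∈ x.support) :
    Nested k (x.cycleOf v).support ↔
      ¬ x.SameCycle v k ∧ (∃ a, x.SameCycle v a ∧ a < k) ∧ ∃ b, x.SameCycle v b ∧ k < b := by
  simp only [Nested, mem_cycle hv]

/-! ### Crossing -/

/-- `u` lies strictly between `a` and `b`. -/
def Btw (a b u : ℕ) : Prop := (a < u ∧ u < b) ∨ (b < u ∧ u < a)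

/-- The pairs `a, b` and `u, v` separate each other. -/
def Sep (a b u v : ℕ) : Prop :=
  (a ≠ u ∧ a ≠ v ∧ b ≠ u ∧ b ≠ v) ∧ (Btw a b u ↔ ¬ Btw a b v)

/-- The position `y` counted from `z` on a circle with `N` positions. -/
def rot (N z y : ℕ) : ℕ := if y < z then y + N - z else y - z

theorem rot_inj {N z a b : ℕ} (hz : z < N) (ha : a < N) (hb : b < N) :
    rot N z a = rot N z b ↔ a = b := by
  unfold rot
  split_ifs <;> omega

/-- Moving the cut of the circle to `z` exchanges inside and outside of the pair `a, b` exactly when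
`z` separates it. The change does not depend on `u`, hence separation is invariant under rotation.
-/
theorem btw_rot_iff {N z a b u : ℕ} (hz : z < N) (ha : a < N) (hb : b < N) (hu : u < N)
    (hau : a ≠ u) (hbu : b ≠ u) :
    Btw (rot N z a) (rot N z b) (rot N z u) ↔ ((a < z ↔ b < z) ↔ Btw a b u) := by
  unfold Btw rot
  by_cases h1 : a < z <;> by_cases h2 : b < z <;> by_cases h3 : u < z <;>
    simp only [h1, h2, h3, if_true, if_false, true_iff, false_iff, not_true_eq_false] <;> omega

theorem sep_rot_iff {N z a b u v : ℕ} (hz : z < N) (ha : a < N) (hb : b < N) (hu : u < N)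
    (hv : v < N) : Sep (rot N z a) (rot N z b) (rot N z u) (rot N z v) ↔ Sep a b u v := by
  unfold Sep
  simp only [ne_eq, rot_inj hz ha hu, rot_inj hz ha hv, rot_inj hz hb hu, rot_inj hz hb hv]
  apply and_congr_right
  rintro ⟨h1, h2, h3, h4⟩
  rw [btw_rot_iff hz ha hb hu h1 h3, btw_rot_iff hz ha hb hv h2 h4]
  by_cases h5 : (a < z ↔ b < z) <;> by_cases h6 : Btw a b u <;> by_cases h7 : Btw a b v <;>
    simp [h5, h6, h7]

theorem cross_iff {c : Perm (Fin (n + 1))} (hc : IsStdCoxeter c) {P Q : Finset (Fin (n + 1))} :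
    Cross c P Q ↔ ∃ a ∈ P, ∃ b ∈ P, ∃ u ∈ Q, ∃ v ∈ Q,
      Sep (ht c a) (ht c b) (ht c u) (ht c v) := by
  simp only [Cross, hc.pos_lt_iff]
  constructor
  · rintro ⟨a, ha, b, hb, u, hu, v, hv, h⟩
    exact ⟨a, ha, b, hb, u, hu, v, hv, by unfold Sep Btw; omega⟩
  · rintro ⟨a, ha, b, hb, u, hu, v, hv, h⟩
    unfold Sep Btw at h
    rcases le_total (ht c a) (ht c b) with h1 | h1 <;> rcases le_total (ht c u) (ht c v) with h2 | h2
    · exact ⟨a, ha, b, hb, u, hu, v, hv, by omega⟩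
    · exact ⟨a, ha, b, hb, v, hv, u, hu, by omega⟩
    · exact ⟨b, hb, a, ha, u, hu, v, hv, by omega⟩
    · exact ⟨b, hb, a, ha, v, hv, u, hu, by omega⟩

theorem IsStdCoxeter.not_sep {c x : Perm (Fin (n + 1))} (hc : IsStdCoxeter c) (hx : x ∈ NC c)
    {a b u v : Fin (n + 1)} (hab : x.SameCycle a b) (huv : x.SameCycle u v)
    (hau : ¬ x.SameCycle a u) : ¬ Sep (ht c a) (ht c b) (ht c u) (ht c v) := by
  have h := hc.arcInvariant_of_mem_NC hx
  have i := hc.ht_inj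
  unfold Sep Btw
  rcases le_total (ht c a) (ht c b) with h1 | h1 <;> rcases le_total (ht c u) (ht c v) with h2 | h2
  · have := h.noncrossing i hab huv hau
    omega
  · have := h.noncrossing i hab huv.symm fun h => hau (h.trans huv.symm)
    omega
  · have := h.noncrossing i hab.symm huv fun h => hau (hab.trans h)
    omega
  · have := h.noncrossing i hab.symm huv.symm fun h => hau (hab.trans (h.trans huv.symm))
    omega

theorem ht_lt (c : Perm (Fin (n + 1))) (v : Fin (n + 1)) : ht c v < 2 * n + 1 := by
  have := v.2
  unfold ht
  split_ifs <;> omega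

/-- Seen from a point `k` on the left part, the points below `k` come before the points above `k`. -/
theorem IsStdCoxeter.rot_le_iff {c : Perm (Fin (n + 1))} (hc : IsStdCoxeter c)
    {k v : Fin (n + 1)} (hk : k ∉ R c) :
    (v < k → rot (2 * n + 1) (ht c k) (ht c v) ≤ 2 * k) ∧
    (k < v → 2 * k < rot (2 * n + 1) (ht c k) (ht c v)) ∧
    (k ≠ v → 0 < rot (2 * n + 1) (ht c k) (ht c v)) ∧ rot (2 * n + 1) (ht c k) (ht c k) = 0 := by
  -- Clockwise from `k` the left points `v` below `k` have position `k - v`, and a right point `v`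
  -- has position `k + v + 1`. The bound `2 * k` is the latter for `v = k - 1`.
  have h1 := hc.pos_of_mem_R hk
  have h2 := hc.pos_of_mem_R (v := v)
  have b := v.2
  simp only [ne_eq, Fin.lt_def, Fin.ext_iff]
  unfold rot ht
  by_cases h3 : v ∈ R c <;>
    simp only [hk, h3, if_true, if_false, not_true_eq_false, not_false_eq_true, forall_const] at h2 ⊢ <;>
    (split_ifs <;> omega)

theorem rot_ht_inj {c : Perm (Fin (n + 1))} (hc : IsStdCoxeter c) {k u v : Fin (n + 1)}
    (h : rot (2 * n + 1) (ht c k) (ht c u) = rot (2 * n + 1) (ht c k) (ht c v)) : u = v := by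
  apply hc.ht_inj
  have := ht_lt c u
  have := ht_lt c v
  have := ht_lt c k
  unfold rot at h
  split_ifs at h <;> omega

/-! ### Points added or removed by the involution, and the polygons visible from them -/

theorem IsStdCoxeter.mem_N {c x : Perm (Fin (n + 1))} (hc : IsStdCoxeter c) {k : Fin (n + 1)} :
    k ∈ N c x ↔ k ∉ R c ∧ k ∉ x.support ∧ ∃ P ∈ Pol x, Nested k P := by
  classical
  rw [N, Finset.mem_filter, hc.mem_L]
  constructor
  · rintro ⟨h1, h2, P, hP, hk⟩
    refine ⟨?_, h2, P, hP, hk⟩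
    obtain ⟨-, ⟨a, -, ha⟩, b, -, hb⟩ := hk
    rcases h1 with rfl | rfl | h1
    · exact absurd ha (Fin.not_lt_zero _)
    · exact absurd hb (not_lt.2 (Fin.le_last _))
    · exact h1
  · rintro ⟨h1, h2, h3⟩
    exact ⟨Or.inr (Or.inr h1), h2, h3⟩

theorem IsStdCoxeter.mem_M {c x : Perm (Fin (n + 1))} (hc : IsStdCoxeter c) {k : Fin (n + 1)} :
    k ∈ M c x ↔ k ∈ D x ∧ k ∈ U x ∧ k ∉ R c := by
  rw [M, Finset.mem_inter, Finset.mem_inter, hc.mem_L, mem_D, mem_U, and_assoc]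
  constructor
  · rintro ⟨⟨j, hj, hj'⟩, ⟨i, hi, hi'⟩, h⟩
    refine ⟨⟨j, hj, hj'⟩, ⟨i, hi, hi'⟩, ?_⟩
    rcases h with rfl | rfl | h
    · exact absurd hi' (Fin.not_lt_zero _)
    · exact absurd hj' (not_lt.2 (Fin.le_last _))
    · exact h
  · rintro ⟨h1, h2, h3⟩
    exact ⟨h1, h2, Or.inr (Or.inr h3)⟩

/-- The point `k` can be added to the polygon `P` without creating crossings. -/
def Visible (c x : Perm (Fin (n + 1))) (k : Fin (n + 1)) (P : Finset (Fin (n + 1))) : Prop :=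
  Nested k P ∧ ∀ Q ∈ Pol x, Q ≠ P → ¬ Cross c (insert k P) Q

/-- Otherwise the chord from `k` to `q` would separate `p` from a vertex of `P` above `k`. So,
clockwise from `k`, no other polygon nesting `k` is met before a lower vertex of a visible one. -/
theorem Visible.not_rot_lt {c x : Perm (Fin (n + 1))} (hc : IsStdCoxeter c) {k : Fin (n + 1)}
    (hk : k ∉ R c) {P Q : Finset (Fin (n + 1))} (hQ : Visible c x k Q) (hP : P ∈ Pol x)
    (hPk : Nested k P) (hPQ : P ≠ Q) {p q : Fin (n + 1)} (hp : p ∈ P) (hq : q ∈ Q) (hqk : q < k) :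
    ¬ rot (2 * n + 1) (ht c k) (ht c p) < rot (2 * n + 1) (ht c k) (ht c q) := by
  intro h
  obtain ⟨hkP, -, b, hb, hkb⟩ := hPk
  apply hQ.2 P hP hPQ
  rw [cross_iff hc]
  refine ⟨k, Finset.mem_insert_self _ _, q, Finset.mem_insert_of_mem hq, p, hp, b, hb, ?_⟩
  rw [← sep_rot_iff (ht_lt c k) (ht_lt c k) (ht_lt c q) (ht_lt c p) (ht_lt c b)]
  have h1 := (hc.rot_le_iff (v := q) hk).1 hqk
  have h2 := (hc.rot_le_iff (v := b) hk).2.1 hkb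
  have h3 := (hc.rot_le_iff (v := p) hk)
  rw [h3.2.2.2]
  have h4 : k ≠ p := by
    rintro rfl
    exact hkP hp
  have h5 := h3.2.2.1 h4
  unfold Sep Btw
  omega

/-- Applied in both directions, `Visible.not_rot_lt` makes two lower vertices coincide, and polygons
sharing a vertex are equal. -/
theorem Visible.unique {c x : Perm (Fin (n + 1))} (hc : IsStdCoxeter c) {k : Fin (n + 1)}
    (hk : k ∉ R c) {P Q : Finset (Fin (n + 1))} (hP : P ∈ Pol x) (hQ : Q ∈ Pol x)
    (hPk : Visible c x k P) (hQk : Visible c x k Q) : P = Q := by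
  by_contra hPQ
  obtain ⟨p, hp, hpk⟩ := hPk.1.2.1
  obtain ⟨q, hq, hqk⟩ := hQk.1.2.1
  have h1 := hQk.not_rot_lt hc hk hP hPk.1 hPQ hp hq hqk
  have h2 := hPk.not_rot_lt hc hk hQ hQk.1 (Ne.symm hPQ) hq hp hpk
  have h3 := rot_ht_inj hc (le_antisymm (not_lt.1 h2) (not_lt.1 h1))
  subst h3
  obtain ⟨v, hv, rfl⟩ := mem_Pol.1 hP
  obtain ⟨w, hw, rfl⟩ := mem_Pol.1 hQ
  apply hPQ
  have h4 := ((mem_cycle hv).1 hp).trans ((mem_cycle hw).1 hq).symm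
  rw [h4.cycleOf_eq]

theorem exists_visible {c x : Perm (Fin (n + 1))} (hc : IsStdCoxeter c) (hx : x ∈ NC c)
    {k : Fin (n + 1)} (hk : k ∈ N c x) :
    ∃ v, IsInitial x v ∧ Visible c x k (x.cycleOf v).support := by
  obtain ⟨hkR, hks, P, hP, hkP⟩ := hc.mem_N.1 hk
  obtain ⟨w, hw, rfl⟩ := mem_Pol.1 hP
  classical
  -- The visible polygon is the first one met clockwise from `k` among those nesting `k`.
  set S := x.support.filter fun p => Nested k (x.cycleOf p).support with hS
  obtain ⟨p, hp, hmin⟩ := Finset.exists_min_image S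
    (fun v => rot (2 * n + 1) (ht c k) (ht c v)) ⟨w, by rw [hS, Finset.mem_filter]; exact ⟨hw, hkP⟩⟩
  rw [hS, Finset.mem_filter] at hp
  obtain ⟨hps, hpk⟩ := hp
  obtain ⟨v, hv, hvp⟩ := exists_isInitial hps
  refine ⟨v, hv, ?_⟩
  rw [hvp.cycleOf_eq]
  refine ⟨hpk, ?_⟩
  intro Q hQ hQP hcross
  obtain ⟨q, hq, rfl⟩ := mem_Pol.1 hQ
  have hpq : ¬ x.SameCycle p q := fun h => hQP (by rw [h.cycleOf_eq])
  rw [cross_iff hc] at hcross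
  obtain ⟨hpk0, ⟨a0, ha0, ha0k⟩, b0, hb0, hb0k⟩ := (nested_cycle_iff hps).1 hpk
  have hS' : ∀ r, x.SameCycle p r → r ∈ S := by
    intro r hr
    rw [hS, Finset.mem_filter]
    exact ⟨sameCycle_mem_support hr hps, by rwa [← hr.cycleOf_eq]⟩
  -- If `Q` had vertices before and after `b`, noncrossing would put `u` before `p` and `w` after
  -- `b0`. Then `u < k < w`, so `Q` would nest `k` and be met earlier than `p`.
  have key : ∀ b u w, x.SameCycle p b → x.SameCycle q u → x.SameCycle q w →
      ¬ (rot (2 * n + 1) (ht c k) (ht c u) < rot (2 * n + 1) (ht c k) (ht c b) ∧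
        rot (2 * n + 1) (ht c k) (ht c b) < rot (2 * n + 1) (ht c k) (ht c w)) := by
    rintro b u w hb hu hw ⟨h1, h2⟩
    have hnb : ¬ x.SameCycle b u := fun h => hpq (hb.trans (h.trans hu.symm))
    have s1 := hc.not_sep hx (hb.symm) (hu.symm.trans hw) hnb
    have s2 := hc.not_sep hx (hb.symm.trans hb0) (hu.symm.trans hw) hnb
    rw [← sep_rot_iff (ht_lt c k) (ht_lt c _) (ht_lt c _) (ht_lt c _) (ht_lt c _)] at s1 s2
    have n1 : rot (2 * n + 1) (ht c k) (ht c p) ≠ rot (2 * n + 1) (ht c k) (ht c u) := by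
      intro h
      rw [rot_ht_inj hc h] at hpq
      exact hpq hu.symm
    have n2 : rot (2 * n + 1) (ht c k) (ht c b0) ≠ rot (2 * n + 1) (ht c k) (ht c w) := by
      intro h
      rw [rot_ht_inj hc h] at hb0
      exact hpq (hb0.trans hw.symm)
    have m1 := hmin a0 (hS' a0 ha0)
    have m2 := hmin b (hS' b hb)
    have l1 := (hc.rot_le_iff (v := a0) hkR).1 ha0k
    have l2 := (hc.rot_le_iff (v := b0) hkR).2.1 hb0k
    have q1 : rot (2 * n + 1) (ht c k) (ht c u) < rot (2 * n + 1) (ht c k) (ht c p) := by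
      unfold Sep Btw at s1; omega
    have q2 : rot (2 * n + 1) (ht c k) (ht c b0) < rot (2 * n + 1) (ht c k) (ht c w) := by
      unfold Sep Btw at s2; omega
    have hku : k ≠ u := by
      rintro rfl
      exact hks (sameCycle_mem_support hu hq)
    have hkw : k ≠ w := by
      rintro rfl
      exact hks (sameCycle_mem_support hw hq)
    have hu1 : u < k := by
      by_contra h
      have := (hc.rot_le_iff (v := u) hkR).2.1 (lt_of_le_of_ne (not_lt.1 h) hku)
      omega
    have hw1 : k < w := by
      by_contra h
      have := (hc.rot_le_iff (v := w) hkR).1 (lt_of_le_of_ne (not_lt.1 h) hkw.symm)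
      omega
    have hus := sameCycle_mem_support hu hq
    have : u ∈ S := by
      rw [hS, Finset.mem_filter]
      refine ⟨hus, (nested_cycle_iff hus).2 ⟨?_, ⟨u, Perm.SameCycle.refl _ _, hu1⟩, w,
        hu.symm.trans hw, hw1⟩⟩
      intro h
      exact hks (sameCycle_mem_support h hus)
    have := hmin u this
    omega
  obtain ⟨a, ha, b, hb, u, hu, w, hw, hsep⟩ := hcross
  rw [mem_cycle hq] at hu hw
  rw [Finset.mem_insert, mem_cycle hps] at ha hb
  rcases ha with rfl | ha <;> rcases hb with rfl | hb
  · unfold Sep Btw at hsep; omega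
  · rw [← sep_rot_iff (ht_lt c a) (ht_lt c _) (ht_lt c _) (ht_lt c _) (ht_lt c _),
      (hc.rot_le_iff (v := a) hkR).2.2.2] at hsep
    have k1 := key b u w hb hu hw
    have k2 := key b w u hb hw hu
    unfold Sep Btw at hsep
    omega
  · rw [← sep_rot_iff (ht_lt c b) (ht_lt c _) (ht_lt c _) (ht_lt c _) (ht_lt c _),
      (hc.rot_le_iff (v := b) hkR).2.2.2] at hsep
    have k1 := key a u w ha hu hw
    have k2 := key a w u ha hw hu
    unfold Sep Btw at hsep
    omega
  · exact hc.not_sep hx (ha.symm.trans hb) (hu.symm.trans hw)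
      (fun h => hpq (ha.trans (h.trans hu.symm))) hsep

/-! ### The involution -/

/-- The block of the image of the involution with smallest element `v`. -/
noncomputable def invBlock (c x : Perm (Fin (n + 1))) (v : Fin (n + 1)) : Finset (Fin (n + 1)) :=
  enlarge c x (x.cycleOf v).support \ M c x

section

variable {c x : Perm (Fin (n + 1))}

theorem mem_invBlock (hc : IsStdCoxeter c) {v k : Fin (n + 1)} (hv : v ∈ x.support) :
    k ∈ invBlock c x v ↔ (x.SameCycle v k ∧ k ∉ M c x) ∨
      (k ∈ N c x ∧ Visible c x k (x.cycleOf v).support) := by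
  classical
  rw [invBlock, Finset.mem_sdiff, enlarge, Finset.mem_union, mem_cycle hv, Finset.mem_filter]
  constructor
  · rintro ⟨h1 | h1, h2⟩
    · exact Or.inl ⟨h1, h2⟩
    · exact Or.inr h1
  · rintro (⟨h1, h2⟩ | h1)
    · exact ⟨Or.inl h1, h2⟩
    · refine ⟨Or.inr h1, fun h2 => ?_⟩
      obtain ⟨j, hj, hkj⟩ := mem_D.1 (hc.mem_M.1 h2).1
      apply (hc.mem_N.1 h1.1).2.1
      rw [Perm.mem_support]
      intro hk
      exact hkj.ne (hj.eq_of_left hk)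

theorem min_mem_invBlock (hc : IsStdCoxeter c) {v : Fin (n + 1)} (hv : IsInitial x v) :
    v ∈ invBlock c x v := by
  obtain ⟨h1, h2⟩ := isInitial_iff.1 hv
  rw [mem_invBlock hc h1]
  refine Or.inl ⟨Perm.SameCycle.refl _ _, fun h => ?_⟩
  obtain ⟨j, hj, hjv⟩ := mem_U.1 (hc.mem_M.1 h).2.1
  exact absurd (h2 j hj) (not_le.2 hjv)

theorem le_of_mem_invBlock (hc : IsStdCoxeter c) {v k : Fin (n + 1)} (hv : IsInitial x v)
    (hk : k ∈ invBlock c x v) : v ≤ k := by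
  obtain ⟨h1, h2⟩ := isInitial_iff.1 hv
  rw [mem_invBlock hc h1] at hk
  rcases hk with hk | hk
  · exact h2 k hk.1
  · obtain ⟨-, ⟨a, ha, hak⟩, -⟩ := hk.2.1
    exact (h2 a ((mem_cycle h1).1 ha)).trans hak.le

/-- The terminal vertex is not in `D x`, hence not removed, and added points are nested, so the
block keeps its maximum. -/
theorem exists_max_invBlock (hc : IsStdCoxeter c) {v : Fin (n + 1)} (hv : IsInitial x v) :
    ∃ m ∈ invBlock c x v, v < m ∧ (∀ k ∈ invBlock c x v, k ≤ m) ∧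
      ∀ k, x.SameCycle v k → k ≤ m := by
  obtain ⟨h1, h2⟩ := isInitial_iff.1 hv
  obtain ⟨m, hm, hmv⟩ := exists_isTerminal h1
  obtain ⟨h3, h4⟩ := isTerminal_iff.1 hm
  have h5 : ∀ k, x.SameCycle v k → k ≤ m := fun k hk => h4 k (hmv.trans hk)
  refine ⟨m, ?_, ?_, ?_, h5⟩
  · rw [mem_invBlock hc h1]
    refine Or.inl ⟨hmv.symm, fun h => ?_⟩
    obtain ⟨j, hj, hjv⟩ := mem_D.1 (hc.mem_M.1 h).1
    exact absurd (h4 j hj) (not_le.2 hjv)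
  · refine lt_of_le_of_ne (h5 v (Perm.SameCycle.refl _ _)) ?_
    rintro rfl
    rw [Perm.mem_support] at h1
    have h6 : x.SameCycle v (x v) := Perm.sameCycle_apply_right.2 (Perm.SameCycle.refl _ _)
    exact h1 (le_antisymm (h5 _ h6) (h2 _ h6))
  · intro k hk
    rw [mem_invBlock hc h1] at hk
    rcases hk with hk | hk
    · exact h5 k hk.1
    · obtain ⟨-, -, b, hb, hkb⟩ := hk.2.1
      exact hkb.le.trans (h5 b ((mem_cycle h1).1 hb))

theorem invBlock_disjoint (hc : IsStdCoxeter c) {u v k : Fin (n + 1)} (hu : IsInitial x u)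
    (hv : IsInitial x v) (hku : k ∈ invBlock c x u) (hkv : k ∈ invBlock c x v) : u = v := by
  have h1 := (isInitial_iff.1 hu).1
  have h2 := (isInitial_iff.1 hv).1
  rw [mem_invBlock hc h1] at hku
  rw [mem_invBlock hc h2] at hkv
  apply hu.eq_of_sameCycle hv
  rcases hku with ⟨h3, -⟩ | ⟨h3, h5⟩ <;> rcases hkv with ⟨h4, -⟩ | ⟨h4, h6⟩
  · exact h3.trans h4.symm
  · exact absurd (sameCycle_mem_support h3 h1) (hc.mem_N.1 h4).2.1
  · exact absurd (sameCycle_mem_support h4 h2) (hc.mem_N.1 h3).2.1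
  · have h7 := h5.unique hc (hc.mem_N.1 h3).1 (mem_Pol.2 ⟨u, h1, rfl⟩) (mem_Pol.2 ⟨v, h2, rfl⟩) h6
    rw [← mem_cycle h1, h7, mem_cycle h2]

theorem blockCycle_props (hc : IsStdCoxeter c) {B : Finset (Fin (n + 1))} {a b : Fin (n + 1)}
    (ha : a ∈ B) (hb : b ∈ B) (hab : a ≠ b) :
    (blockCycle c B).IsCycle ∧ (blockCycle c B).support = B := by
  have h1 : ((circle c).filter fun v => v ∈ B).Nodup := hc.circle_nodup.filter _
  have h2 : ∀ v, v ∈ ((circle c).filter fun v => v ∈ B) ↔ v ∈ B := by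
    intro v
    simp [hc.mem_circle v]
  rw [blockCycle]
  generalize (circle c).filter (fun v => decide (v ∈ B)) = l at h1 h2
  have h3 : ∀ y, l ≠ [y] := by
    rintro y rfl
    simp only [List.mem_singleton] at h2
    exact hab (((h2 a).2 ha).trans ((h2 b).2 hb).symm)
  constructor
  · apply List.isCycle_formPerm h1
    rcases l with _ | ⟨y, _ | ⟨z, l⟩⟩
    · exact absurd ((h2 a).2 ha) (by simp)
    · exact absurd rfl (h3 y)
    · simp
  · rw [List.support_formPerm_of_nodup _ h1 h3]
    ext v
    rw [List.mem_toFinset, h2]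

theorem mem_initials (hc : IsStdCoxeter c) {v : Fin (n + 1)} [DecidablePred (IsInitial x)] :
    v ∈ ((ccwCircle c).filter fun v => decide (IsInitial x v)) ↔ IsInitial x v := by
  simp [hc.mem_ccwCircle v]

/-- The block cycles are pairwise disjoint, so they are the cycle factors of their product. -/
theorem Pol_inv (hc : IsStdCoxeter c) {P : Finset (Fin (n + 1))} :
    P ∈ Pol (inv c x) ↔ ∃ v, IsInitial x v ∧ P = invBlock c x v := by
  classical
  set V := (ccwCircle c).filter fun v => decide (IsInitial x v) with hV
  have hVmem : ∀ v, v ∈ V ↔ IsInitial x v := fun v => mem_initials hc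
  have hVnd : V.Nodup := hc.ccwCircle_nodup.filter _
  have hprops : ∀ v ∈ V, (blockCycle c (invBlock c x v)).IsCycle ∧
      (blockCycle c (invBlock c x v)).support = invBlock c x v := by
    intro v hv
    rw [hVmem] at hv
    obtain ⟨m, hm, hvm, -⟩ := exists_max_invBlock hc hv
    exact blockCycle_props hc (min_mem_invBlock hc hv) hm hvm.ne
  set l := V.map fun v => blockCycle c (invBlock c x v) with hl
  have hprod : l.prod = inv c x := by
    rw [hl, inv, cycleList, List.map_map]
    rfl
  have hdis : l.Pairwise Perm.Disjoint := by
    rw [hl, List.pairwise_map]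
    refine List.Pairwise.imp_of_mem ?_ hVnd
    intro u v hu hv huv
    rw [Perm.disjoint_iff_disjoint_support, (hprops u hu).2, (hprops v hv).2,
      Finset.disjoint_left]
    intro k hk hk'
    rw [hVmem] at hu hv
    exact huv (invBlock_disjoint hc hu hv hk hk')
  have hcyc : ∀ f ∈ l, f.IsCycle := by
    intro f hf
    obtain ⟨v, hv, rfl⟩ := List.mem_map.1 hf
    exact (hprops v hv).1
  have hnd : l.Nodup := by
    apply Perm.nodup_of_pairwise_disjoint _ hdis
    intro h1
    exact (hcyc 1 h1).ne_one rfl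
  have hcf : (inv c x).cycleFactorsFinset = l.toFinset :=
    (Perm.cycleFactorsFinset_eq_list_toFinset hnd).2 ⟨hcyc, hdis, hprod⟩
  rw [Pol, hcf, Finset.mem_image]
  constructor
  · rintro ⟨σ, hσ, rfl⟩
    rw [List.mem_toFinset, hl, List.mem_map] at hσ
    obtain ⟨v, hv, rfl⟩ := hσ
    exact ⟨v, (hVmem v).1 hv, (hprops v hv).2⟩
  · rintro ⟨v, hv, rfl⟩
    rw [← hVmem] at hv
    exact ⟨_, List.mem_toFinset.2 (List.mem_map.2 ⟨v, hv, rfl⟩), (hprops v hv).2⟩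

theorem mem_D_iff_Pol {y : Perm (Fin (n + 1))} {k : Fin (n + 1)} :
    k ∈ D y ↔ ∃ P ∈ Pol y, k ∈ P ∧ ∃ j ∈ P, k < j := by
  rw [mem_D]
  constructor
  · rintro ⟨j, hj, hkj⟩
    have hk : k ∈ y.support := by
      rw [Perm.mem_support]
      intro hk
      exact hkj.ne (hj.eq_of_left hk)
    exact ⟨_, mem_Pol.2 ⟨k, hk, rfl⟩, (mem_cycle hk).2 (Perm.SameCycle.refl _ _), j,
      (mem_cycle hk).2 hj, hkj⟩
  · rintro ⟨P, hP, hk, j, hj, hkj⟩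
    obtain ⟨v, hv, rfl⟩ := mem_Pol.1 hP
    rw [mem_cycle hv] at hk hj
    exact ⟨j, hk.symm.trans hj, hkj⟩

theorem mem_U_iff_Pol {y : Perm (Fin (n + 1))} {k : Fin (n + 1)} :
    k ∈ U y ↔ ∃ P ∈ Pol y, k ∈ P ∧ ∃ j ∈ P, j < k := by
  rw [mem_U]
  constructor
  · rintro ⟨j, hj, hkj⟩
    have hk : k ∈ y.support := by
      rw [Perm.mem_support]
      intro hk
      exact hkj.ne' (hj.eq_of_left hk)
    exact ⟨_, mem_Pol.2 ⟨k, hk, rfl⟩, (mem_cycle hk).2 (Perm.SameCycle.refl _ _), j,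
      (mem_cycle hk).2 hj, hkj⟩
  · rintro ⟨P, hP, hk, j, hj, hkj⟩
    obtain ⟨v, hv, rfl⟩ := mem_Pol.1 hP
    rw [mem_cycle hv] at hk hj
    exact ⟨j, hk.symm.trans hj, hkj⟩

/-- Blocks keep their extremes, removed vertices are intermediate and added points are nested. With
`mem_U_inv` this is all the comparison needs from the involution: `D` and `U` change by the same
points. -/
theorem mem_D_inv (hc : IsStdCoxeter c) (hx : x ∈ NC c) {k : Fin (n + 1)} :
    k ∈ D (inv c x) ↔ (k ∈ D x ∧ k ∉ M c x) ∨ k ∈ N c x := by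
  rw [mem_D_iff_Pol]
  constructor
  · rintro ⟨P, hP, hk, j, hj, hkj⟩
    obtain ⟨v, hv, rfl⟩ := (Pol_inv hc).1 hP
    have hvs := (isInitial_iff.1 hv).1
    obtain ⟨m, hm, hvm, h1, h2⟩ := exists_max_invBlock hc hv
    rw [mem_invBlock hc hvs] at hk hm
    rcases hk with ⟨hk, hkM⟩ | ⟨hk, -⟩
    · left
      refine ⟨mem_D.2 ⟨m, ?_, hkj.trans_le (h1 j hj)⟩, hkM⟩
      rcases hm with ⟨hm, -⟩ | ⟨-, hm⟩
      · exact hk.symm.trans hm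
      · obtain ⟨-, -, b, hb, hmb⟩ := hm.1
        exact absurd (h2 b ((mem_cycle hvs).1 hb)) (not_le.2 hmb)
    · exact Or.inr hk
  · rintro (⟨hk, hkM⟩ | hk)
    · obtain ⟨j, hj, hkj⟩ := mem_D.1 hk
      have hks : k ∈ x.support := by
        rw [Perm.mem_support]
        intro hk
        exact hkj.ne (hj.eq_of_left hk)
      obtain ⟨v, hv, hvk⟩ := exists_isInitial hks
      obtain ⟨m, hm, hvm, h1, h2⟩ := exists_max_invBlock hc hv
      exact ⟨_, (Pol_inv hc).2 ⟨v, hv, rfl⟩,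
        (mem_invBlock hc (isInitial_iff.1 hv).1).2 (Or.inl ⟨hvk, hkM⟩), m, hm,
        hkj.trans_le (h2 j (hvk.trans hj))⟩
    · obtain ⟨v, hv, hvk⟩ := exists_visible hc hx hk
      obtain ⟨m, hm, hvm, h1, h2⟩ := exists_max_invBlock hc hv
      obtain ⟨-, -, b, hb, hkb⟩ := hvk.1
      have hvs := (isInitial_iff.1 hv).1
      exact ⟨_, (Pol_inv hc).2 ⟨v, hv, rfl⟩,
        (mem_invBlock hc hvs).2 (Or.inr ⟨hk, hvk⟩), m, hm,
        hkb.trans_le (h2 b ((mem_cycle hvs).1 hb))⟩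

theorem mem_U_inv (hc : IsStdCoxeter c) (hx : x ∈ NC c) {k : Fin (n + 1)} :
    k ∈ U (inv c x) ↔ (k ∈ U x ∧ k ∉ M c x) ∨ k ∈ N c x := by
  rw [mem_U_iff_Pol]
  constructor
  · rintro ⟨P, hP, hk, j, hj, hkj⟩
    obtain ⟨v, hv, rfl⟩ := (Pol_inv hc).1 hP
    have hvs := (isInitial_iff.1 hv).1
    have h1 := le_of_mem_invBlock hc hv hj
    rw [mem_invBlock hc hvs] at hk
    rcases hk with ⟨hk, hkM⟩ | ⟨hk, -⟩
    · exact Or.inl ⟨mem_U.2 ⟨v, hk.symm, h1.trans_lt hkj⟩, hkM⟩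
    · exact Or.inr hk
  · rintro (⟨hk, hkM⟩ | hk)
    · obtain ⟨j, hj, hkj⟩ := mem_U.1 hk
      have hks : k ∈ x.support := by
        rw [Perm.mem_support]
        intro hk
        exact hkj.ne' (hj.eq_of_left hk)
      obtain ⟨v, hv, hvk⟩ := exists_isInitial hks
      exact ⟨_, (Pol_inv hc).2 ⟨v, hv, rfl⟩,
        (mem_invBlock hc (isInitial_iff.1 hv).1).2 (Or.inl ⟨hvk, hkM⟩), v,
        min_mem_invBlock hc hv, ((isInitial_iff.1 hv).2 j (hvk.trans hj)).trans_lt hkj⟩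
    · obtain ⟨v, hv, hvk⟩ := exists_visible hc hx hk
      obtain ⟨-, ⟨a, ha, hak⟩, -⟩ := hvk.1
      have hvs := (isInitial_iff.1 hv).1
      exact ⟨_, (Pol_inv hc).2 ⟨v, hv, rfl⟩,
        (mem_invBlock hc hvs).2 (Or.inr ⟨hk, hvk⟩), v, min_mem_invBlock hc hv,
        ((isInitial_iff.1 hv).2 a ((mem_cycle hvs).1 ha)).trans_lt hak⟩

end

/-! ### Comparison of the two words -/

theorem exists_forall₂ {α β : Type*} {r : α → β → Prop} {l : List α} (h : ∀ a ∈ l, ∃ b, r a b) :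
    ∃ m, List.Forall₂ r l m := by
  induction l with
  | nil => exact ⟨[], List.Forall₂.nil⟩
  | cons a l ih =>
    obtain ⟨b, hb⟩ := h a (by simp)
    obtain ⟨m, hm⟩ := ih fun a ha => h a (List.mem_cons_of_mem _ ha)
    exact ⟨b :: m, List.Forall₂.cons hb hm⟩

theorem exists_of_forall₂_left {α β : Type*} {r : α → β → Prop} {l : List α} {m : List β}
    (h : List.Forall₂ r l m) {a : α} (ha : a ∈ l) : ∃ b ∈ m, r a b := by
  induction h with
  | nil => simp at ha
  | cons h1 h2 ih =>
    rcases List.mem_cons.1 ha with rfl | ha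
    · exact ⟨_, by simp, h1⟩
    · obtain ⟨b, hb, hr⟩ := ih ha
      exact ⟨b, List.mem_cons_of_mem _ hb, hr⟩

theorem flatten_flatMap_of_forall₂ {α β γ : Type*} {r : α → List β → Prop} {V : List α}
    {ts : List (List β)} (h : List.Forall₂ r V ts) (φ : β → List γ) (ψ : α → List γ)
    (hψ : ∀ v ∈ V, ∀ t, r v t → t.flatMap φ = ψ v) : ts.flatten.flatMap φ = V.flatMap ψ := by
  induction h with
  | nil => rfl
  | cons h1 h2 ih =>
    rw [List.flatten_cons, List.flatMap_append, List.flatMap_cons, hψ _ (by simp) _ h1,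
      ih fun v hv t ht => hψ v (List.mem_cons_of_mem _ hv) t ht]

/-- The smallest vertices of the polygons of `x`, in the order of the polygons. -/
def IsInitials (c x : Perm (Fin (n + 1))) (V : List (Fin (n + 1))) : Prop :=
  (∀ v, v ∈ V ↔ IsInitial x v) ∧ V.Pairwise (fun u v => ccwHt c u < ccwHt c v) ∧
    cycleList c x = V.map x.cycleOf

theorem exists_isInitials {c : Perm (Fin (n + 1))} (hc : IsStdCoxeter c)
    (x : Perm (Fin (n + 1))) : ∃ V, IsInitials c x V := by
  classical
  exact ⟨(ccwCircle c).filter fun v => decide (IsInitial x v), fun v => mem_initials hc,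
    hc.ccwCircle_pairwise.filter _, rfl⟩

theorem exists_standardForm {c x : Perm (Fin (n + 1))} (hc : IsStdCoxeter c) (hx : x ∈ NC c) :
    ∃ t, IsStandardForm c x t := by
  obtain ⟨V, hV, -, hl⟩ := exists_isInitials hc x
  obtain ⟨ts, hts⟩ : ∃ ts, List.Forall₂ IsDistinguished (cycleList c x) ts := by
    apply exists_forall₂
    intro σ hσ
    rw [hl, List.mem_map] at hσ
    obtain ⟨v, hv, rfl⟩ := hσ
    have hvs := (isInitial_iff.1 ((hV v).1 hv)).1
    apply exists_isDistinguished (Perm.isCycle_cycleOf x (Perm.mem_support.1 hvs))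
    intro k hk m hm hmk
    rw [mem_cycle hvs] at hk hm
    -- The smaller neighbour is the predecessor on the right side and the successor on the left
    -- side.
    by_cases hkR : k ∈ R c
    · right
      rw [Perm.cycleOf_inv, (Perm.sameCycle_inv.2 hk).cycleOf_apply]
      exact hc.inv_apply_lt_of_mem_R hx hkR (hk.symm.trans hm) hmk
    · left
      rw [hk.cycleOf_apply]
      exact hc.apply_lt_of_notMem_R hx hkR (hk.symm.trans hm) hmk
  exact ⟨_, ts, hts, rfl⟩

theorem IsDistinguished.mem_support {σ : Perm (Fin (n + 1))} {t : List (Fin (n + 1) × Fin (n + 1))}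
    (h : IsDistinguished σ t) {p : Fin (n + 1) × Fin (n + 1)} (hp : p ∈ t) :
    p.1 ∈ σ.support ∧ p.2 ∈ σ.support := by
  have h1 := h.1.mem_iff.1 hp
  have h2 := (List.of_mem_zip (a := p.1) (b := p.2) h1)
  exact ⟨(Finset.mem_sort _).1 h2.1, (Finset.mem_sort _).1 (List.mem_of_mem_tail h2.2)⟩

theorem zip_map_fst_sublist {α β : Type*} (A : List α) (B : List β) :
    ((A.zip B).map Prod.fst).Sublist A := by
  induction A generalizing B with
  | nil => simp
  | cons a A ih =>
    rcases B with _ | ⟨b, B⟩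
    · simp
    · rw [List.zip_cons_cons, List.map_cons]
      exact (ih B).cons_cons a

theorem zip_map_snd_sublist {α β : Type*} (A : List α) (B : List β) :
    ((A.zip B).map Prod.snd).Sublist B := by
  induction A generalizing B with
  | nil => simp
  | cons a A ih =>
    rcases B with _ | ⟨b, B⟩
    · simp
    · rw [List.zip_cons_cons, List.map_cons]
      exact (ih B).cons_cons b

theorem IsDistinguished.nodup {σ : Perm (Fin (n + 1))} {t : List (Fin (n + 1) × Fin (n + 1))}
    (h : IsDistinguished σ t) : (t.map Prod.fst).Nodup ∧ (t.map Prod.snd).Nodup := by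
  have h1 := σ.support.sort_nodup (· ≤ ·)
  constructor
  · rw [(h.1.map Prod.fst).nodup_iff]
    exact (zip_map_fst_sublist _ _).nodup h1
  · rw [(h.1.map Prod.snd).nodup_iff]
    exact ((zip_map_snd_sublist _ _).trans (List.tail_sublist _)).nodup h1

theorem nodup_map_flatten {x : Perm (Fin (n + 1))} {V : List (Fin (n + 1))}
    {ts : List (List (Fin (n + 1) × Fin (n + 1)))} (f : Fin (n + 1) × Fin (n + 1) → Fin (n + 1))
    (h : List.Forall₂ (fun v t => IsDistinguished (x.cycleOf v) t) V ts)
    (hf : ∀ v t, IsDistinguished (x.cycleOf v) t →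
      (t.map f).Nodup ∧ ∀ p ∈ t, f p ∈ (x.cycleOf v).support)
    (hV : V.Pairwise fun u v => ¬ x.SameCycle u v) : (ts.flatten.map f).Nodup ∧
      ∀ p ∈ ts.flatten, ∃ v ∈ V, x.SameCycle v (f p) := by
  induction h with
  | nil => simp
  | @cons v t V ts h1 h2 ih =>
    obtain ⟨hV1, hV2⟩ := List.pairwise_cons.1 hV
    obtain ⟨ih1, ih2⟩ := ih hV2
    obtain ⟨hf1, hf2⟩ := hf v t h1
    have hf3 : ∀ p ∈ t, x.SameCycle v (f p) := fun p hp =>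
      (Perm.mem_support_cycleOf_iff.1 (hf2 p hp)).1
    constructor
    · rw [List.flatten_cons, List.map_append, List.nodup_append]
      refine ⟨hf1, ih1, ?_⟩
      intro a ha b hb hab
      subst hab
      obtain ⟨p, hp, rfl⟩ := List.mem_map.1 ha
      obtain ⟨q, hq, hpq⟩ := List.mem_map.1 hb
      obtain ⟨w, hw, hwq⟩ := ih2 q hq
      apply hV1 w hw
      rw [hpq] at hwq
      exact (hf3 p hp).trans hwq.symm
    · intro p hp
      rw [List.flatten_cons, List.mem_append] at hp
      rcases hp with hp | hp
      · exact ⟨v, by simp, hf3 p hp⟩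
      · obtain ⟨w, hw, h3⟩ := ih2 p hp
        exact ⟨w, List.mem_cons_of_mem _ hw, h3⟩

theorem countP_eq_card {l : List (Fin (n + 1))} (hl : l.Nodup) {S : Finset (Fin (n + 1))}
    (h : ∀ v, v ∈ l ↔ v ∈ S) (p : Fin (n + 1) → Prop) [DecidablePred p] :
    l.countP (fun v => p v) = ∑ v, if v ∈ S ∧ p v then 1 else 0 := by
  rw [← Finset.card_filter, List.countP_eq_length_filter,
    ← List.toFinset_card_of_nodup (hl.filter _)]
  congr 1
  ext v
  simp [h]

/-- The edges of a standard form, with their basic properties. -/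
structure IsEdgeList (x : Perm (Fin (n + 1))) (t : List (Fin (n + 1) × Fin (n + 1))) : Prop where
  lt : ∀ p ∈ t, p.1 < p.2
  nodup_fst : (t.map Prod.fst).Nodup
  nodup_snd : (t.map Prod.snd).Nodup
  mem_fst : ∀ k, k ∈ t.map Prod.fst ↔ k ∈ D x
  mem_snd : ∀ k, k ∈ t.map Prod.snd ↔ k ∈ U x
  nested : ∀ k, ∀ P ∈ Pol x, Nested k P → ∃ p ∈ t, p.1 < k ∧ k < p.2

theorem isEdgeList {c x : Perm (Fin (n + 1))} {V : List (Fin (n + 1))} (hV : IsInitials c x V)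
    {ts : List (List (Fin (n + 1) × Fin (n + 1)))}
    (h : List.Forall₂ (fun v t => IsDistinguished (x.cycleOf v) t) V ts) :
    IsEdgeList x ts.flatten := by
  have hpw : V.Pairwise fun u v => ¬ x.SameCycle u v := by
    refine hV.2.1.imp_of_mem ?_
    intro u v hu hv huv hs
    rw [((hV.1 u).1 hu).eq_of_sameCycle ((hV.1 v).1 hv) hs] at huv
    exact lt_irrefl _ huv
  have hsrc : ∀ p ∈ ts.flatten, ∃ v t, IsDistinguished (x.cycleOf v) t ∧ p ∈ t := by
    clear hV hpw
    induction h with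
    | nil => simp
    | @cons v t V ts h1 h2 ih =>
      intro p hp
      rw [List.flatten_cons, List.mem_append] at hp
      rcases hp with hp | hp
      · exact ⟨v, t, h1, hp⟩
      · exact ih p hp
  have hend : ∀ p ∈ ts.flatten, p.1 < p.2 ∧ x.SameCycle p.1 p.2 := by
    intro p hp
    obtain ⟨v, t, ht, hpt⟩ := hsrc p hp
    obtain ⟨h1, h2⟩ := ht.mem_support hpt
    rw [Perm.mem_support_cycleOf_iff] at h1 h2
    exact ⟨ht.fst_lt_snd hpt, h1.1.symm.trans h2.1⟩
  have hblock : ∀ k ∈ x.support, ∃ v, IsInitial x v ∧ x.SameCycle v k ∧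
      ∃ t, IsDistinguished (x.cycleOf v) t ∧ ∀ p ∈ edgesAt k t, p ∈ ts.flatten := by
    intro k hk
    obtain ⟨v, hv, hvk⟩ := exists_isInitial hk
    obtain ⟨t, ht, hd⟩ := exists_of_forall₂_left h ((hV.1 v).2 hv)
    exact ⟨v, hv, hvk, t, hd, fun p hp => List.mem_flatten.2 ⟨t, ht, (List.mem_filter.1 hp).1⟩⟩
  refine ⟨fun p hp => (hend p hp).1, (nodup_map_flatten Prod.fst h ?_ hpw).1,
    (nodup_map_flatten Prod.snd h ?_ hpw).1, ?_, ?_, ?_⟩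
  · exact fun v t ht => ⟨ht.nodup.1, fun p hp => (ht.mem_support hp).1⟩
  · exact fun v t ht => ⟨ht.nodup.2, fun p hp => (ht.mem_support hp).2⟩
  · intro k
    rw [mem_D, List.mem_map]
    constructor
    · rintro ⟨p, hp, rfl⟩
      exact ⟨p.2, (hend p hp).2, (hend p hp).1⟩
    · rintro ⟨m, hkm, hlt⟩
      have hk : k ∈ x.support := by
        rw [Perm.mem_support]
        intro hk
        exact hlt.ne (hkm.eq_of_left hk)
      obtain ⟨v, hv, hvk, t, hd, ht⟩ := hblock k hk
      have hvs := (isInitial_iff.1 hv).1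
      have e1 := (mem_cycle hvs).2 hvk
      have e2 := (mem_cycle hvs).2 (hvk.trans hkm)
      rcases hd.edgesAt_cases k with ⟨h2 | h2 | h2, -⟩ | ⟨h4, -⟩ | ⟨-, -, j, hj, h6, h5⟩ |
        ⟨-, h2, -⟩ | ⟨-, i, hi, j, -, -, h6, h5⟩
      · exact absurd (h2 k e1) (lt_irrefl _)
      · exact absurd (h2 k e1) (lt_irrefl _)
      · exact absurd (h2 m e2) hlt.ne'
      · exact absurd e1 h4
      · exact ⟨(k, j), ht _ (by rw [h5]; simp), rfl⟩
      · exact absurd (h2 m e2) (not_le.2 hlt)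
      · exact ⟨(k, j), ht _ (by rw [h5.mem_iff]; simp), rfl⟩
  · intro k
    rw [mem_U, List.mem_map]
    constructor
    · rintro ⟨p, hp, rfl⟩
      exact ⟨p.1, (hend p hp).2.symm, (hend p hp).1⟩
    · rintro ⟨m, hkm, hlt⟩
      have hk : k ∈ x.support := by
        rw [Perm.mem_support]
        intro hk
        exact hlt.ne' (hkm.eq_of_left hk)
      obtain ⟨v, hv, hvk, t, hd, ht⟩ := hblock k hk
      have hvs := (isInitial_iff.1 hv).1
      have e1 := (mem_cycle hvs).2 hvk
      have e2 := (mem_cycle hvs).2 (hvk.trans hkm)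
      rcases hd.edgesAt_cases k with ⟨h2 | h2 | h2, -⟩ | ⟨h4, -⟩ | ⟨-, h2, -⟩ |
        ⟨-, -, i, hi, h6, h5⟩ | ⟨-, i, hi, j, -, -, h6, h5⟩
      · exact absurd (h2 k e1) (lt_irrefl _)
      · exact absurd (h2 k e1) (lt_irrefl _)
      · exact absurd (h2 m e2) hlt.ne
      · exact absurd e1 h4
      · exact absurd (h2 m e2) (not_le.2 hlt)
      · exact ⟨(i, k), ht _ (by rw [h5]; simp), rfl⟩
      · exact ⟨(i, k), ht _ (by rw [h5.mem_iff]; simp), rfl⟩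
  · intro k P hP hkP
    obtain ⟨w, hw, rfl⟩ := mem_Pol.1 hP
    obtain ⟨v, hv, hvw⟩ := exists_isInitial hw
    obtain ⟨t, ht, hd⟩ := exists_of_forall₂_left h ((hV.1 v).2 hv)
    rw [← hvw.cycleOf_eq] at hkP
    obtain ⟨h1, ⟨a, ha, hak⟩, b, hb, hkb⟩ := hkP
    rcases hd.edgesAt_cases k with ⟨h2 | h2 | h2, -⟩ | ⟨-, i, -, j, -, h4, h6, h5⟩ | ⟨h2, -⟩ |
        ⟨h2, -⟩ | ⟨h2, -⟩
    · exact absurd (h2 a ha) (not_lt.2 hak.le)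
    · exact absurd (h2 b hb) (not_lt.2 hkb.le)
    · exact absurd (h2 a ha) hak.ne
    · refine ⟨(i, j), List.mem_flatten.2 ⟨t, ht, ?_⟩, h4, h6⟩
      have : (i, j) ∈ edgesAt k t := by rw [h5]; simp
      exact (List.mem_filter.1 this).1
    all_goals exact absurd h2 h1

/-- The pairs of the normal form attached to `inv c x`. -/
noncomputable def normalPairs (c x : Perm (Fin (n + 1))) : List (Fin (n + 1) × Fin (n + 1)) :=
  ((D (inv c x)).sort (· ≤ ·)).zip ((U (inv c x)).sort (· ≤ ·))

theorem phi_eq (c x : Perm (Fin (n + 1))) : phi c x = wordProd (normalWord (normalPairs c x)) := by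
  rw [phi, g, normalWord, normalPairs, List.flatMap_def, List.map_zip_eq_zipWith]
  rfl

theorem not_mem_of_mem_N {c x : Perm (Fin (n + 1))} (hc : IsStdCoxeter c) {k : Fin (n + 1)}
    (hk : k ∈ N c x) : k ∉ D x ∧ k ∉ U x := by
  have h1 := (hc.mem_N.1 hk).2.1
  rw [Perm.mem_support, not_not] at h1
  constructor
  · intro h
    obtain ⟨j, hj, hkj⟩ := mem_D.1 h
    exact hkj.ne (hj.eq_of_left h1)
  · intro h
    obtain ⟨j, hj, hkj⟩ := mem_U.1 h
    exact hkj.ne' (hj.eq_of_left h1)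

/-- The points of `M c x` lie in both sets and those of `N c x` in neither, so toggling them
preserves the difference of the counts; it is written additively to avoid subtraction in `ℕ`. -/
theorem sum_indicator_inv {c x : Perm (Fin (n + 1))} (hc : IsStdCoxeter c) (hx : x ∈ NC c)
    (p : Fin (n + 1) → Prop) [DecidablePred p] :
    ((∑ v, if v ∈ D (inv c x) ∧ p v then 1 else 0) + ∑ v, if v ∈ U x ∧ p v then 1 else 0) =
      (∑ v, if v ∈ U (inv c x) ∧ p v then 1 else 0) + ∑ v, if v ∈ D x ∧ p v then 1 else 0 := by
  rw [← Finset.sum_add_distrib, ← Finset.sum_add_distrib]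
  apply Finset.sum_congr rfl
  intro v _
  have h1 := mem_D_inv hc hx (k := v)
  have h2 := mem_U_inv hc hx (k := v)
  have h3 := hc.mem_M (x := x) (k := v)
  have h4 := not_mem_of_mem_N hc (x := x) (k := v)
  grind

theorem IsEdgeList.countP_eq {c x : Perm (Fin (n + 1))} (hc : IsStdCoxeter c) (hx : x ∈ NC c)
    {t : List (Fin (n + 1) × Fin (n + 1))} (ht : IsEdgeList x t) (k : Fin (n + 1)) :
    (t.countP fun p => p.1 ≤ k ∧ k < p.2) +
      ((U (inv c x)).sort (· ≤ ·)).countP (fun v => v ≤ k) =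
    ((D (inv c x)).sort (· ≤ ·)).countP fun v => v ≤ k := by
  have h1 := countP_add_countP ht.lt k
  rw [countP_eq_card ht.nodup_fst ht.mem_fst, countP_eq_card ht.nodup_snd ht.mem_snd] at h1
  rw [countP_eq_card (Finset.sort_nodup _ _) (fun v => Finset.mem_sort _),
    countP_eq_card (Finset.sort_nodup _ _) (fun v => Finset.mem_sort _)]
  have h2 := sum_indicator_inv hc hx (fun v => v ≤ k)
  omega

theorem IsEdgeList.length_eq {c x : Perm (Fin (n + 1))} (hc : IsStdCoxeter c) (hx : x ∈ NC c)
    {t : List (Fin (n + 1) × Fin (n + 1))} (ht : IsEdgeList x t) :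
    ((U (inv c x)).sort (· ≤ ·)).length = ((D (inv c x)).sort (· ≤ ·)).length := by
  have h1 := ht.countP_eq hc hx (Fin.last n)
  have h2 : (t.countP fun p => p.1 ≤ Fin.last n ∧ Fin.last n < p.2) = 0 := by
    rw [List.countP_eq_zero]
    intro p _
    simp [Fin.le_last]
  have h3 : ∀ l : List (Fin (n + 1)), l.countP (fun v => v ≤ Fin.last n) = l.length := by
    intro l
    rw [List.countP_eq_length]
    intro v _
    simp [Fin.le_last]
  rw [h2, h3, h3] at h1
  omega

theorem countP_le_eq_add {l : List (Fin (n + 1))} (hl : l.Nodup) (k : Fin (n + 1)) :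
    l.countP (fun v => v ≤ k) = l.countP (fun v => v < k) + if k ∈ l then 1 else 0 := by
  induction l with
  | nil => simp
  | cons a l ih =>
    obtain ⟨h1, h2⟩ := List.nodup_cons.1 hl
    rw [List.countP_cons, List.countP_cons, ih h2]
    grind

/-- For the ballot condition at `k ∈ D (inv c x)` one edge starting at or passing over `k` is
needed: `k` starts one if it was in `D x`, and is nested under one if it was added. -/
theorem IsEdgeList.increasing {c x : Perm (Fin (n + 1))} (hc : IsStdCoxeter c) (hx : x ∈ NC c)
    {t : List (Fin (n + 1) × Fin (n + 1))} (ht : IsEdgeList x t) :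
    Increasing (normalPairs c x) := by
  have hD := (D (inv c x)).sortedLT_sort.pairwise
  have hU := (U (inv c x)).sortedLT_sort.pairwise
  refine ⟨zip_pairwise hD hU, zip_lt_of_countP hD hU ?_⟩
  intro k
  have h1 := ht.countP_eq hc hx k
  rw [countP_le_eq_add (Finset.sort_nodup (D (inv c x)) _)] at h1
  by_cases hk : k ∈ D (inv c x)
  · have h2 : 0 < t.countP fun p => p.1 ≤ k ∧ k < p.2 := by
      rw [List.countP_pos_iff]
      rcases (mem_D_inv hc hx).1 hk with ⟨h3, -⟩ | h3
      · obtain ⟨p, hp, rfl⟩ := List.mem_map.1 ((ht.mem_fst k).2 h3)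
        exact ⟨p, hp, by simpa using ht.lt p hp⟩
      · obtain ⟨-, -, P, hP, hkP⟩ := hc.mem_N.1 h3
        obtain ⟨p, hp, h4, h5⟩ := ht.nested k P hP hkP
        exact ⟨p, hp, by simpa using ⟨h4.le, h5⟩⟩
    split_ifs at h1 <;> omega
  · rw [if_neg (by rwa [Finset.mem_sort])] at h1
    omega

theorem map_normalPairs {c x : Perm (Fin (n + 1))} (hc : IsStdCoxeter c) (hx : x ∈ NC c)
    {t : List (Fin (n + 1) × Fin (n + 1))} (ht : IsEdgeList x t) :
    (normalPairs c x).map Prod.fst = (D (inv c x)).sort (· ≤ ·) ∧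
      (normalPairs c x).map Prod.snd = (U (inv c x)).sort (· ≤ ·) := by
  have h := ht.length_eq hc hx
  exact ⟨List.map_fst_zip h.ge, List.map_snd_zip h.le⟩

/-- Both counts are the number of starts minus the number of ends up to `k`. -/
theorem IsEdgeList.count_eq {c x : Perm (Fin (n + 1))} (hc : IsStdCoxeter c) (hx : x ∈ NC c)
    {t : List (Fin (n + 1) × Fin (n + 1))} (ht : IsEdgeList x t) (k : Fin n) :
    (extractedWord c t).count k = (normalWord (normalPairs c x)).count k := by
  have hZ := ht.increasing hc hx
  rw [extractedWord, normalWord, count_flatMap_eq_countP fun p hp =>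
    count_contribution hc t (ht.lt p hp) k, count_flatMap_eq_countP fun p _ => count_desc p k]
  have h1 := ht.countP_eq hc hx k.castSucc
  have h2 := countP_add_countP hZ.2 k.castSucc
  rw [(map_normalPairs hc hx ht).1, (map_normalPairs hc hx ht).2] at h2
  omega

/-! ### Alternating words and the order of the polygons around a point -/

theorem cons_replicate_flatten {β : Type*} (a b : β) (m : ℕ) :
    a :: (List.replicate m [b, a]).flatten = (List.replicate m [a, b]).flatten ++ [a] := by
  induction m with
  | zero => simp
  | succ m ih =>
    rw [List.replicate_succ, List.replicate_succ, List.flatten_cons, List.flatten_cons,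
      List.append_assoc, ← ih]
    rfl

theorem cons_replicate_flatten_append {β : Type*} (a b : β) (m : ℕ) :
    [a] ++ (List.replicate m [b, a]).flatten ++ [b] =
      (List.replicate (m + 1) [a, b]).flatten := by
  rw [List.singleton_append, cons_replicate_flatten, List.replicate_succ', List.flatten_append]
  simp

theorem count_replicate_flatten {β : Type*} [DecidableEq β] (b : β) (w : List β) (m : ℕ) :
    (List.replicate m w).flatten.count b = m * w.count b := by
  induction m with
  | zero => simp
  | succ m ih =>
    rw [List.replicate_succ, List.flatten_cons, List.count_append, ih]
    ring

/-- The order of the polygons at an initial or terminal point `k`. -/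
theorem ccwHt_lt_of_nested {c x : Perm (Fin (n + 1))} (hc : IsStdCoxeter c) (hx : x ∈ NC c)
    {k u v : Fin (n + 1)} (hu : IsInitial x u) (hv : IsInitial x v) (huk : x.SameCycle u k)
    (hk : k = u ∨ ∀ j, x.SameCycle k j → j ≤ k) (hkv : Nested k (x.cycleOf v).support) :
    (k ∈ R c → ccwHt c u < ccwHt c v) ∧ (k ∉ R c → ccwHt c v < ccwHt c u) := by
  obtain ⟨hvs, hvm⟩ := isInitial_iff.1 hv
  obtain ⟨hus, hum⟩ := isInitial_iff.1 hu
  obtain ⟨h1, ⟨a, ha, hak⟩, b, hb, hkb⟩ := (nested_cycle_iff hvs).1 hkv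
  have hvk : v < k := (hvm a ha).trans_lt hak
  have huv : u ≠ v := by
    rintro rfl
    exact h1 huk
  have hs := hc.not_sep hx huk hb (fun h => h1 (h.symm.trans huk))
  have huk' := hum k huk
  have p1 := hc.pos_of_mem_R (v := u)
  have p2 := hc.pos_of_mem_R (v := v)
  have p3 := hc.pos_of_mem_R (v := k)
  have p4 := hc.pos_of_mem_R (v := b)
  have b1 := u.2
  have b2 := v.2
  have b3 := k.2
  have b4 := b.2
  have huv' : (u : ℕ) ≠ v := fun h => huv (Fin.ext h)
  rw [Fin.lt_def] at hvk hkb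
  rw [Fin.le_def] at huk'
  rcases hk with rfl | hk
  -- For an initial point the inequality `v < k` alone decides the order.
  · unfold ccwHt
    by_cases r1 : k ∈ R c <;> by_cases r2 : v ∈ R c <;>
      simp only [r1, r2, if_true, if_false, not_true_eq_false, not_false_eq_true, forall_const,
        IsEmpty.forall_iff, and_true, true_and] at p1 p2 ⊢ <;> omega
  · have huk'' : u ≠ k := by
      rintro rfl
      have h2 : x.SameCycle u (x u) := Perm.sameCycle_apply_right.2 (Perm.SameCycle.refl _ _)
      exact (Perm.mem_support.1 hus) (le_antisymm (hk _ h2) (hum _ h2))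
    have huk3 : (u : ℕ) ≠ k := fun h => huk'' (Fin.ext h)
    -- For a terminal point the order follows from the noncrossing of the chords from `u` to `k` and
    -- from `v` to `b`.
    unfold Sep Btw ht at hs
    unfold ccwHt
    by_cases r1 : u ∈ R c <;> by_cases r2 : v ∈ R c <;> by_cases r3 : k ∈ R c <;>
      by_cases r4 : b ∈ R c <;>
      simp only [r1, r2, r3, r4, if_true, if_false, not_true_eq_false, not_false_eq_true,
        forall_const, IsEmpty.forall_iff, and_true, true_and] at p1 p2 p3 p4 hs ⊢ <;> omega

/-- The polygons that do not contain `k` contribute a power of `w`. -/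
theorem exists_replicate {α β : Type*} (V : List α) (ψ : α → List β) (w : List β) (q : α → Prop)
    (h : ∀ v ∈ V, (q v ∧ ψ v = w) ∨ (¬ q v ∧ ψ v = [])) :
    ∃ m, V.flatMap ψ = (List.replicate m w).flatten ∧ ((∀ v ∈ V, ¬ q v) → m = 0) ∧
      (m = 0 → ∀ v ∈ V, ¬ q v) := by
  induction V with
  | nil => exact ⟨0, by simp⟩
  | cons v V ih =>
    obtain ⟨m, h1, h2, h3⟩ := ih fun v hv => h v (List.mem_cons_of_mem _ hv)
    rcases h v (by simp) with ⟨h4, h5⟩ | ⟨h4, h5⟩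
    · refine ⟨m + 1, ?_, fun h6 => absurd h4 (h6 v (by simp)), by simp⟩
      rw [List.flatMap_cons, h1, h5, List.replicate_succ, List.flatten_cons]
    · refine ⟨m, by rw [List.flatMap_cons, h1, h5, List.nil_append],
        fun h6 => h2 fun v hv => h6 v (List.mem_cons_of_mem _ hv), fun h6 u hu => ?_⟩
      rcases List.mem_cons.1 hu with rfl | hu
      · exact h4
      · exact h3 h6 u hu

open scoped Classical in
/-- The contribution at the point `k` of the polygon with smallest vertex `v`. -/
noncomputable def polygonWord {β : Type*} (x : Perm (Fin (n + 1))) (w : List β) (a b : β)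
    (k v : Fin (n + 1)) : List β :=
  if x.SameCycle v k then
    if k ∈ D x then if k ∈ U x then if k < x k then [a, b] else [b, a] else [b] else [a]
  else if Nested k (x.cycleOf v).support then w else []

theorem flatMap_eq_polygonWord {β : Type*} {x : Perm (Fin (n + 1))} (w : List β) (a b : β)
    (k : Fin (n + 1)) {v : Fin (n + 1)} (hv : v ∈ x.support)
    {t : List (Fin (n + 1) × Fin (n + 1))} (ht : IsDistinguished (x.cycleOf v) t) :
    t.flatMap (edgeWord w a b k) = polygonWord x w a b k v := by
  unfold polygonWord
  split_ifs with h1 h2 h3 h4 h5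
  · obtain ⟨j, hj, hkj⟩ := mem_D.1 h2
    obtain ⟨i, hi, hik⟩ := mem_U.1 h3
    apply (ht.flatMap_of_mid w a b k ((mem_cycle hv).2 h1) ((mem_cycle hv).2 (h1.trans hi))
      ((mem_cycle hv).2 (h1.trans hj)) hik hkj).1
    rwa [h1.cycleOf_apply]
  · obtain ⟨j, hj, hkj⟩ := mem_D.1 h2
    obtain ⟨i, hi, hik⟩ := mem_U.1 h3
    apply (ht.flatMap_of_mid w a b k ((mem_cycle hv).2 h1) ((mem_cycle hv).2 (h1.trans hi))
      ((mem_cycle hv).2 (h1.trans hj)) hik hkj).2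
    rw [h1.cycleOf_apply]
    refine lt_of_le_of_ne (not_lt.1 h4) fun h5 => ?_
    exact hkj.ne (hj.eq_of_left h5)
  · obtain ⟨j, hj, hkj⟩ := mem_D.1 h2
    refine ht.flatMap_of_min w a b k ?_ ((mem_cycle hv).2 h1) ((mem_cycle hv).2 (h1.trans hj)) hkj
    intro i hi
    by_contra hik
    exact h3 (mem_U.2 ⟨i, h1.symm.trans ((mem_cycle hv).1 hi), not_le.1 hik⟩)
  · have hmax : ∀ i, x.SameCycle k i → i ≤ k := by
      intro i hi
      by_contra hik
      exact h2 (mem_D.2 ⟨i, hi, not_le.1 hik⟩)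
    have hks := sameCycle_mem_support h1 hv
    have h3 : x.SameCycle k (x k) := Perm.sameCycle_apply_right.2 (Perm.SameCycle.refl _ _)
    refine ht.flatMap_of_max w a b k ?_ ((mem_cycle hv).2 h1) ((mem_cycle hv).2 (h1.trans h3))
      (lt_of_le_of_ne (hmax _ h3) (Perm.mem_support.1 hks))
    intro i hi
    exact hmax i (h1.symm.trans ((mem_cycle hv).1 hi))
  · exact ht.flatMap_of_nested w a b k h5
  · exact ht.flatMap_of_not_nested w a b k (fun h => h1 ((mem_cycle hv).1 h)) h5

theorem polygonWord_cases {β : Type*} {x : Perm (Fin (n + 1))} (w : List β) (a b : β)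
    {k v : Fin (n + 1)} (h : ¬ x.SameCycle v k) :
    (Nested k (x.cycleOf v).support ∧ polygonWord x w a b k v = w) ∨
      (¬ Nested k (x.cycleOf v).support ∧ polygonWord x w a b k v = []) := by
  by_cases h1 : Nested k (x.cycleOf v).support
  · exact Or.inl ⟨h1, by rw [polygonWord, if_neg h, if_pos h1]⟩
  · exact Or.inr ⟨h1, by rw [polygonWord, if_neg h, if_neg h1]⟩

open scoped Classical in
/-- The explicit form of the projection of the extracted word at the point `k`. -/
theorem flatMap_polygonWord {β : Type*} {c x : Perm (Fin (n + 1))} (hc : IsStdCoxeter c)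
    (hx : x ∈ NC c) {V : List (Fin (n + 1))} (hV : IsInitials c x V) {a b : β}
    {k : Fin (n + 1)} (w : List β)
    (hw : w = if (k ∈ D x ∧ k ∉ R c) ∨ (k ∉ D x ∧ k ∈ R c) then [b, a] else [a, b]) :
    ∃ m, V.flatMap (polygonWord x w a b k) =
      (if k ∈ U (inv c x) then [a] else []) ++ (List.replicate m [b, a]).flatten ++
        (if k ∈ D (inv c x) then [b] else []) := by
  have hD := mem_D_inv hc hx (k := k)
  have hU := mem_U_inv hc hx (k := k)
  have hM := hc.mem_M (x := x) (k := k)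
  by_cases hks : k ∈ x.support
  · have hNk : k ∉ N c x := fun h => (hc.mem_N.1 h).2.1 hks
    obtain ⟨v0, hv0, hv0k⟩ := exists_isInitial hks
    obtain ⟨V1, V2, rfl⟩ := List.append_of_mem ((hV.1 v0).2 hv0)
    have hp := hV.2.1
    rw [List.pairwise_append, List.pairwise_cons] at hp
    obtain ⟨-, ⟨hp2, -⟩, hp1⟩ := hp
    have hns : ∀ v, IsInitial x v → ccwHt c v ≠ ccwHt c v0 → ¬ x.SameCycle v k := by
      intro v hv hne h
      exact hne (by rw [hv.eq_of_sameCycle hv0 (h.trans hv0k.symm)])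
    have i1 : ∀ v ∈ V1, IsInitial x v ∧ ccwHt c v < ccwHt c v0 := fun v hv =>
      ⟨(hV.1 v).1 (by simp [hv]), hp1 v hv v0 (by simp)⟩
    have i2 : ∀ v ∈ V2, IsInitial x v ∧ ccwHt c v0 < ccwHt c v := fun v hv =>
      ⟨(hV.1 v).1 (by simp [hv]), hp2 v hv⟩
    obtain ⟨m1, e1, z1, -⟩ := exists_replicate V1 (polygonWord x w a b k) w _ fun v hv =>
      polygonWord_cases w a b (hns v (i1 v hv).1 (i1 v hv).2.ne)
    obtain ⟨m2, e2, z2, -⟩ := exists_replicate V2 (polygonWord x w a b k) w _ fun v hv =>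
      polygonWord_cases w a b (hns v (i2 v hv).1 (i2 v hv).2.ne')
    -- At an initial or terminal `k`, the polygon through `k` precedes all polygons nesting `k` on
    -- the right side and follows them on the left side, so one of the two blocks of copies of `w`
    -- is empty.
    have hz : (k = v0 ∨ ∀ j, x.SameCycle k j → j ≤ k) → (k ∈ R c → m1 = 0) ∧
        (k ∉ R c → m2 = 0) := by
      intro hk
      constructor
      · intro hkR
        apply z1
        intro v hv hn
        have := (ccwHt_lt_of_nested hc hx hv0 (i1 v hv).1 hv0k hk hn).1 hkR
        exact absurd this (not_lt.2 (i1 v hv).2.le)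
      · intro hkR
        apply z2
        intro v hv hn
        have := (ccwHt_lt_of_nested hc hx hv0 (i2 v hv).1 hv0k hk hn).2 hkR
        exact absurd this (not_lt.2 (i2 v hv).2.le)
    rw [List.flatMap_append, List.flatMap_cons, e1, e2]
    by_cases hkD : k ∈ D x
    · by_cases hkU : k ∈ U x
      · obtain ⟨j, hj, hkj⟩ := mem_D.1 hkD
        obtain ⟨i, hi, hik⟩ := mem_U.1 hkU
        by_cases hkR : k ∈ R c
        -- Intermediate vertex on the right: the polygon through `k` also contributes `ab`, and
        -- `(ab)^(m+1) = a(ba)^m b`.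
        · have hlt := hc.lt_apply_of_mem_R hx hkR hj hkj
          have e3 : polygonWord x w a b k v0 = [a, b] := by
            simp [polygonWord, hv0k, hkD, hkU, hlt]
          have hw' : w = [a, b] := by simpa [hkD, hkR] using hw
          have hD' := hD.2 (Or.inl ⟨hkD, fun h => (hM.1 h).2.2 hkR⟩)
          have hU' := hU.2 (Or.inl ⟨hkU, fun h => (hM.1 h).2.2 hkR⟩)
          refine ⟨m1 + m2, ?_⟩
          rw [e3, hw', if_pos hD', if_pos hU', cons_replicate_flatten_append, add_assoc,
            List.replicate_add, List.replicate_succ]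
          simp
        -- Intermediate vertex on the left: all contributions are `ba`, and the involution removes
        -- `k`.
        · have hlt := hc.apply_lt_of_notMem_R hx hkR hi hik
          have e3 : polygonWord x w a b k v0 = [b, a] := by
            simp [polygonWord, hv0k, hkD, hkU, hlt.not_gt]
          have hw' : w = [b, a] := by simpa [hkD, hkR] using hw
          have hM' := hM.2 ⟨hkD, hkU, hkR⟩
          have hD' : k ∉ D (inv c x) := fun h => (hD.1 h).elim (fun h => h.2 hM') hNk
          have hU' : k ∉ U (inv c x) := fun h => (hU.1 h).elim (fun h => h.2 hM') hNk
          refine ⟨m1 + (m2 + 1), ?_⟩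
          rw [e3, hw', if_neg hD', if_neg hU', List.replicate_add, List.replicate_succ]
          simp
      · have hkv : k = v0 := by
          have h1 := (isInitial_iff.1 hv0).2 k hv0k
          rcases h1.lt_or_eq with h2 | h2
          · exact absurd (mem_U.2 ⟨v0, hv0k.symm, h2⟩) hkU
          · exact h2.symm
        have hz' := hz (Or.inl hkv)
        have e3 : polygonWord x w a b k v0 = [b] := by
          simp [polygonWord, hv0k, hkD, hkU]
        have hD' := hD.2 (Or.inl ⟨hkD, fun h => hkU (hM.1 h).2.1⟩)
        have hU' : k ∉ U (inv c x) := fun h => (hU.1 h).elim (fun h => hkU h.1) hNk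
        rw [e3, if_pos hD', if_neg hU']
        -- Initial vertex: `b(ab)^m = (ba)^m b` on the right, and `(ba)^m b` directly on the left.
        by_cases hkR : k ∈ R c
        · have hw' : w = [a, b] := by simpa [hkD, hkR] using hw
          refine ⟨m2, ?_⟩
          rw [hz'.1 hkR, hw', List.nil_append, ← cons_replicate_flatten]
          simp
        · have hw' : w = [b, a] := by simpa [hkD, hkR] using hw
          refine ⟨m1, ?_⟩
          rw [hz'.2 hkR, hw']
          simp
    · have hmax : ∀ j, x.SameCycle k j → j ≤ k := by
        intro i hi
        by_contra hik
        exact hkD (mem_D.2 ⟨i, hi, not_le.1 hik⟩)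
      have hkU : k ∈ U x := by
        have h3 : x.SameCycle k (x k) := Perm.sameCycle_apply_right.2 (Perm.SameCycle.refl _ _)
        exact mem_U.2 ⟨_, h3, lt_of_le_of_ne (hmax _ h3) (Perm.mem_support.1 hks)⟩
      have hz' := hz (Or.inr hmax)
      have e3 : polygonWord x w a b k v0 = [a] := by
        simp [polygonWord, hv0k, hkD]
      have hD' : k ∉ D (inv c x) := fun h => (hD.1 h).elim (fun h => hkD h.1) hNk
      have hU' := hU.2 (Or.inl ⟨hkU, fun h => hkD (hM.1 h).1⟩)
      rw [e3, if_neg hD', if_pos hU']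
      -- Terminal vertex: `a(ba)^m` directly on the right, and `(ab)^m a = a(ba)^m` on the left.
      by_cases hkR : k ∈ R c
      · have hw' : w = [b, a] := by simpa [hkD, hkR] using hw
        refine ⟨m2, ?_⟩
        rw [hz'.1 hkR, hw']
        simp
      · have hw' : w = [a, b] := by simpa [hkD, hkR] using hw
        refine ⟨m1, ?_⟩
        rw [hz'.2 hkR, hw', List.singleton_append (l := (List.replicate m1 [b, a]).flatten),
          cons_replicate_flatten]
        simp
  · have hkD : k ∉ D x := by
      intro h
      obtain ⟨j, hj, hkj⟩ := mem_D.1 h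
      rw [Perm.mem_support, not_not] at hks
      exact hkj.ne (hj.eq_of_left hks)
    have hkU : k ∉ U x := by
      intro h
      obtain ⟨j, hj, hkj⟩ := mem_U.1 h
      rw [Perm.mem_support, not_not] at hks
      exact hkj.ne' (hj.eq_of_left hks)
    have hns : ∀ v ∈ V, ¬ x.SameCycle v k := fun v hv h =>
      hks (sameCycle_mem_support h (isInitial_iff.1 ((hV.1 v).1 hv)).1)
    obtain ⟨m, e, z, z'⟩ := exists_replicate V (polygonWord x w a b k) w _ fun v hv =>
      polygonWord_cases w a b (hns v hv)
    rw [e]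
    by_cases hkR : k ∈ R c
    · have hNk : k ∉ N c x := fun h => (hc.mem_N.1 h).1 hkR
      have hD' : k ∉ D (inv c x) := fun h => (hD.1 h).elim (fun h => hkD h.1) hNk
      have hU' : k ∉ U (inv c x) := fun h => (hU.1 h).elim (fun h => hkU h.1) hNk
      have hw' : w = [b, a] := by simpa [hkD, hkR] using hw
      exact ⟨m, by rw [hw', if_neg hD', if_neg hU']; simp⟩
    · have hw' : w = [a, b] := by simpa [hkD, hkR] using hw
      by_cases hNk : k ∈ N c x
      · have hD' := hD.2 (Or.inr hNk)
        have hU' := hU.2 (Or.inr hNk)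
        rw [if_pos hD', if_pos hU', hw']
        -- A visible polygon nests `k`, so there is at least one block `ab`; rewriting the power
        -- with outer letters `a` and `b` lowers the exponent by one.
        rcases m with _ | m
        · exfalso
          obtain ⟨v, hv, hvk⟩ := exists_visible hc hx hNk
          exact z' rfl v ((hV.1 v).2 hv) hvk.1
        · refine ⟨m, ?_⟩
          rw [cons_replicate_flatten_append]
      · have hD' : k ∉ D (inv c x) := fun h => (hD.1 h).elim (fun h => hkD h.1) hNk
        have hU' : k ∉ U (inv c x) := fun h => (hU.1 h).elim (fun h => hkU h.1) hNk
        have hm : m = 0 := by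
          apply z
          intro v hv hn
          exact hNk (hc.mem_N.2 ⟨hkR, hks, _,
            mem_Pol.2 ⟨v, (isInitial_iff.1 ((hV.1 v).1 hv)).1, rfl⟩, hn⟩)
        exact ⟨0, by rw [if_neg hD', if_neg hU', hm]; simp⟩

theorem isCenter_iff {x : Perm (Fin (n + 1))} {t : List (Fin (n + 1) × Fin (n + 1))}
    (ht : IsEdgeList x t) (k : Fin n) : IsCenter t k ↔ k.castSucc ∈ D x := by
  rw [← ht.mem_fst, IsCenter, List.mem_map]
  simp only [centerPart, List.mem_filter, List.mem_finRange, true_and, decide_eq_true_eq]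
  exact exists_congr fun p => and_congr_right fun _ => eq_comm

/-- The projections of the extracted word and of the normal form to adjacent letters agree. -/
theorem filter_extractedWord {c x : Perm (Fin (n + 1))} (hc : IsStdCoxeter c) (hx : x ∈ NC c)
    {V : List (Fin (n + 1))} (hV : IsInitials c x V)
    {ts : List (List (Fin (n + 1) × Fin (n + 1)))}
    (h : List.Forall₂ (fun v t => IsDistinguished (x.cycleOf v) t) V ts)
    {a b : Fin n} (hab : (a : ℕ) + 1 = b) :
    (extractedWord c ts.flatten).filter (fun y => decide (y = a ∨ y = b)) =
      (normalWord (normalPairs c x)).filter fun y => decide (y = a ∨ y = b) := by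
  classical
  have ht := isEdgeList hV h
  have hZ := ht.increasing hc hx
  have hcount := ht.count_eq hc hx b
  have hne : a ≠ b := by rintro rfl; omega
  have hL : FromLeft c ts.flatten b ↔ (b.castSucc ∈ D x ∧ b.castSucc ∉ R c) ∨
      (b.castSucc ∉ D x ∧ b.castSucc ∈ R c) := by
    have h1 := hc.mem_L (v := b.castSucc)
    have h2 : b.castSucc ≠ 0 := by intro h; simp [Fin.ext_iff] at h; omega
    have h3 : b.castSucc ≠ Fin.last n := (Fin.castSucc_lt_last b).ne
    rw [FromLeft, isCenter_iff ht]
    tauto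
  have e1 : (extractedWord c ts.flatten).filter (fun y => decide (y = a ∨ y = b)) =
      V.flatMap (polygonWord x (if FromLeft c ts.flatten b then [b, a] else [a, b]) a b
        b.castSucc) := by
    rw [extractedWord, List.filter_flatMap, ← flatten_flatMap_of_forall₂ h
      (edgeWord (if FromLeft c ts.flatten b then [b, a] else [a, b]) a b b.castSucc)]
    · apply List.flatMap_congr
      intro p hp
      exact filter_contribution hc _ hab (ht.lt p hp)
    · intro v hv t hvt
      exact flatMap_eq_polygonWord _ a b _ (isInitial_iff.1 ((hV.1 v).1 hv)).1 hvt
  obtain ⟨m, hm⟩ := flatMap_polygonWord hc hx hV (a := a) (b := b) (k := b.castSucc)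
    (if FromLeft c ts.flatten b then [b, a] else [a, b]) (by simp only [hL])
  have e2 : (normalWord (normalPairs c x)).filter (fun y => decide (y = a ∨ y = b)) =
      (normalPairs c x).flatMap (edgeWord [b, a] a b b.castSucc) := by
    rw [normalWord, List.filter_flatMap]
    apply List.flatMap_congr
    intro p hp
    exact filter_desc hab (hZ.2 p hp)
  obtain ⟨m', hm'⟩ := hZ.flatMap_edgeWord a b b.castSucc
  obtain ⟨f1, f2⟩ := map_normalPairs hc hx ht
  simp only [f1, f2, Finset.mem_sort] at hm'
  -- Both projections have the same shape; the exponents agree because `b` occurs equally often in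
  -- the two words.
  rw [← List.count_filter (p := fun y => decide (y = a ∨ y = b)) (by simp), e1, hm,
    ← List.count_filter (p := fun y => decide (y = a ∨ y = b)) (l := normalWord _) (by simp), e2,
    hm'] at hcount
  simp only [List.count_append, count_replicate_flatten] at hcount
  have h3 : [b, a].count b = 1 := by simp [hne]
  rw [h3] at hcount
  have h4 : m = m' := by omega
  rw [e1, e2, hm, hm', h4]

/-- Tightness involves only the product and the length, so it passes from the normal form to the
extracted word. -/
theorem wordProd_extractedWord {c x : Perm (Fin (n + 1))} (hc : IsStdCoxeter c) (hx : x ∈ NC c)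
    {t : List (Fin (n + 1) × Fin (n + 1))} (ht : IsStandardForm c x t) :
    wordProd (extractedWord c t) = phi c x ∧ Tight (extractedWord c t) := by
  obtain ⟨V, hV⟩ := exists_isInitials hc x
  obtain ⟨ts, hts, rfl⟩ := ht
  rw [hV.2.2, List.forall₂_map_left_iff] at hts
  have he := isEdgeList hV hts
  have hcount := he.count_eq hc hx
  have hprod : wordProd (extractedWord c ts.flatten) =
      wordProd (normalWord (normalPairs c x)) := by
    apply prod_map_eq_of_projections s _ _ hcount
    intro i j hij hn
    have hij' : (i : ℕ) ≠ j := fun h => hij (Fin.ext h)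
    have hadj : (i : ℕ) + 1 = j ∨ (j : ℕ) + 1 = i := by
      by_contra h
      exact hn (commute_s (by omega))
    rcases hadj with h | h
    · exact filter_extractedWord hc hx hV hts h
    · have := filter_extractedWord hc hx hV hts h
      simpa only [or_comm] using this
  refine ⟨by rw [phi_eq, hprod], ?_⟩
  have hlen : (extractedWord c ts.flatten).length = (normalWord (normalPairs c x)).length :=
    (List.perm_iff_count.2 hcount).length_eq
  have htight := (he.increasing hc hx).tight
  unfold Tight at *
  rw [hprod, hlen, htight]

end NCFC

theorem mainTheorem2 (n : ℕ) (c x : Equiv.Perm (Fin (n + 1))) (hc : NCFC.IsStdCoxeter c)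
    (hx : x ∈ NCFC.NC c) :
    (∃ t, NCFC.IsStandardForm c x t) ∧
    ∀ t, NCFC.IsStandardForm c x t →
      NCFC.IsReduced (NCFC.extractedWord c t) ∧
      NCFC.IsFullyCommutative (NCFC.wordProd (NCFC.extractedWord c t)) ∧
      NCFC.phi c x = NCFC.wordProd (NCFC.extractedWord c t) := by
  refine ⟨NCFC.exists_standardForm hc hx, fun t ht => ?_⟩
  obtain ⟨h1, h2⟩ := NCFC.wordProd_extractedWord hc hx ht
  exact ⟨h2.isReduced, h2.isFullyCommutative, h1.symm⟩
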